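/- Let $A$ be a normal subgroup of a finite group $G$, $Q=G/A$, $\pi\colon G\to Q$ the projection, and let $\alpha\colon G\times G\to\mathbb S^1$ be a normalized 2-cocycle: $\alpha(gh,k)\alpha(g,h)=\alpha(g,hk)\alpha(h,k)$ and $\alpha(g,1)=\alpha(1,g)=1$. For a finite group $H$ with a normalized $\mathbb S^1$-valued 2-cocycle $\beta$, let $\widetilde H_\beta=H\times\mathbb S^1$ with product $(g,z)(h,w)=(gh,\beta(g,h)zw)$. For a compact Hausdorff $H$-space $X$, let ${}^{\beta}K^0_H(X)$ be the Grothendieck group of isomorphism classes of $\widetilde H_\beta$-equivariant complex vector bundles over $X$ on which $\mathbb S^1$ acts by multiplication of scalars, and for $n>0$ let ${}^{\beta}K^n_H(X)={}^{\beta}\widetilde K^0_H(\Sigma^nX_+)$, where $X_+$ is $X$ with a base point added, $\Sigma^n$ is the $n$-fold reduced suspension, and $\widetilde K^0$ is the kernel of restriction to the base point. Let $\mathrm{Irr}^\alpha(A)$ be the set of isomorphism classes of finite-dimensional irreducible complex $\alpha$-representations of $A$, that is, of maps $\tau\colon A\to \mathrm{GL}(V_\tau)$ with $\tau(1)=1$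 and $\tau(a)\tau(b)=\alpha(a,b)\tau(ab)$; put $\tilde\tau(a,z)=z\tau(a)$ for $(a,z)\in\widetilde A_\alpha$. The group $G$ acts on $\mathrm{Irr}^\alpha(A)$ by $(g\cdot\tau)(a)=\alpha(g^{-1}a,g)\,\alpha(g,g^{-1}a)^{-1}\,\tau(g^{-1}ag)$. Let $G_{[\tau]}=\{g\in G: g\cdot\tau\cong\tau\}$ and $Q_{[\tau]}=G_{[\tau]}/A$. For every irreducible $\alpha$-representation $\tau$ of $A$ one can choose an $A$-invariant Hermitian inner product on $V_\tau$, a map $\sigma\colon Q_{[\tau]}\to G_{[\tau]}$ with $\pi\circ\sigma=\mathrm{id}$ and $\sigma(1)=1$, and unitary maps $M_q$ of $V_\tau$ $(q\in Q_{[\tau]})$ with $M_1=1$ and $(\sigma(q)\cdot\tau)(a)=M_q^{-1}\tau(a)M_q$ for all $a\in A$. Given such choices, a normalized 2-cocycle $\beta_{\tau,\alpha}$ on $Q_{[\tau]}$ with values in $\mathbb S^1$ is defined by $$\beta_{\tau,\alpha}(q_1,q_2)\,\mathrm{Id}_{V_\tau}=t(q_1,q_2)\,\tau(\chi(q_1,q_2))\,M_{q_2}^{-1}M_{q_1}^{-1}M_{q_1q_2},$$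 where $\chi(q_1,q_2)=\sigma(q_1q_2)^{-1}\sigma(q_1)\sigma(q_2)$ and $t(q_1,q_2)=\alpha(\sigma(q_1q_2),\chi(q_1,q_2))^{-1}\alpha(\sigma(q_1),\sigma(q_2))$. Fix one such $\tau$, with such choices, for each $G$-orbit in $\mathrm{Irr}^\alpha(A)$. Then for all compact Hausdorff $G$-spaces $X$ on which $A$ acts trivially and all $n\ge 0$ there are isomorphisms of abelian groups $$\Phi_X\colon {}^{\alpha}K^n_G(X)\to\bigoplus_{[\tau]\in G\backslash \mathrm{Irr}^\alpha(A)}{}^{\beta_{\tau,\alpha}}K^n_{Q_{[\tau]}}(X),\qquad [E]\mapsto\bigoplus_{[\tau]}\big[\mathrm{Hom}_{\widetilde A_\alpha}(\mathbb V_\tau,E)\big],$$ natural with respect to continuous $G$-maps of such spaces. Here $\mathbb V_\tau$ is the trivial bundle with fibre $V_\tau$ on which $\widetilde A_\alpha$ acts through $\tilde\tau$, and $(q,z)\in(\widetilde{Q_{[\tau]}})_{\beta_{\tau,\alpha}}$ acts on $\mathrm{Hom}_{\widetilde A_\alpha}(\mathbb V_\tau,E)$ by $((q,z)\cdot f)(v)=z\,(\sigma(q),1)\cdot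 f(M_q^{-1}v)$. For $n>0$ the elements of ${}^{\alpha}K^n_G(X)$ are differences $[E]-[E']$ of classes of bundles over $\Sigma^nX_+$, and the formula is applied to $E$ and $E'$. -/

import Mathlib

universe u v w

noncomputable section

namespace TwistedK

/-! ### Normalized cocycles and the associated central extensions -/

/-- A normalized `2`-cocycle on `G` with values in `𝕊¹`. -/
structure NormalizedCocycle (G : Type w) [Group G] where
  toFun : G → G → Circle
  cocycle : ∀ g h k, toFun (g * h) k * toFun g h = toFun g (h * k) * toFun h k
  map_one_right : ∀ g, toFun g 1 = 1
  map_one_left : ∀ g, toFun 1 g = 1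

namespace NormalizedCocycle

variable {G : Type w} [Group G]

instance : CoeFun (NormalizedCocycle G) (fun _ => G → G → Circle) := ⟨toFun⟩

/-- The restriction of a cocycle to a subgroup. -/
def res (α : NormalizedCocycle G) (A : Subgroup G) : NormalizedCocycle A where
  toFun a b := α a b
  cocycle a b c := α.cocycle a b c
  map_one_right a := α.map_one_right a
  map_one_left a := α.map_one_left a

end NormalizedCocycle

/-- The central extension of `G` by `𝕊¹` defined by `α`: the set of pairs `(g, z)` with
`(g₁, z₁) (g₂, z₂) = (g₁ g₂, α(g₁, g₂) z₁ z₂)`. -/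
@[ext]
structure CentralExt {G : Type w} [Group G] (α : NormalizedCocycle G) where
  base : G
  phase : Circle

namespace CentralExt

variable {G : Type w} [Group G] {α : NormalizedCocycle G}

instance : Mul (CentralExt α) :=
  ⟨fun x y => ⟨x.base * y.base, α x.base y.base * x.phase * y.phase⟩⟩

instance : One (CentralExt α) := ⟨⟨1, 1⟩⟩

instance : Inv (CentralExt α) :=
  ⟨fun x => ⟨x.base⁻¹, (α x.base⁻¹ x.base)⁻¹ * x.phase⁻¹⟩⟩

@[simp] theorem mul_base (x y : CentralExt α) : (x * y).base = x.base * y.base := rfl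

@[simp] theorem mul_phase (x y : CentralExt α) :
    (x * y).phase = α x.base y.base * x.phase * y.phase := rfl

@[simp] theorem one_base : (1 : CentralExt α).base = 1 := rfl

@[simp] theorem one_phase : (1 : CentralExt α).phase = 1 := rfl

@[simp] theorem inv_base (x : CentralExt α) : (x⁻¹).base = x.base⁻¹ := rfl

theorem inv_phase (x : CentralExt α) :
    (x⁻¹).phase = (α x.base⁻¹ x.base)⁻¹ * x.phase⁻¹ := rfl

instance : Group (CentralExt α) := Group.ofLeftAxioms
  (fun x y z => CentralExt.ext (mul_assoc _ _ _) (by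
    simp only [mul_phase, mul_base]
    have := α.cocycle x.base y.base z.base
    calc _ = (α (x.base * y.base) z.base * α x.base y.base) *
          (x.phase * y.phase * z.phase) := by ac_rfl
      _ = _ := by rw [this]; ac_rfl))
  (fun x => CentralExt.ext (one_mul _) (by simp [α.map_one_left]))
  (fun x => CentralExt.ext (inv_mul_cancel _) (by simp [inv_phase]))

/-- The topology of `G × 𝕊¹`, where `G` is discrete. -/
instance : TopologicalSpace (CentralExt α) :=
  TopologicalSpace.induced (fun x => (x.base, x.phase))
    (@instTopologicalSpaceProd G Circle ⊥ inferInstance)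

theorem continuous_of_base {T S : Type*} [TopologicalSpace T] [TopologicalSpace S]
    {F : CentralExt α × T → S}
    (h : ∀ g : G, Continuous (fun p : Circle × T => F (⟨g, p.1⟩, p.2))) : Continuous F := by
  let _ : TopologicalSpace G := ⊥
  have : DiscreteTopology G := ⟨rfl⟩
  have h1 : Continuous (fun x : CentralExt α => (x.base, x.phase)) := continuous_induced_dom
  have h2 : Continuous (fun p : G × (Circle × T) => F (⟨p.1, p.2.1⟩, p.2.2)) := by
    rw [continuous_prod_of_discrete_left]
    exact h
  exact h2.comp ((continuous_fst.comp (h1.comp continuous_fst)).prodMk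
    ((continuous_snd.comp (h1.comp continuous_fst)).prodMk continuous_snd))

theorem continuous_mk (g : G) : Continuous (fun z : Circle => (⟨g, z⟩ : CentralExt α)) := by
  let _ : TopologicalSpace G := ⊥
  exact continuous_induced_rng.2 (continuous_const.prodMk continuous_id)

theorem continuous_base_smul {T : Type*} [TopologicalSpace T] [MulAction G T]
    [ContinuousConstSMul G T] : Continuous (fun p : CentralExt α × T => p.1.base • p.2) :=
  continuous_of_base fun g => (continuous_const_smul g).comp continuous_snd

/-- The inclusion of the central circle. -/
def ofCircle (z : Circle) : CentralExt α := ⟨1, z⟩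

/-- The set-theoretic lift `g ↦ (g, 1)`. -/
def lift (α : NormalizedCocycle G) (g : G) : CentralExt α := ⟨g, 1⟩

/-- The inclusion of the central extension of a subgroup `A` into the one of `G`. -/
def incl (α : NormalizedCocycle G) (A : Subgroup G) : CentralExt (α.res A) →* CentralExt α where
  toFun x := ⟨x.base, x.phase⟩
  map_one' := rfl
  map_mul' _ _ := rfl

@[simp] theorem incl_base (A : Subgroup G) (x : CentralExt (α.res A)) :
    (incl α A x).base = x.base := rfl

@[simp] theorem incl_phase (A : Subgroup G) (x : CentralExt (α.res A)) :
    (incl α A x).phase = x.phase := rfl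

theorem incl_injective (A : Subgroup G) : Function.Injective (incl α A) := by
  intro x y h
  have h1 := congrArg CentralExt.base h
  have h2 := congrArg CentralExt.phase h
  exact CentralExt.ext (Subtype.ext h1) h2

/-- For `A` normal in `G`, the conjugation `x ↦ γ⁻¹ x γ` on the central extension of `A`. -/
def conj {A : Subgroup G} [hA : A.Normal] (γ : CentralExt α) :
    CentralExt (α.res A) →* CentralExt (α.res A) where
  toFun x := ⟨⟨γ.base⁻¹ * x.base * γ.base, hA.conj_mem' _ x.base.2 _⟩,
    (γ⁻¹ * incl α A x * γ).phase⟩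
  map_one' := incl_injective A (by
    change γ⁻¹ * incl α A 1 * γ = 1
    simp)
  map_mul' x y := incl_injective A (by
    change γ⁻¹ * incl α A (x * y) * γ = (γ⁻¹ * incl α A x * γ) * (γ⁻¹ * incl α A y * γ)
    simp only [map_mul]; group)

theorem incl_conj {A : Subgroup G} [A.Normal] (γ : CentralExt α) (x : CentralExt (α.res A)) :
    incl α A (conj γ x) = γ⁻¹ * incl α A x * γ := rfl

theorem conj_one {A : Subgroup G} [A.Normal] (x : CentralExt (α.res A)) :
    conj (1 : CentralExt α) x = x := incl_injective A (by simp [incl_conj])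

theorem conj_mul {A : Subgroup G} [A.Normal] (γ δ : CentralExt α) (x : CentralExt (α.res A)) :
    conj (γ * δ) x = conj δ (conj γ x) := incl_injective A (by
      simp only [incl_conj]; group)

theorem conj_incl {A : Subgroup G} [A.Normal] (y x : CentralExt (α.res A)) :
    conj (incl α A y) x = y⁻¹ * x * y := incl_injective A (by
      simp only [incl_conj, map_mul, map_inv])

theorem ofCircle_comm (z : Circle) (x : CentralExt α) : ofCircle z * x = x * ofCircle z :=
  CentralExt.ext (by simp [ofCircle]) (by
    simp [ofCircle, α.map_one_left, α.map_one_right, mul_comm])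

theorem eq_ofCircle_mul_lift (x : CentralExt α) : x = ofCircle x.phase * lift α x.base :=
  CentralExt.ext (by simp [ofCircle, lift]) (by simp [ofCircle, lift, α.map_one_left])

theorem conj_ofCircle {A : Subgroup G} [A.Normal] (γ : CentralExt α) (z : Circle) :
    conj γ (ofCircle z : CentralExt (α.res A)) = ofCircle z := incl_injective A (by
      rw [incl_conj]
      have : incl α A (ofCircle z) = ofCircle z := rfl
      rw [this, mul_assoc, ofCircle_comm, inv_mul_cancel_left])

/-- Explicit form of the conjugation by `(g, 1)`. -/
theorem conj_lift_lift {A : Subgroup G} [hA : A.Normal] (g : G) (a : A) :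
    conj (lift α g) (lift (α.res A) a) =
      ⟨⟨g⁻¹ * a * g, hA.conj_mem' _ a.2 _⟩, α (g⁻¹ * a) g * (α g (g⁻¹ * a))⁻¹⟩ := by
  refine CentralExt.ext rfl ?_
  change ((lift α g)⁻¹ * incl α A (lift (α.res A) a) * lift α g).phase = _
  simp only [mul_phase, mul_base, inv_base, inv_phase, lift, incl_base]
  change α (g⁻¹ * a) g * (α g⁻¹ a * ((α g⁻¹ g)⁻¹ * 1⁻¹) * 1) * 1 = _
  have h1 := α.cocycle g g⁻¹ a
  have h2 := α.cocycle g⁻¹ g g⁻¹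
  simp only [mul_inv_cancel, inv_mul_cancel, α.map_one_left, α.map_one_right, one_mul] at h1 h2
  rw [h2, h1]
  simp only [inv_one, mul_one, mul_inv, mul_comm (α.toFun g (g⁻¹ * a))⁻¹, mul_inv_cancel_left,
    one_mul]

end CentralExt

/-! ### Projective representations -/

/-- An `α`-representation of `G` on a finite-dimensional complex vector space `V`: a map
`ρ : G → GL(V)` with `ρ(g) ρ(h) = α(g, h) ρ(g h)` and `ρ(1) = 1` (invertibility of the `ρ(g)`
follows from these two conditions). -/
structure ProjRep {G : Type w} [Group G] (α : NormalizedCocycle G) where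
  V : Type
  [addCommGroup : AddCommGroup V]
  [module : Module ℂ V]
  [finiteDimensional : FiniteDimensional ℂ V]
  ρ : G → Module.End ℂ V
  map_one : ρ 1 = 1
  map_mul : ∀ g h, ρ g * ρ h = (α g h : ℂ) • ρ (g * h)

attribute [instance] ProjRep.addCommGroup ProjRep.module ProjRep.finiteDimensional

namespace ProjRep

variable {G : Type w} [Group G]

section

variable {α : NormalizedCocycle G}

/-- `ρ` is irreducible: `V ≠ 0` and the only invariant subspaces are `0` and `V`. -/
def IsIrreducible (ρ : ProjRep α) : Prop :=
  Nontrivial ρ.V ∧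
    ∀ W : Submodule ℂ ρ.V, (∀ g, ∀ v ∈ W, ρ.ρ g v ∈ W) → W = ⊥ ∨ W = ⊤

/-- Two `α`-representations are isomorphic if there is an equivariant linear isomorphism. -/
def IsIso (ρ τ : ProjRep α) : Prop :=
  ∃ f : ρ.V ≃ₗ[ℂ] τ.V, ∀ g v, f (ρ.ρ g v) = τ.ρ g (f v)

/-- The representation `(g, z) ↦ z ρ(g)` of the central extension. -/
def tilde (ρ : ProjRep α) : CentralExt α →* Module.End ℂ ρ.V where
  toFun x := (x.phase : ℂ) • ρ.ρ x.base
  map_one' := by simp [ρ.map_one]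
  map_mul' x y := by
    simp only [CentralExt.mul_phase, CentralExt.mul_base, smul_mul_smul_comm, ρ.map_mul, smul_smul,
      Circle.coe_mul]
    congr 1; ring

theorem tilde_apply (ρ : ProjRep α) (x : CentralExt α) :
    ρ.tilde x = (x.phase : ℂ) • ρ.ρ x.base := rfl

theorem tilde_lift (ρ : ProjRep α) (g : G) : ρ.tilde (CentralExt.lift α g) = ρ.ρ g := by
  simp [tilde_apply, CentralExt.lift]

end

variable {α : NormalizedCocycle G} {A : Subgroup G} [hA : A.Normal]

/-- The translate `(g · ρ)(a) = α(g⁻¹a, g) α(g, g⁻¹a)⁻¹ ρ(g⁻¹ a g)` of an `α`-representation `ρ`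
of the normal subgroup `A`. -/
def translate (g : G) (ρ : ProjRep (α.res A)) : ProjRep (α.res A) where
  V := ρ.V
  ρ a := ((α (g⁻¹ * a) g * (α g (g⁻¹ * a))⁻¹ : Circle) : ℂ) •
    ρ.ρ ⟨g⁻¹ * a * g, hA.conj_mem' _ a.2 _⟩
  map_one := by
    have := congrArg (ρ.tilde) (CentralExt.conj_lift_lift (α := α) g (1 : A))
    rw [show CentralExt.lift (α.res A) 1 = 1 from rfl, _root_.map_one, _root_.map_one] at this
    exact this.symm
  map_mul a b := by
    have h : ∀ a : A, ((α (g⁻¹ * a) g * (α g (g⁻¹ * a))⁻¹ : Circle) : ℂ) •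
        ρ.ρ ⟨g⁻¹ * a * g, hA.conj_mem' _ a.2 _⟩ =
        ρ.tilde (CentralExt.conj (CentralExt.lift α g) (CentralExt.lift (α.res A) a)) := by
      intro a
      rw [CentralExt.conj_lift_lift]
      rfl
    rw [h, h, h, ← _root_.map_mul, ← _root_.map_mul]
    have h2 : CentralExt.lift (α.res A) a * CentralExt.lift (α.res A) b =
        CentralExt.ofCircle (α.res A a b) * CentralExt.lift (α.res A) (a * b) :=
      CentralExt.ext (by simp [CentralExt.lift, CentralExt.ofCircle])
        (by simp [CentralExt.lift, CentralExt.ofCircle, NormalizedCocycle.map_one_left])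
    rw [h2, _root_.map_mul, CentralExt.conj_ofCircle, _root_.map_mul]
    simp [tilde_apply, CentralExt.ofCircle, ρ.map_one]
    exact smul_comm _ _ _

theorem translate_tilde (g : G) (ρ : ProjRep (α.res A)) (x : CentralExt (α.res A)) :
    (ρ.translate g).tilde x = ρ.tilde (CentralExt.conj (CentralExt.lift α g) x) := by
  have h : (ρ.translate g).ρ x.base =
      ρ.tilde (CentralExt.conj (CentralExt.lift α g) (CentralExt.lift (α.res A) x.base)) := by
    rw [CentralExt.conj_lift_lift]
    rfl
  rw [tilde_apply, h]
  conv_rhs => rw [x.eq_ofCircle_mul_lift, _root_.map_mul, CentralExt.conj_ofCircle,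
    _root_.map_mul]
  simp [tilde_apply, CentralExt.ofCircle, ρ.map_one]
  exact smul_comm (M := ℂ) (N := ℂ) (α := Module.End ℂ ρ.V) _ _ _

theorem translate_one (ρ : ProjRep (α.res A)) (a : A) :
    (ρ.translate (1 : G)).ρ a = ρ.ρ a := by
  rw [← tilde_lift, translate_tilde]
  change ρ.tilde (CentralExt.conj (1 : CentralExt α) _) = _
  rw [CentralExt.conj_one, tilde_lift]

theorem translate_mul (g h : G) (ρ : ProjRep (α.res A)) (a : A) :
    (ρ.translate (g * h)).ρ a = ((ρ.translate h).translate g).ρ a := by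
  rw [← tilde_lift, ← tilde_lift, translate_tilde, translate_tilde]
  change _ = (ρ.translate h).tilde _
  rw [translate_tilde, ← CentralExt.conj_mul]
  have h2 : CentralExt.lift α g * CentralExt.lift α h =
      CentralExt.ofCircle (α g h) * CentralExt.lift α (g * h) :=
    CentralExt.ext (by simp [CentralExt.lift, CentralExt.ofCircle])
      (by simp [CentralExt.lift, CentralExt.ofCircle, NormalizedCocycle.map_one_left])
  rw [h2, CentralExt.conj_mul]
  congr 2
  apply CentralExt.incl_injective A
  rw [CentralExt.incl_conj, mul_assoc, ← CentralExt.ofCircle_comm, inv_mul_cancel_left]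

theorem IsIso.refl (ρ : ProjRep α) : ρ.IsIso ρ := ⟨LinearEquiv.refl ℂ _, fun _ _ => rfl⟩

theorem IsIso.symm {ρ τ : ProjRep α} : ρ.IsIso τ → τ.IsIso ρ := fun ⟨f, hf⟩ =>
  ⟨f.symm, fun g v => by rw [LinearEquiv.symm_apply_eq, hf, LinearEquiv.apply_symm_apply]⟩

theorem IsIso.trans {ρ τ κ : ProjRep α} : ρ.IsIso τ → τ.IsIso κ → ρ.IsIso κ :=
  fun ⟨f, hf⟩ ⟨e, he⟩ => ⟨f.trans e, fun g v => by simp [hf, he]⟩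

theorem IsIso.translate {ρ τ : ProjRep (α.res A)} (g : G) :
    ρ.IsIso τ → (ρ.translate g).IsIso (τ.translate g) :=
  fun ⟨f, hf⟩ => ⟨f, fun a v => by
    exact (f.map_smul _ _).trans (congrArg _ (hf _ _))⟩

theorem isIso_translate_one (ρ : ProjRep (α.res A)) : (ρ.translate (1 : G)).IsIso ρ :=
  ⟨LinearEquiv.refl ℂ _, fun a v => congrArg (fun T : Module.End ℂ ρ.V => T v) (translate_one ρ a)⟩

theorem isIso_translate_mul (g h : G) (ρ : ProjRep (α.res A)) :
    (ρ.translate (g * h)).IsIso ((ρ.translate h).translate g) :=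
  ⟨LinearEquiv.refl ℂ _, fun a v =>
    congrArg (fun T : Module.End ℂ ρ.V => T v) (translate_mul g h ρ a)⟩

theorem IsIrreducible.translate {ρ : ProjRep (α.res A)} (h : ρ.IsIrreducible) (g : G) :
    (ρ.translate g).IsIrreducible := by
  refine ⟨h.1, fun W hW => h.2 W fun a v hv => ?_⟩
  have h1 : ρ.ρ a = ((ρ.translate g).translate g⁻¹).ρ a := by
    rw [← translate_mul, inv_mul_cancel, translate_one]
  rw [h1]
  exact W.smul_mem _ (hW _ _ hv)

/-- The isotropy group `G_[τ] = {g | g · τ ≅ τ}`. -/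
def stab (τ : ProjRep (α.res A)) : Subgroup G where
  carrier := {g | (τ.translate g).IsIso τ}
  one_mem' := isIso_translate_one τ
  mul_mem' := fun {g _} hg hh => (isIso_translate_mul g _ τ).trans ((hh.translate g).trans hg)
  inv_mem' := fun {g} hg => by
    have h1 := (hg.translate g⁻¹).symm.trans (isIso_translate_mul g⁻¹ g τ).symm
    rw [inv_mul_cancel] at h1
    exact h1.trans (isIso_translate_one τ)

/-- The subgroup `Q_[τ] = G_[τ] / A` of `Q = G / A`. -/
def quotStab (τ : ProjRep (α.res A)) : Subgroup (G ⧸ A) := τ.stab.map (QuotientGroup.mk' A)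

end ProjRep

/-- Isomorphism of irreducible representations. -/
def irrSetoid {G : Type w} [Group G] (α : NormalizedCocycle G) :
    Setoid {ρ : ProjRep α // ρ.IsIrreducible} where
  r ρ τ := ρ.1.IsIso τ.1
  iseqv := ⟨fun ρ => ProjRep.IsIso.refl ρ.1, ProjRep.IsIso.symm, ProjRep.IsIso.trans⟩

/-- `Irr^α(G)`: the isomorphism classes of irreducible `α`-representations of `G`. -/
def Irr {G : Type w} [Group G] (α : NormalizedCocycle G) : Type _ := Quotient (irrSetoid α)

/-- The class of an irreducible representation. -/
def Irr.mk {G : Type w} [Group G] {α : NormalizedCocycle G} (ρ : ProjRep α)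
    (h : ρ.IsIrreducible) : Irr α := Quotient.mk (irrSetoid α) ⟨ρ, h⟩

/-- The action of `G` on `Irr^α(A)`, for `A` normal in `G`: `g · [ρ] = [g · ρ]`. -/
instance Irr.mulAction {G : Type w} [Group G] (α : NormalizedCocycle G) (A : Subgroup G)
    [A.Normal] : MulAction G (Irr (α.res A)) where
  smul g := Quotient.map (fun ρ => ⟨ρ.1.translate g, ρ.2.translate g⟩)
    fun _ _ h => ProjRep.IsIso.translate g h
  one_smul c := Quotient.inductionOn c fun ρ => Quotient.sound (ProjRep.isIso_translate_one ρ.1)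
  mul_smul g h c :=
    Quotient.inductionOn c fun ρ => Quotient.sound (ProjRep.isIso_translate_mul g h ρ.1)

/-! ### The cocycles `β_{τ,α}` -/

/-- The choices entering the construction of `β_{τ,α}`: an `A`-invariant Hermitian inner product
on `V_τ` (so that `τ : A → U(V_τ)`), a section `σ : Q_[τ] → G_[τ]` of the projection with
`σ(1) = 1`, and unitary maps `M_q` with `M_1 = 1` and `σ(q) · τ(a) = M_q⁻¹ τ(a) M_q`. -/
structure Frame {G : Type w} [Group G] {α : NormalizedCocycle G} {A : Subgroup G} [A.Normal]
    (τ : ProjRep (α.res A)) where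
  form : InnerProductSpace.Core ℂ τ.V
  unitary : ∀ a v v', form.inner (τ.ρ a v) (τ.ρ a v') = form.inner v v'
  σ : τ.quotStab → G
  σ_mem : ∀ q, σ q ∈ τ.stab
  mk_σ : ∀ q, (σ q : G ⧸ A) = q
  σ_one : σ 1 = 1
  M : τ.quotStab → (τ.V ≃ₗ[ℂ] τ.V)
  M_unitary : ∀ q v v', form.inner (M q v) (M q v') = form.inner v v'
  M_one : M 1 = LinearEquiv.refl ℂ τ.V
  M_spec : ∀ q a v, (τ.translate (σ q)).ρ a v = (M q).symm (τ.ρ a (M q v))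

namespace Frame

variable {G : Type w} [Group G] {α : NormalizedCocycle G} {A : Subgroup G} [A.Normal]
  {τ : ProjRep (α.res A)} (F : Frame τ)

/-- `(χ(q₁, q₂), τ(q₁, q₂))`, where `χ(q₁, q₂) = σ(q₁ q₂)⁻¹ σ(q₁) σ(q₂) ∈ A` and
`τ(q₁, q₂) = α(σ(q₁ q₂), χ(q₁, q₂))⁻¹ α(σ(q₁), σ(q₂))`, as an element of the central extension
of `A`. -/
def chi (q₁ q₂ : τ.quotStab) : CentralExt (α.res A) where
  base := ⟨(F.σ (q₁ * q₂))⁻¹ * F.σ q₁ * F.σ q₂, by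
    rw [← QuotientGroup.eq_one_iff]
    simp [F.mk_σ]⟩
  phase := (α (F.σ (q₁ * q₂)) ((F.σ (q₁ * q₂))⁻¹ * F.σ q₁ * F.σ q₂))⁻¹ * α (F.σ q₁) (F.σ q₂)

/-- `M_q` as an endomorphism. -/
def endM (q : τ.quotStab) : Module.End ℂ τ.V := (F.M q).toLinearMap

/-- `M_q⁻¹` as an endomorphism. -/
def endMinv (q : τ.quotStab) : Module.End ℂ τ.V := (F.M q).symm.toLinearMap

/-- The endomorphism `τ̃(χ(q₁, q₂), τ(q₁, q₂)) M_{q₂}⁻¹ M_{q₁}⁻¹ M_{q₁q₂}`. -/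
def betaEnd (q₁ q₂ : τ.quotStab) : Module.End ℂ τ.V :=
  τ.tilde (F.chi q₁ q₂) * F.endMinv q₂ * F.endMinv q₁ * F.endM (q₁ * q₂)

theorem endM_mul_endMinv (q : τ.quotStab) : F.endM q * F.endMinv q = 1 :=
  LinearMap.ext fun v => (F.M q).apply_symm_apply v

theorem endMinv_mul_endM (q : τ.quotStab) : F.endMinv q * F.endM q = 1 :=
  LinearMap.ext fun v => (F.M q).symm_apply_apply v

theorem incl_chi (q₁ q₂ : τ.quotStab) :
    CentralExt.incl α A (F.chi q₁ q₂) = (CentralExt.lift α (F.σ (q₁ * q₂)))⁻¹ *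
      CentralExt.lift α (F.σ q₁) * CentralExt.lift α (F.σ q₂) := by
  rw [mul_assoc, eq_inv_mul_iff_mul_eq]
  exact CentralExt.ext (by simp [CentralExt.lift, chi, mul_assoc])
    (by simp [CentralExt.lift, chi])

theorem tilde_conj (q : τ.quotStab) (x : CentralExt (α.res A)) :
    τ.tilde (CentralExt.conj (CentralExt.lift α (F.σ q)) x) =
      F.endMinv q * τ.tilde x * F.endM q := by
  rw [← ProjRep.translate_tilde]
  refine LinearMap.ext fun v => ?_
  exact (congrArg (fun u : τ.V => (x.phase : ℂ) • u) (F.M_spec q x.base v)).trans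
    ((F.M q).symm.map_smul _ _).symm

theorem tilde_conj_mul_endMinv (q : τ.quotStab) (x : CentralExt (α.res A)) :
    τ.tilde (CentralExt.conj (CentralExt.lift α (F.σ q)) x) * F.endMinv q =
      F.endMinv q * τ.tilde x := by
  rw [tilde_conj, mul_assoc, endM_mul_endMinv, mul_one]

theorem betaEnd_comm (q₁ q₂ : τ.quotStab) (x : CentralExt (α.res A)) :
    τ.tilde x * F.betaEnd q₁ q₂ = F.betaEnd q₁ q₂ * τ.tilde x := by
  obtain ⟨y, rfl⟩ : ∃ y, CentralExt.conj (CentralExt.lift α (F.σ (q₁ * q₂))) y = x :=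
    ⟨CentralExt.conj (CentralExt.lift α (F.σ (q₁ * q₂)))⁻¹ x, by
      rw [← CentralExt.conj_mul, inv_mul_cancel, CentralExt.conj_one]⟩
  have key : F.chi q₁ q₂ * CentralExt.conj (CentralExt.lift α (F.σ q₂))
      (CentralExt.conj (CentralExt.lift α (F.σ q₁)) y) =
      CentralExt.conj (CentralExt.lift α (F.σ (q₁ * q₂))) y * F.chi q₁ q₂ := by
    apply CentralExt.incl_injective A
    simp only [map_mul, CentralExt.incl_conj, incl_chi]
    group
  calc _ = τ.tilde (CentralExt.conj (CentralExt.lift α (F.σ (q₁ * q₂))) y * F.chi q₁ q₂) *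
        F.endMinv q₂ * F.endMinv q₁ * F.endM (q₁ * q₂) := by
        simp only [betaEnd, map_mul, mul_assoc]
    _ = τ.tilde (F.chi q₁ q₂) * F.endMinv q₂ * F.endMinv q₁ * τ.tilde y *
        F.endM (q₁ * q₂) := by
        rw [← key, map_mul]
        rw [mul_assoc (τ.tilde (F.chi q₁ q₂)), tilde_conj_mul_endMinv]
        rw [← mul_assoc (τ.tilde (F.chi q₁ q₂)), mul_assoc _ (τ.tilde _) (F.endMinv q₁),
          tilde_conj_mul_endMinv]
        simp only [mul_assoc]
    _ = _ := by
        rw [tilde_conj, betaEnd]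
        have := F.endM_mul_endMinv (q₁ * q₂)
        simp only [mul_assoc]
        rw [← mul_assoc (F.endM (q₁ * q₂)) (F.endMinv (q₁ * q₂)), this, one_mul]

theorem inner_smul_smul (c : ℂ) (v v' : τ.V) :
    F.form.inner (c • v) (c • v') = (starRingEnd ℂ c * c) * F.form.inner v v' := by
  rw [F.form.smul_left, ← F.form.conj_inner_symm, F.form.smul_left, map_mul,
    F.form.conj_inner_symm, RingHomCompTriple.comp_apply, RingHom.id_apply, mul_assoc]

theorem inner_circle_smul (z : Circle) (v v' : τ.V) :
    F.form.inner ((z : ℂ) • v) ((z : ℂ) • v') = F.form.inner v v' := by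
  rw [inner_smul_smul, ← Circle.coe_inv_eq_conj, ← Circle.coe_mul, inv_mul_cancel, Circle.coe_one,
    one_mul]

theorem tilde_unitary (x : CentralExt (α.res A)) (v v' : τ.V) :
    F.form.inner (τ.tilde x v) (τ.tilde x v') = F.form.inner v v' := by
  rw [ProjRep.tilde_apply, LinearMap.smul_apply, LinearMap.smul_apply, F.inner_circle_smul,
    F.unitary]

theorem endM_unitary (q : τ.quotStab) (v v' : τ.V) :
    F.form.inner (F.endM q v) (F.endM q v') = F.form.inner v v' := F.M_unitary q v v'

theorem endMinv_unitary (q : τ.quotStab) (v v' : τ.V) :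
    F.form.inner (F.endMinv q v) (F.endMinv q v') = F.form.inner v v' := by
  rw [← F.M_unitary q]
  simp [endMinv]

theorem betaEnd_unitary (q₁ q₂ : τ.quotStab) (v v' : τ.V) :
    F.form.inner (F.betaEnd q₁ q₂ v) (F.betaEnd q₁ q₂ v') = F.form.inner v v' := by
  simp only [betaEnd, Module.End.mul_apply, tilde_unitary, endMinv_unitary, endM_unitary]

/-- By Schur's lemma and unitarity, `τ̃(χ(q₁, q₂), τ(q₁, q₂)) M_{q₂}⁻¹ M_{q₁}⁻¹ M_{q₁q₂}` is a
scalar of modulus one. -/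
theorem exists_beta (hτ : τ.IsIrreducible) (q₁ q₂ : τ.quotStab) :
    ∃ z : Circle, F.betaEnd q₁ q₂ = (z : ℂ) • (1 : Module.End ℂ τ.V) := by
  have := hτ.1
  obtain ⟨c, hc⟩ := Module.End.exists_eigenvalue (F.betaEnd q₁ q₂)
  have htop : Module.End.eigenspace (F.betaEnd q₁ q₂) c = ⊤ := by
    refine (hτ.2 _ fun a v hv => ?_).resolve_left hc
    rw [Module.End.mem_eigenspace_iff] at hv ⊢
    have h := congrArg (fun T : Module.End ℂ τ.V => T v)
      (F.betaEnd_comm q₁ q₂ (CentralExt.lift (α.res A) a))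
    simp only [Module.End.mul_apply, ProjRep.tilde_lift, hv, map_smul] at h
    exact h.symm
  have hT : ∀ v, F.betaEnd q₁ q₂ v = c • v := fun v =>
    Module.End.mem_eigenspace_iff.1 (htop ▸ Submodule.mem_top)
  obtain ⟨v, hv⟩ := exists_ne (0 : τ.V)
  have h := F.betaEnd_unitary q₁ q₂ v v
  rw [hT, inner_smul_smul] at h
  have h1 : starRingEnd ℂ c * c = 1 :=
    mul_right_cancel₀ (fun h0 => hv (F.form.definite v h0)) (h.trans (one_mul _).symm)
  have h2 : ‖c‖ = 1 := by
    rw [← sq_eq_sq₀ (norm_nonneg c) zero_le_one, one_pow]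
    rw [Complex.conj_mul'] at h1
    exact_mod_cast h1
  exact ⟨⟨c, mem_sphere_zero_iff_norm.2 h2⟩, LinearMap.ext hT⟩

/-- The function `β_{τ,α}`, characterized by
`β_{τ,α}(q₁, q₂) = τ̃(χ(q₁, q₂), τ(q₁, q₂)) M_{q₂}⁻¹ M_{q₁}⁻¹ M_{q₁q₂}`. -/
def betaFun (hτ : τ.IsIrreducible) (q₁ q₂ : τ.quotStab) : Circle :=
  (F.exists_beta hτ q₁ q₂).choose

theorem betaFun_spec (hτ : τ.IsIrreducible) (q₁ q₂ : τ.quotStab) :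
    F.betaEnd q₁ q₂ = (F.betaFun hτ q₁ q₂ : ℂ) • (1 : Module.End ℂ τ.V) :=
  (F.exists_beta hτ q₁ q₂).choose_spec

theorem beta_endMinv (hτ : τ.IsIrreducible) (q₁ q₂ : τ.quotStab) :
    τ.tilde (F.chi q₁ q₂) * F.endMinv q₂ * F.endMinv q₁ =
      (F.betaFun hτ q₁ q₂ : ℂ) • F.endMinv (q₁ * q₂) := by
  have h := F.betaFun_spec hτ q₁ q₂
  rw [betaEnd] at h
  have h2 := congrArg (· * F.endMinv (q₁ * q₂)) h
  simp only [mul_assoc, endM_mul_endMinv, mul_one, smul_mul_assoc, one_mul] at h2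
  simpa only [mul_assoc] using h2

theorem circle_eq_of_smul_endMinv (hτ : τ.IsIrreducible) (q : τ.quotStab) {z z' : Circle}
    (h : (z : ℂ) • F.endMinv q = (z' : ℂ) • F.endMinv q) : z = z' := by
  have := hτ.1
  obtain ⟨v, hv⟩ := exists_ne (0 : τ.V)
  have h1 := congrArg (fun T : Module.End ℂ τ.V => T (F.M q v)) h
  simp only [LinearMap.smul_apply, endMinv, LinearEquiv.coe_coe, LinearEquiv.symm_apply_apply] at h1
  exact Circle.ext (smul_left_injective ℂ hv h1)

theorem endMinv_one : F.endMinv 1 = 1 := by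
  rw [endMinv, F.M_one]
  rfl

theorem tilde_chi_one_left (q : τ.quotStab) : F.chi 1 q = 1 := by
  apply CentralExt.incl_injective A
  rw [incl_chi, F.σ_one, one_mul, map_one]
  change _ * (1 : CentralExt α) * _ = 1
  group

theorem tilde_chi_one_right (q : τ.quotStab) : F.chi q 1 = 1 := by
  apply CentralExt.incl_injective A
  rw [incl_chi, F.σ_one, mul_one, map_one]
  change _ * _ * (1 : CentralExt α) = 1
  group

/-- The normalized cocycle `β_{τ,α}` on `Q_[τ]`. -/
def beta (hτ : τ.IsIrreducible) : NormalizedCocycle τ.quotStab where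
  toFun := F.betaFun hτ
  cocycle q₁ q₂ q₃ := by
    have hc : F.chi (q₁ * q₂) q₃ * CentralExt.conj (CentralExt.lift α (F.σ q₃)) (F.chi q₁ q₂) =
        F.chi q₁ (q₂ * q₃) * F.chi q₂ q₃ := by
      apply CentralExt.incl_injective A
      simp only [map_mul, CentralExt.incl_conj, incl_chi, mul_assoc q₁ q₂ q₃]
      group
    have h1 : τ.tilde (F.chi (q₁ * q₂) q₃ * CentralExt.conj (CentralExt.lift α (F.σ q₃))
        (F.chi q₁ q₂)) * F.endMinv q₃ * F.endMinv q₂ * F.endMinv q₁ =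
        ((F.betaFun hτ (q₁ * q₂) q₃ * F.betaFun hτ q₁ q₂ : Circle) : ℂ) •
          F.endMinv (q₁ * q₂ * q₃) := by
      rw [map_mul, mul_assoc (τ.tilde (F.chi (q₁ * q₂) q₃)), tilde_conj_mul_endMinv]
      have e1 := F.beta_endMinv hτ q₁ q₂
      have e2 := F.beta_endMinv hτ (q₁ * q₂) q₃
      simp only [mul_assoc] at e1 e2 ⊢
      rw [e1, mul_smul_comm, mul_smul_comm, e2, smul_smul, Circle.coe_mul, mul_comm]
    have h2 : τ.tilde (F.chi q₁ (q₂ * q₃) * F.chi q₂ q₃) * F.endMinv q₃ * F.endMinv q₂ *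
        F.endMinv q₁ =
        ((F.betaFun hτ q₁ (q₂ * q₃) * F.betaFun hτ q₂ q₃ : Circle) : ℂ) •
          F.endMinv (q₁ * q₂ * q₃) := by
      have e1 := F.beta_endMinv hτ q₂ q₃
      have e2 := F.beta_endMinv hτ q₁ (q₂ * q₃)
      rw [map_mul, mul_assoc (τ.tilde _), mul_assoc (τ.tilde _), e1, mul_smul_comm, smul_mul_assoc,
        e2, smul_smul, Circle.coe_mul, mul_comm, mul_assoc q₁ q₂ q₃]
    rw [hc] at h1
    exact F.circle_eq_of_smul_endMinv hτ _ (h1.symm.trans h2)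
  map_one_right q := by
    have h := F.beta_endMinv hτ q 1
    rw [tilde_chi_one_right, endMinv_one, map_one, one_mul, one_mul, mul_one] at h
    refine F.circle_eq_of_smul_endMinv hτ q (h.symm.trans ?_)
    rw [Circle.coe_one, one_smul]
  map_one_left q := by
    have h := F.beta_endMinv hτ 1 q
    rw [tilde_chi_one_left, endMinv_one, map_one, one_mul, mul_one, one_mul] at h
    refine F.circle_eq_of_smul_endMinv hτ q (h.symm.trans ?_)
    rw [Circle.coe_one, one_smul]

end Frame

/-! ### Equivariant vector bundles -/

section Bundles

variable {G : Type w} [Group G]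

/-- A family `E → X` of complex vector spaces over a `G`-space `X`, with a topology on the total
space and a fibrewise linear lift of the `G`-action to an action of the central extension of `G`
defined by `α` for which the central circle acts by multiplication of scalars. The linear map
`act γ h : E_x → E_y` is the action of `γ` on the fibre over `x`, where `h : γ x = y`. (Finite-
dimensional fibres can be taken in `Type`: every bundle is isomorphic to such a bundle.) -/
structure TwistedFamily (α : NormalizedCocycle G) (X : Type u) [MulAction G X] where
  fiber : X → Type
  [addCommGroup : ∀ x, AddCommGroup (fiber x)]
  [module : ∀ x, Module ℂ (fiber x)]
  top : TopologicalSpace (Bundle.TotalSpace ℂ fiber)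
  act : ∀ (γ : CentralExt α) {x y : X}, γ.base • x = y → (fiber x →ₗ[ℂ] fiber y)
  act_one : ∀ {x : X} (h : (1 : CentralExt α).base • x = x) (e : fiber x), act 1 h e = e
  act_mul : ∀ (γ δ : CentralExt α) {x y z : X} (hδ : δ.base • x = y) (hγ : γ.base • y = z)
    (h : (γ * δ).base • x = z) (e : fiber x), act (γ * δ) h e = act γ hγ (act δ hδ e)
  act_circle : ∀ (c : Circle) {x : X} (h : (CentralExt.ofCircle c : CentralExt α).base • x = x)
    (e : fiber x), act (CentralExt.ofCircle c) h e = (c : ℂ) • e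

attribute [instance] TwistedFamily.addCommGroup TwistedFamily.module

namespace TwistedFamily

section

variable {α : NormalizedCocycle G} {X : Type u} [MulAction G X]

/-- The total space. -/
abbrev Total (E : TwistedFamily α X) : Type u := Bundle.TotalSpace ℂ E.fiber

instance (E : TwistedFamily α X) : TopologicalSpace E.Total := E.top

/-- The family is an equivariant complex vector bundle: the projection is continuous, the family
is locally isomorphic to a product `U × ℂⁿ` (where `n` may depend on the point of the base), and
the action of the central extension on the total space is continuous. -/
structure IsBundle [TopologicalSpace X] (E : TwistedFamily α X) : Prop where
  continuous_proj : Continuous (fun e : E.Total => e.proj)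
  locally_trivial : ∀ x₀ : X, ∃ U : Set X, IsOpen U ∧ x₀ ∈ U ∧
    ∃ (n : ℕ) (φ : ∀ x : U, (Fin n → ℂ) ≃ₗ[ℂ] E.fiber x),
      Topology.IsEmbedding (fun p : U × (Fin n → ℂ) => (⟨p.1, φ p.1 p.2⟩ : E.Total))
  continuous_act : Continuous (fun p : CentralExt α × E.Total =>
    (⟨p.1.base • p.2.proj, E.act p.1 rfl p.2.snd⟩ : E.Total))

/-- An isomorphism of equivariant families: fibrewise linear isomorphisms which commute with the
actions and define a homeomorphism of the total spaces. -/
structure Iso (E F : TwistedFamily α X) where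
  toEquiv : ∀ x, E.fiber x ≃ₗ[ℂ] F.fiber x
  continuous_toFun : Continuous (fun e : E.Total => (⟨e.proj, toEquiv e.proj e.snd⟩ : F.Total))
  continuous_invFun :
    Continuous (fun e : F.Total => (⟨e.proj, (toEquiv e.proj).symm e.snd⟩ : E.Total))
  map_act : ∀ (γ : CentralExt α) {x y : X} (h : γ.base • x = y) (e : E.fiber x),
    toEquiv y (E.act γ h e) = F.act γ h (toEquiv x e)

/-- The identity. -/
def Iso.refl (E : TwistedFamily α X) : Iso E E where
  toEquiv _ := LinearEquiv.refl ℂ _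
  continuous_toFun := continuous_id
  continuous_invFun := continuous_id
  map_act _ _ _ _ _ := rfl

/-- The inverse isomorphism. -/
def Iso.symm {E F : TwistedFamily α X} (f : Iso E F) : Iso F E where
  toEquiv x := (f.toEquiv x).symm
  continuous_toFun := f.continuous_invFun
  continuous_invFun := f.continuous_toFun
  map_act γ _ _ h e := by
    rw [LinearEquiv.symm_apply_eq, f.map_act, LinearEquiv.apply_symm_apply]

/-- The composition of isomorphisms. -/
def Iso.trans {E F H : TwistedFamily α X} (f : Iso E F) (g : Iso F H) : Iso E H where
  toEquiv x := (f.toEquiv x).trans (g.toEquiv x)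
  continuous_toFun := g.continuous_toFun.comp f.continuous_toFun
  continuous_invFun := f.continuous_invFun.comp g.continuous_invFun
  map_act γ _ _ h e := by simp [f.map_act, g.map_act]

/-- The zero family. -/
def zero [TopologicalSpace X] : TwistedFamily α X where
  fiber _ := PUnit
  top := TopologicalSpace.induced (fun e => e.proj) inferInstance
  act _ _ _ _ := 0
  act_one _ _ := rfl
  act_mul _ _ _ _ _ _ _ _ _ := rfl
  act_circle _ _ _ _ := rfl

/-- The direct sum of families, with the topology of the fibre product of the total spaces. -/
def sum (E F : TwistedFamily α X) : TwistedFamily α X where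
  fiber x := E.fiber x × F.fiber x
  top := TopologicalSpace.induced
    (fun e => ((⟨e.proj, e.snd.1⟩, ⟨e.proj, e.snd.2⟩) : E.Total × F.Total)) inferInstance
  act γ _ _ h := (E.act γ h).prodMap (F.act γ h)
  act_one h e := Prod.ext (E.act_one h e.1) (F.act_one h e.2)
  act_mul γ δ _ _ _ hδ hγ h e := Prod.ext (E.act_mul γ δ hδ hγ h e.1) (F.act_mul γ δ hδ hγ h e.2)
  act_circle c _ h e := Prod.ext (E.act_circle c h e.1) (F.act_circle c h e.2)

/-- The pullback along a `G`-map `f : Y → X`, with the topology of the fibre product of `Y` and the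
total space. -/
def pullback {Y : Type v} [TopologicalSpace Y] [MulAction G Y] (f : Y → X)
    (hf : ∀ (g : G) y, f (g • y) = g • f y) (E : TwistedFamily α X) : TwistedFamily α Y where
  fiber y := E.fiber (f y)
  top := TopologicalSpace.induced
    (fun e => ((e.proj, ⟨f e.proj, e.snd⟩) : Y × E.Total)) inferInstance
  act γ _ _ h := E.act γ (by rw [← hf, h])
  act_one h e := E.act_one _ e
  act_mul γ δ _ _ _ hδ hγ h e := E.act_mul γ δ _ _ _ e
  act_circle c _ h e := E.act_circle c _ e

theorem mk_act (E : TwistedFamily α X) (γ : CentralExt α) {x y : X} (h : γ.base • x = y)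
    (e : E.fiber x) : (⟨y, E.act γ h e⟩ : E.Total) = ⟨γ.base • x, E.act γ rfl e⟩ := by
  subst h
  rfl

theorem continuous_proj_sum (E F : TwistedFamily α X) :
    Continuous (fun e : (E.sum F).Total => ((⟨e.proj, e.snd.1⟩ : E.Total), (⟨e.proj, e.snd.2⟩ : F.Total))) :=
  continuous_induced_dom

theorem continuous_fst (E F : TwistedFamily α X) :
    Continuous (fun e : (E.sum F).Total => (⟨e.proj, e.snd.1⟩ : E.Total)) :=
  _root_.continuous_fst.comp (continuous_proj_sum E F)

theorem continuous_snd (E F : TwistedFamily α X) :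
    Continuous (fun e : (E.sum F).Total => (⟨e.proj, e.snd.2⟩ : F.Total)) :=
  _root_.continuous_snd.comp (continuous_proj_sum E F)

theorem continuous_sum_rng {T : Type*} [TopologicalSpace T] {E F : TwistedFamily α X}
    {f : T → (E.sum F).Total}
    (h₁ : Continuous (fun t => (⟨(f t).proj, (f t).snd.1⟩ : E.Total)))
    (h₂ : Continuous (fun t => (⟨(f t).proj, (f t).snd.2⟩ : F.Total))) : Continuous f :=
  continuous_induced_rng.2 (h₁.prodMk h₂)

section

variable {Y : Type v} [TopologicalSpace Y] [MulAction G Y] (f : Y → X)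
    (hf : ∀ (g : G) y, f (g • y) = g • f y) (E : TwistedFamily α X)

theorem continuous_pullback_proj :
    Continuous (fun e : (E.pullback f hf).Total => e.proj) :=
  _root_.continuous_fst.comp (continuous_induced_dom (t := instTopologicalSpaceProd)
    (f := fun e : (E.pullback f hf).Total => ((e.proj, ⟨f e.proj, e.snd⟩) : Y × E.Total)))

theorem continuous_pullback_total :
    Continuous (fun e : (E.pullback f hf).Total => (⟨f e.proj, e.snd⟩ : E.Total)) :=
  _root_.continuous_snd.comp (continuous_induced_dom (t := instTopologicalSpaceProd)
    (f := fun e : (E.pullback f hf).Total => ((e.proj, ⟨f e.proj, e.snd⟩) : Y × E.Total)))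

theorem continuous_pullback_rng {T : Type*} [TopologicalSpace T]
    {k : T → (E.pullback f hf).Total} (h₁ : Continuous (fun t => (k t).proj))
    (h₂ : Continuous (fun t => (⟨f (k t).proj, (k t).snd⟩ : E.Total))) : Continuous k :=
  continuous_induced_rng.2 (h₁.prodMk h₂)

end

theorem isBundle_zero [TopologicalSpace X] [ContinuousConstSMul G X] :
    (zero : TwistedFamily α X).IsBundle where
  continuous_proj := continuous_induced_dom
  locally_trivial x₀ := by
    refine ⟨Set.univ, isOpen_univ, trivial, 0, fun _ =>
      { toFun := fun _ => PUnit.unit, invFun := fun _ => 0, map_add' := fun _ _ => rfl,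
        map_smul' := fun _ _ => rfl, left_inv := fun _ => Subsingleton.elim _ _,
        right_inv := fun _ => rfl }, ?_⟩
    have hs : Topology.IsEmbedding (fun p : ↥(Set.univ : Set X) × (Fin 0 → ℂ) => (p.1 : X)) :=
      Topology.IsEmbedding.subtypeVal.comp (Homeomorph.prodUnique _ _).isEmbedding
    exact Topology.IsEmbedding.of_comp (g := fun e : (zero : TwistedFamily α X).Total => e.proj)
      (continuous_induced_rng.2 hs.continuous) continuous_induced_dom hs
  continuous_act := by
    have h : Continuous (fun e : (zero : TwistedFamily α X).Total => e.proj) :=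
      continuous_induced_dom
    exact continuous_induced_rng.2
      (CentralExt.continuous_base_smul.comp (continuous_id.prodMap h))

theorem IsBundle.sum [TopologicalSpace X] {E F : TwistedFamily α X} (hE : E.IsBundle)
    (hF : F.IsBundle) : (E.sum F).IsBundle where
  continuous_proj := hE.continuous_proj.comp (continuous_fst E F)
  locally_trivial x₀ := by
    obtain ⟨U, hU, hxU, n, φ, hφ⟩ := hE.locally_trivial x₀
    obtain ⟨V, hV, hxV, m, ψ, hψ⟩ := hF.locally_trivial x₀
    let L : (Fin (n + m) → ℂ) ≃ₗ[ℂ] (Fin n → ℂ) × (Fin m → ℂ) :=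
      (LinearEquiv.funCongrLeft ℂ ℂ finSumFinEquiv).trans
        (LinearEquiv.sumArrowLequivProdArrow (Fin n) (Fin m) ℂ ℂ)
    have hL : Topology.IsEmbedding L := L.toContinuousLinearEquiv.toHomeomorph.isEmbedding
    refine ⟨U ∩ V, hU.inter hV, ⟨hxU, hxV⟩, n + m,
      fun x => L.trans ((φ ⟨x, x.2.1⟩).prodCongr (ψ ⟨x, x.2.2⟩)), ?_⟩
    have hs : Topology.IsEmbedding (fun p : (U ∩ V : Set X) × (Fin (n + m) → ℂ) =>
        (((⟨p.1, p.1.2.1⟩, (L p.2).1), (⟨p.1, p.1.2.2⟩, (L p.2).2)) :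
          (U × (Fin n → ℂ)) × (V × (Fin m → ℂ)))) := by
      refine Topology.IsEmbedding.of_comp (g := fun p => ((p.1.1 : X), (p.1.2, p.2.2))) ?_
        (by fun_prop) ?_
      · have := hL.continuous
        fun_prop
      · exact Topology.IsEmbedding.subtypeVal.prodMap hL
    have h := (hφ.prodMap hψ).comp hs
    exact Topology.IsEmbedding.of_comp
      (continuous_sum_rng (_root_.continuous_fst.comp h.continuous)
        (_root_.continuous_snd.comp h.continuous)) (continuous_proj_sum E F) h
  continuous_act := continuous_sum_rng
    (hE.continuous_act.comp (continuous_id.prodMap (continuous_fst E F)))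
    (hF.continuous_act.comp (continuous_id.prodMap (continuous_snd E F)))

theorem IsBundle.pullback [TopologicalSpace X] {E : TwistedFamily α X} (hE : E.IsBundle)
    {Y : Type v} [TopologicalSpace Y] [MulAction G Y] [ContinuousConstSMul G Y] {f : Y → X}
    (hf : ∀ (g : G) y, f (g • y) = g • f y) (hc : Continuous f) :
    (E.pullback f hf).IsBundle where
  continuous_proj := continuous_pullback_proj f hf E
  locally_trivial y₀ := by
    obtain ⟨U, hU, hxU, n, φ, hφ⟩ := hE.locally_trivial (f y₀)
    refine ⟨f ⁻¹' U, hU.preimage hc, hxU, n, fun y => φ ⟨f y, y.2⟩, ?_⟩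
    have hs : Topology.IsEmbedding (fun p : (f ⁻¹' U : Set Y) × (Fin n → ℂ) =>
        (((p.1 : Y), (⟨f p.1, p.1.2⟩, p.2)) : Y × (U × (Fin n → ℂ)))) :=
      Topology.IsEmbedding.of_comp
        (g := fun p : Y × (U × (Fin n → ℂ)) => (p.1, p.2.2)) (by fun_prop)
        (by fun_prop) (Topology.IsEmbedding.subtypeVal.prodMap Topology.IsEmbedding.id)
    have h := (Topology.IsEmbedding.id.prodMap hφ).comp hs
    exact Topology.IsEmbedding.of_comp
      (continuous_pullback_rng f hf E (_root_.continuous_fst.comp h.continuous)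
        (_root_.continuous_snd.comp h.continuous))
      ((continuous_pullback_proj f hf E).prodMk (continuous_pullback_total f hf E)) h
  continuous_act := by
    refine continuous_pullback_rng f hf E ?_ ?_
    · exact CentralExt.continuous_base_smul.comp
        (continuous_id.prodMap (continuous_pullback_proj f hf E))
    · refine (hE.continuous_act.comp
        (continuous_id.prodMap (continuous_pullback_total f hf E))).congr ?_
      rintro ⟨γ, y, e⟩
      exact (E.mk_act γ _ e).symm

/-- The direct sum of isomorphisms. -/
def Iso.sum {E E' F F' : TwistedFamily α X} (f : Iso E E') (g : Iso F F') :
    Iso (E.sum F) (E'.sum F') where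
  toEquiv x := (f.toEquiv x).prodCongr (g.toEquiv x)
  continuous_toFun := continuous_sum_rng (f.continuous_toFun.comp (continuous_fst E F))
    (g.continuous_toFun.comp (continuous_snd E F))
  continuous_invFun := continuous_sum_rng (f.continuous_invFun.comp (continuous_fst E' F'))
    (g.continuous_invFun.comp (continuous_snd E' F'))
  map_act γ _ _ h e := Prod.ext (f.map_act γ h e.1) (g.map_act γ h e.2)

/-- Commutativity of the direct sum. -/
def Iso.sumComm (E F : TwistedFamily α X) : Iso (E.sum F) (F.sum E) where
  toEquiv x := LinearEquiv.prodComm ℂ (E.fiber x) (F.fiber x)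
  continuous_toFun := continuous_sum_rng (continuous_snd E F) (continuous_fst E F)
  continuous_invFun := continuous_sum_rng (continuous_snd F E) (continuous_fst F E)
  map_act _ _ _ _ _ := rfl

/-- Associativity of the direct sum. -/
def Iso.sumAssoc (E F H : TwistedFamily α X) : Iso ((E.sum F).sum H) (E.sum (F.sum H)) where
  toEquiv x := LinearEquiv.prodAssoc ℂ (E.fiber x) (F.fiber x) (H.fiber x)
  continuous_toFun := continuous_sum_rng ((continuous_fst E F).comp (continuous_fst _ H))
    (continuous_sum_rng ((continuous_snd E F).comp (continuous_fst _ H)) (continuous_snd _ H))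
  continuous_invFun := continuous_sum_rng
    (continuous_sum_rng (continuous_fst E _) ((continuous_fst F H).comp (continuous_snd E _)))
    ((continuous_snd F H).comp (continuous_snd E _))
  map_act _ _ _ _ _ := rfl

/-- The zero family is neutral for the direct sum. -/
def Iso.zeroSum [TopologicalSpace X] {E : TwistedFamily α X} (hE : E.IsBundle) :
    Iso (zero.sum E) E where
  toEquiv x := (LinearEquiv.uniqueProd : (PUnit × E.fiber x) ≃ₗ[ℂ] E.fiber x)
  continuous_toFun := continuous_snd zero E
  continuous_invFun := continuous_sum_rng (continuous_induced_rng.2 hE.continuous_proj)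
    continuous_id
  map_act _ _ _ _ _ := rfl

section

variable {Y : Type v} [TopologicalSpace Y] [MulAction G Y] {f : Y → X}
    (hf : ∀ (g : G) y, f (g • y) = g • f y)

/-- The pullback of an isomorphism. -/
def Iso.pullback {E F : TwistedFamily α X} (i : Iso E F) :
    Iso (E.pullback f hf) (F.pullback f hf) where
  toEquiv y := i.toEquiv (f y)
  continuous_toFun := continuous_pullback_rng f hf F (continuous_pullback_proj f hf E)
    (i.continuous_toFun.comp (continuous_pullback_total f hf E))
  continuous_invFun := continuous_pullback_rng f hf E (continuous_pullback_proj f hf F)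
    (i.continuous_invFun.comp (continuous_pullback_total f hf F))
  map_act γ _ _ _ e := i.map_act γ _ e

/-- The pullback commutes with direct sums. -/
def Iso.pullbackSum (E F : TwistedFamily α X) :
    Iso ((E.sum F).pullback f hf) ((E.pullback f hf).sum (F.pullback f hf)) where
  toEquiv y := LinearEquiv.refl ℂ (E.fiber (f y) × F.fiber (f y))
  continuous_toFun := continuous_sum_rng
    (continuous_pullback_rng f hf E (continuous_pullback_proj f hf _)
      ((continuous_fst E F).comp (continuous_pullback_total f hf _)))
    (continuous_pullback_rng f hf F (continuous_pullback_proj f hf _)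
      ((continuous_snd E F).comp (continuous_pullback_total f hf _)))
  continuous_invFun := continuous_pullback_rng f hf _
    ((continuous_pullback_proj f hf E).comp (continuous_fst _ _))
    (continuous_sum_rng ((continuous_pullback_total f hf E).comp (continuous_fst _ _))
      ((continuous_pullback_total f hf F).comp (continuous_snd _ _)))
  map_act _ _ _ _ _ := rfl

/-- The pullback of the zero family. -/
def Iso.pullbackZero [TopologicalSpace X] (hc : Continuous f) :
    Iso ((zero : TwistedFamily α X).pullback f hf) zero where
  toEquiv _ := LinearEquiv.refl ℂ PUnit
  continuous_toFun := continuous_induced_rng.2 (continuous_pullback_proj f hf _)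
  continuous_invFun :=
    have h : Continuous (fun e : (zero : TwistedFamily α Y).Total => e.proj) :=
      continuous_induced_dom
    continuous_pullback_rng f hf _ h (continuous_induced_rng.2 (hc.comp h))
  map_act _ _ _ _ _ := rfl

/-- The pullback along a composition. -/
def Iso.pullbackComp {Z : Type*} [TopologicalSpace Z] [MulAction G Z] {k : Z → Y}
    (hk : ∀ (g : G) z, k (g • z) = g • k z) (hc : Continuous k) {l : Z → X}
    (hl : ∀ (g : G) z, l (g • z) = g • l z) (h : ∀ z, f (k z) = l z) (E : TwistedFamily α X) :
    Iso ((E.pullback f hf).pullback k hk) (E.pullback l hl) := by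
  obtain rfl : f ∘ k = l := funext h
  exact
    { toEquiv := fun z => LinearEquiv.refl ℂ (E.fiber (f (k z)))
      continuous_toFun := continuous_pullback_rng _ _ _ (continuous_pullback_proj k hk _)
        ((continuous_pullback_total f hf E).comp (continuous_pullback_total k hk _))
      continuous_invFun := continuous_pullback_rng _ _ _ (continuous_pullback_proj _ hl E)
        (continuous_pullback_rng _ _ _ (hc.comp (continuous_pullback_proj _ hl E))
          (continuous_pullback_total _ hl E))
      map_act := fun _ _ _ _ _ => rfl }

end

end

end TwistedFamily

/-- A `G`-equivariant complex vector bundle over `X` twisted by `α`: a complex vector bundle which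
is equivariant for the central extension of `G` by `α` and on which the central circle acts by
multiplication of scalars. -/
structure TwistedBundle (α : NormalizedCocycle G) (X : Type u) [TopologicalSpace X]
    [MulAction G X] extends TwistedFamily α X where
  isBundle : toTwistedFamily.IsBundle

/-- Isomorphism of twisted equivariant vector bundles. -/
def bundleSetoid (α : NormalizedCocycle G) (X : Type u) [TopologicalSpace X] [MulAction G X] :
    Setoid (TwistedBundle α X) where
  r E F := Nonempty (TwistedFamily.Iso E.toTwistedFamily F.toTwistedFamily)
  iseqv := ⟨fun _ => ⟨.refl _⟩, fun ⟨i⟩ => ⟨i.symm⟩, fun ⟨i⟩ ⟨j⟩ => ⟨i.trans j⟩⟩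

/-- The set of isomorphism classes of twisted equivariant vector bundles over `X`. -/
def Vect (α : NormalizedCocycle G) (X : Type u) [TopologicalSpace X] [MulAction G X] : Type _ :=
  Quotient (bundleSetoid α X)

namespace Vect

variable {α : NormalizedCocycle G} {X : Type u} [TopologicalSpace X] [MulAction G X]

/-- The isomorphism class of a bundle. -/
def mk (E : TwistedBundle α X) : Vect α X := Quotient.mk (bundleSetoid α X) E

variable [ContinuousConstSMul G X]

instance : Add (Vect α X) :=
  ⟨Quotient.map₂ (fun E F => ⟨E.sum F.toTwistedFamily, E.isBundle.sum F.isBundle⟩)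
    fun _ _ ⟨i⟩ _ _ ⟨j⟩ => ⟨i.sum j⟩⟩

instance : Zero (Vect α X) := ⟨mk ⟨.zero, TwistedFamily.isBundle_zero⟩⟩

/-- Isomorphism classes form a commutative monoid under direct sum. -/
instance : AddCommMonoid (Vect α X) where
  add_assoc a b c := Quotient.inductionOn₃ a b c fun _ _ _ => Quotient.sound ⟨.sumAssoc _ _ _⟩
  add_comm a b := Quotient.inductionOn₂ a b fun _ _ => Quotient.sound ⟨.sumComm _ _⟩
  zero_add a := Quotient.inductionOn a fun E => Quotient.sound ⟨.zeroSum E.isBundle⟩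
  add_zero a := Quotient.inductionOn a fun E =>
    Quotient.sound ⟨(TwistedFamily.Iso.sumComm _ _).trans (.zeroSum E.isBundle)⟩
  nsmul := nsmulRec

/-- The pullback of isomorphism classes along a continuous `G`-map. -/
def map {Y : Type v} [TopologicalSpace Y] [MulAction G Y] [ContinuousConstSMul G Y] (f : C(Y, X))
    (hf : ∀ (g : G) y, f (g • y) = g • f y) : Vect α X →+ Vect α Y where
  toFun := Quotient.map (fun E => ⟨E.pullback f hf, E.isBundle.pullback hf f.continuous⟩)
    fun _ _ ⟨i⟩ => ⟨i.pullback hf⟩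
  map_zero' := Quotient.sound ⟨.pullbackZero hf f.continuous⟩
  map_add' a b := Quotient.inductionOn₂ a b fun _ _ => Quotient.sound ⟨.pullbackSum hf _ _⟩

end Vect

/-! ### Twisted equivariant `K`-theory -/

/-- The twisted equivariant `K`-group `^αK_G^0(X)`: the Grothendieck group of the monoid of
isomorphism classes of twisted equivariant vector bundles over `X`. -/
abbrev KZero (α : NormalizedCocycle G) (X : Type u) [TopologicalSpace X] [MulAction G X]
    [ContinuousConstSMul G X] : Type _ := Algebra.GrothendieckAddGroup (Vect α X)

namespace KZero

variable {α : NormalizedCocycle G} {X : Type u} [TopologicalSpace X] [MulAction G X]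
  [ContinuousConstSMul G X]

/-- The class `[E]` of a bundle. -/
def mk (E : TwistedBundle α X) : KZero α X := Algebra.GrothendieckAddGroup.of (Vect.mk E)

/-- The homomorphism `f^*` induced by a continuous `G`-map. -/
def map {Y : Type v} [TopologicalSpace Y] [MulAction G Y] [ContinuousConstSMul G Y] (f : C(Y, X))
    (hf : ∀ (g : G) y, f (g • y) = g • f y) : KZero α X →+ KZero α Y :=
  Algebra.GrothendieckAddGroup.lift (Algebra.GrothendieckAddGroup.of.comp (Vect.map f hf))

theorem map_of {Y : Type v} [TopologicalSpace Y] [MulAction G Y] [ContinuousConstSMul G Y]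
    (f : C(Y, X)) (hf : ∀ (g : G) y, f (g • y) = g • f y) (a : Vect α X) :
    map f hf (Algebra.GrothendieckAddGroup.of a) =
      Algebra.GrothendieckAddGroup.of (Vect.map f hf a) :=
  congrArg (fun φ : Vect α X →+ KZero α Y => φ a)
    (Algebra.GrothendieckAddGroup.lift.symm_apply_apply
      (Algebra.GrothendieckAddGroup.of.comp (Vect.map f hf)))

theorem map_map {Y : Type v} [TopologicalSpace Y] [MulAction G Y] [ContinuousConstSMul G Y]
    (f : C(Y, X)) (hf : ∀ (g : G) y, f (g • y) = g • f y) {Z : Type*} [TopologicalSpace Z]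
    [MulAction G Z] [ContinuousConstSMul G Z] (k : C(Z, Y))
    (hk : ∀ (g : G) z, k (g • z) = g • k z) (l : C(Z, X))
    (hl : ∀ (g : G) z, l (g • z) = g • l z) (h : ∀ z, f (k z) = l z) (ξ : KZero α X) :
    map k hk (map f hf ξ) = map l hl ξ := by
  have h1 : (map (α := α) k hk).comp (map f hf) = map l hl := by
    apply Algebra.GrothendieckAddGroup.lift.symm.injective
    refine AddMonoidHom.ext fun a => ?_
    simp only [Algebra.GrothendieckAddGroup.lift_symm_apply, AddMonoidHom.comp_apply]
    have e : Vect.map k hk (Vect.map f hf a) = Vect.map l hl a :=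
      Quotient.inductionOn a fun E =>
        Quotient.sound ⟨.pullbackComp hf hk k.continuous hl h E.toTwistedFamily⟩
    rw [map_of, map_of, map_of, e]
  exact congrArg (fun φ : KZero α X →+ KZero α Z => φ ξ) h1

end KZero

/-! ### Suspensions and the groups `^αK_G^n(X)` -/

/-- The subspace of `X₊ × Iⁿ` which is collapsed to the base point in `Σⁿ X₊`: the pairs `(x, t)`
with `x` the added base point or `t ∈ ∂Iⁿ`. -/
def suspBase (n : ℕ) (X : Type u) : Set ((X ⊕ Unit) × (Fin n → unitInterval)) :=
  {p | p.1 = Sum.inr () ∨ p.2 ∈ Cube.boundary (Fin n)}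

/-- The equivalence relation which collapses `suspBase n X` to one point. -/
def suspSetoid (n : ℕ) (X : Type u) : Setoid ((X ⊕ Unit) × (Fin n → unitInterval)) where
  r p q := p = q ∨ (p ∈ suspBase n X ∧ q ∈ suspBase n X)
  iseqv := ⟨fun _ => Or.inl rfl, fun h => h.imp Eq.symm And.symm, by
    rintro p q r (rfl | h) (rfl | h')
    exacts [Or.inl rfl, Or.inr h', Or.inr h, Or.inr ⟨h.1, h'.2⟩]⟩

/-- The `n`-fold reduced suspension
`Σⁿ X₊ = (X₊ × Iⁿ) / ({base point} × Iⁿ ∪ X₊ × ∂Iⁿ) = X₊ ∧ (Iⁿ / ∂Iⁿ)`. -/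
def Susp (n : ℕ) (X : Type u) : Type u := Quotient (suspSetoid n X)

namespace Susp

variable {n : ℕ}

instance {X : Type u} [TopologicalSpace X] : TopologicalSpace (Susp n X) :=
  inferInstanceAs (TopologicalSpace (Quotient (suspSetoid n X)))

/-- The point of `Σⁿ X₊` represented by an element of `X₊ × Iⁿ`. -/
def mk {X : Type u} (p : (X ⊕ Unit) × (Fin n → unitInterval)) : Susp n X :=
  Quotient.mk (suspSetoid n X) p

/-- The base point of `Σⁿ X₊`. -/
def pt (n : ℕ) (X : Type u) : Susp n X := mk (Sum.inr (), fun _ => 0)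

/-- The map `Σⁿ f₊`. -/
def map {X : Type u} {Y : Type v} (f : X → Y) : Susp n X → Susp n Y :=
  Quotient.map (Prod.map (Sum.map f id) id) (by
    rintro p q (rfl | ⟨hp, hq⟩)
    · exact Or.inl rfl
    · exact Or.inr ⟨hp.imp (fun h => by simp [h]) id, hq.imp (fun h => by simp [h]) id⟩)

theorem continuous_map {X : Type u} {Y : Type v} [TopologicalSpace X] [TopologicalSpace Y]
    {f : X → Y} (hf : Continuous f) : Continuous (map f : Susp n X → Susp n Y) :=
  Continuous.quotient_map' ((hf.sumMap continuous_id).prodMap continuous_id) _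

/-- The action `g · [x, t] = [g x, t]`. -/
instance {X : Type u} [MulAction G X] : MulAction G (Susp n X) where
  smul g := map (g • ·)
  one_smul z := Quotient.inductionOn z fun p => by
    obtain ⟨x | x, t⟩ := p
    · exact congrArg (fun y => mk (Sum.inl y, t)) (one_smul G x)
    · rfl
  mul_smul g h z := Quotient.inductionOn z fun p => by
    obtain ⟨x | x, t⟩ := p
    · exact congrArg (fun y => mk (Sum.inl y, t)) (mul_smul g h x)
    · rfl

theorem smul_def {X : Type u} [MulAction G X] (g : G) (z : Susp n X) :
    g • z = map (g • ·) z := rfl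

theorem smul_pt {X : Type u} [MulAction G X] (g : G) : g • pt n X = pt n X := rfl

instance {X : Type u} [TopologicalSpace X] [MulAction G X] [ContinuousConstSMul G X] :
    ContinuousConstSMul G (Susp n X) :=
  ⟨fun g => continuous_map (continuous_const_smul g)⟩

theorem map_smul {X : Type u} {Y : Type v} [MulAction G X] [MulAction G Y] (f : Y → X)
    (hf : ∀ (g : G) y, f (g • y) = g • f y) (g : G) (z : Susp n Y) :
    map f (g • z) = g • map f z := Quotient.inductionOn z fun p => by
  obtain ⟨x | x, t⟩ := p
  · exact congrArg (fun y => mk (Sum.inl y, t)) (hf g x)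
  · rfl

end Susp

/-- The reduced `K`-group `^αK̃_G^0(Z)` of a `G`-space `Z` with a fixed base point `z₀`: the kernel
of the restriction `^αK_G^0(Z) → ^αK_G^0({z₀})`. -/
def reducedKZero (α : NormalizedCocycle G) (Z : Type u) [TopologicalSpace Z] [MulAction G Z]
    [ContinuousConstSMul G Z] (z₀ : Z) (h : ∀ g : G, g • z₀ = z₀) : AddSubgroup (KZero α Z) :=
  (KZero.map (Y := PUnit.{1}) (ContinuousMap.const _ z₀) (fun g _ => (h g).symm)).ker

/-- The group `^αK_G^n(X)`: it is `^αK_G^0(X)` for `n = 0`, and `^αK̃_G^0(Σⁿ X₊)` for `n > 0`. -/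
def KGroup (α : NormalizedCocycle G) (n : ℕ) (X : Type u) [TopologicalSpace X] [MulAction G X]
    [ContinuousConstSMul G X] : Type _ :=
  match n with
  | 0 => KZero α X
  | n + 1 => reducedKZero α (Susp (n + 1) X) (Susp.pt _ X) Susp.smul_pt

namespace KGroup

variable {α : NormalizedCocycle G} {X : Type u} [TopologicalSpace X] [MulAction G X]
  [ContinuousConstSMul G X]

instance : ∀ n, AddCommGroup (KGroup α n X)
  | 0 => inferInstanceAs (AddCommGroup (KZero α X))
  | n + 1 => inferInstanceAs
    (AddCommGroup (reducedKZero α (Susp (n + 1) X) (Susp.pt _ X) Susp.smul_pt))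

/-- An element of `^αK_G^0(X)` as an element of `KGroup α 0 X`. -/
def ofKZero (ξ : KZero α X) : KGroup α 0 X := ξ

/-- The inclusion of `^αK_G^n(X) = ^αK̃_G^0(Σⁿ X₊)` into `^αK_G^0(Σⁿ X₊)` for `n > 0`. -/
def toKZero {n : ℕ} (ξ : KGroup α (n + 1) X) : KZero α (Susp (n + 1) X) := ξ.1

/-- The homomorphism `f^*` induced by a continuous `G`-map. -/
def map {Y : Type v} [TopologicalSpace Y] [MulAction G Y] [ContinuousConstSMul G Y] (f : C(Y, X))
    (hf : ∀ (g : G) y, f (g • y) = g • f y) : ∀ n, KGroup α n X →+ KGroup α n Y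
  | 0 => KZero.map f hf
  | n + 1 =>
    (((KZero.map (α := α) ⟨Susp.map f, Susp.continuous_map f.continuous⟩
        (Susp.map_smul (n := n + 1) f hf)).comp
      (reducedKZero α (Susp (n + 1) X) (Susp.pt _ X) Susp.smul_pt).subtype).codRestrict
      (reducedKZero α (Susp (n + 1) Y) (Susp.pt _ Y) Susp.smul_pt) fun ξ => by
        have h := ξ.2
        exact (KZero.map_map _ _ _ _ _ _ (fun _ => rfl) _).trans h)

end KGroup

end Bundles

/-! ### The bundles `Hom(V_τ, E)` -/

section HomBundle

variable {G : Type w} [Group G] {α : NormalizedCocycle G} {A : Subgroup G}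

namespace TwistedFamily

theorem act_congr {X : Type u} [MulAction G X] (E : TwistedFamily α X) {γ δ : CentralExt α}
    (h : γ = δ) {x y : X} (hγ : γ.base • x = y) (hδ : δ.base • x = y) (e : E.fiber x) :
    E.act γ hγ e = E.act δ hδ e := by
  subst h
  rfl

theorem act_act {X : Type u} [MulAction G X] (E : TwistedFamily α X) {γ δ : CentralExt α}
    {x y z : X} (hδ : δ.base • x = y) (hγ : γ.base • y = z) {ε : CentralExt α} (h : ε = γ * δ)
    (hε : ε.base • x = z) (e : E.fiber x) : E.act γ hγ (E.act δ hδ e) = E.act ε hε e := by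
  subst h
  exact (E.act_mul γ δ hδ hγ hε e).symm

/-- The space `Hom_{Ã_α}(V_τ, E_x)` of linear maps `V_τ → E_x` which are equivariant for the central
extension of `A`, where `A` acts trivially on the base. -/
def homFiber {X : Type u} [MulAction G X] (hA : ∀ (a : A) (x : X), (a : G) • x = x)
    (τ : ProjRep (α.res A)) (E : TwistedFamily α X) (x : X) :
    Submodule ℂ (τ.V →ₗ[ℂ] E.fiber x) where
  carrier := {f | ∀ (γ : CentralExt (α.res A)) (v : τ.V),
    f (τ.tilde γ v) = E.act (CentralExt.incl α A γ) (hA γ.base x) (f v)}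
  add_mem' hf hg γ v := by simp [hf γ v, hg γ v]
  zero_mem' γ v := by simp
  smul_mem' c f hf γ v := by simp [hf γ v]

variable [A.Normal]

theorem smul_eq_of_quotient {X : Type u} [MulAction G X] [MulAction (G ⧸ A) X]
    (hX : ∀ (g : G) (x : X), (g : G ⧸ A) • x = g • x) (a : A) (x : X) : (a : G) • x = x := by
  rw [← hX, (QuotientGroup.eq_one_iff (a : G)).2 a.2, one_smul]

theorem _root_.TwistedK.Frame.σ_smul {τ : ProjRep (α.res A)} (F : Frame τ) {X : Type u}
    [MulAction G X] [MulAction (G ⧸ A) X] (hX : ∀ (g : G) (x : X), (g : G ⧸ A) • x = g • x)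
    {q : τ.quotStab} {x y : X} (h : q • x = y) :
    (CentralExt.lift α (F.σ q)).base • x = y := by
  change F.σ q • x = y
  rw [← hX, F.mk_σ, ← h]
  rfl

/-- For a `G`-space `X` on which `A` acts trivially, with the induced action of `Q = G / A`, and a
twisted family `E` over `X`, the family `Hom_{Ã_α}(V_τ, E)` with the action
`((q, z) · f)(v) = z (σ(q), 1) · f(M_q⁻¹ v)` of the central extension of `Q_[τ]` by `β_{τ,α}`. The
total space has the topology of pointwise convergence of maps `V_τ → E`. -/
def hom {τ : ProjRep (α.res A)} (hτ : τ.IsIrreducible) (F : Frame τ) {X : Type u} [MulAction G X]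
    [MulAction (G ⧸ A) X] (hX : ∀ (g : G) (x : X), (g : G ⧸ A) • x = g • x)
    (E : TwistedFamily α X) : TwistedFamily (F.beta hτ) X where
  fiber x := homFiber (smul_eq_of_quotient hX) τ E x
  top := TopologicalSpace.induced
    (fun e => (fun v => ⟨e.proj, e.snd.1 v⟩ : τ.V → E.Total)) inferInstance
  act γ x y h :=
    { toFun := fun f => ⟨(γ.phase : ℂ) •
          (E.act (CentralExt.lift α (F.σ γ.base)) (F.σ_smul hX h) ∘ₗ f.1 ∘ₗ F.endMinv γ.base), by
        intro δ v
        have h1 := congrArg (fun T : Module.End ℂ τ.V => T v)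
          (F.tilde_conj_mul_endMinv γ.base δ)
        simp only [Module.End.mul_apply] at h1
        simp only [LinearMap.smul_apply, LinearMap.comp_apply, map_smul]
        congr 1
        have h2 : ((CentralExt.incl α A δ) * CentralExt.lift α (F.σ γ.base)).base • x = y := by
          rw [CentralExt.mul_base, mul_smul, F.σ_smul hX h]
          exact smul_eq_of_quotient hX _ _
        rw [← h1, f.2]
        exact (E.act_act _ _ (by rw [CentralExt.incl_conj]; group) h2 _).trans
          (E.act_act _ _ rfl h2 _).symm⟩
      map_add' := fun f f' => Subtype.ext (LinearMap.ext fun v => by simp)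
      map_smul' := fun c f => Subtype.ext (LinearMap.ext fun v => by
        simp [smul_comm (γ.phase : ℂ) c]) }
  act_one {x} h f := Subtype.ext (LinearMap.ext fun v => by
    have h1 := E.act_one (x := x) (one_smul G x) (f.1 v)
    have h2 : CentralExt.lift α (F.σ 1) = 1 := by rw [F.σ_one]; rfl
    change ((1 : Circle) : ℂ) • E.act (CentralExt.lift α (F.σ 1)) _ (f.1 (F.endMinv 1 v)) = f.1 v
    rw [F.endMinv_one, Module.End.one_apply, Circle.coe_one, one_smul]
    exact (E.act_congr h2 _ _ _).trans h1)
  act_mul γ δ x y z hδ hγ h f := Subtype.ext (LinearMap.ext fun v => by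
    have h1 := congrArg (fun T : Module.End ℂ τ.V => T v) (F.beta_endMinv hτ γ.base δ.base)
    simp only [Module.End.mul_apply, LinearMap.smul_apply] at h1
    have h2 : (CentralExt.lift α (F.σ γ.base) * CentralExt.lift α (F.σ δ.base)).base • x = z := by
      rw [CentralExt.mul_base, mul_smul, F.σ_smul hX hδ, F.σ_smul hX hγ]
    have h3 : CentralExt.lift α (F.σ γ.base) * CentralExt.lift α (F.σ δ.base) =
        CentralExt.lift α (F.σ (γ.base * δ.base)) *
          CentralExt.incl α A (F.chi γ.base δ.base) := by
      rw [F.incl_chi]; group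
    change ((F.betaFun hτ γ.base δ.base * γ.phase * δ.phase : Circle) : ℂ) •
        E.act (CentralExt.lift α (F.σ (γ.base * δ.base))) _
          (f.1 (F.endMinv (γ.base * δ.base) v)) =
      (γ.phase : ℂ) • E.act (CentralExt.lift α (F.σ γ.base)) _
        ((δ.phase : ℂ) • E.act (CentralExt.lift α (F.σ δ.base)) _
          (f.1 (F.endMinv δ.base (F.endMinv γ.base v))))
    rw [map_smul, smul_smul, E.act_act _ _ rfl h2, ← E.act_act _ _ h3 h2, ← f.2, h1, map_smul,
      map_smul, smul_smul]
    · congr 1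
      push_cast
      ring
    · exact smul_eq_of_quotient hX _ _
    · exact F.σ_smul hX h)
  act_circle c x h f := Subtype.ext (LinearMap.ext fun v => by
    have h1 := E.act_one (x := x) (one_smul G x) (f.1 v)
    have h2 : CentralExt.lift α (F.σ 1) = 1 := by rw [F.σ_one]; rfl
    change (c : ℂ) • E.act (CentralExt.lift α (F.σ 1)) _ (f.1 (F.endMinv 1 v)) = (c : ℂ) • f.1 v
    rw [F.endMinv_one, Module.End.one_apply]
    exact congrArg _ ((E.act_congr h2 _ _ _).trans h1))

end TwistedFamily

end HomBundle

/-! ### Local triviality of `Hom(V_τ, E)` -/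

section HomIsBundle

variable {G : Type w} [Group G] {α : NormalizedCocycle G} {A : Subgroup G}

namespace TwistedFamily

section Average

variable {X : Type u} [MulAction G X] (hA : ∀ (a : A) (x : X), (a : G) • x = x)
  (τ : ProjRep (α.res A)) (E : TwistedFamily α X) (x : X)

/-- The action of the central extension of `A` on linear maps `V_τ → E_x` by conjugation. -/
def conjHom (γ : CentralExt (α.res A)) : (τ.V →ₗ[ℂ] E.fiber x) →ₗ[ℂ] (τ.V →ₗ[ℂ] E.fiber x) where
  toFun f := E.act (CentralExt.incl α A γ) (hA γ.base x) ∘ₗ f ∘ₗ τ.tilde γ⁻¹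
  map_add' f g := by simp [LinearMap.comp_add, LinearMap.add_comp]
  map_smul' c f := by simp [LinearMap.comp_smul, LinearMap.smul_comp]

theorem conjHom_apply (γ : CentralExt (α.res A)) (f : τ.V →ₗ[ℂ] E.fiber x) (v : τ.V) :
    conjHom hA τ E x γ f v =
      E.act (CentralExt.incl α A γ) (hA γ.base x) (f (τ.tilde γ⁻¹ v)) := rfl

theorem conjHom_mul (γ δ : CentralExt (α.res A)) (f : τ.V →ₗ[ℂ] E.fiber x) :
    conjHom hA τ E x (γ * δ) f = conjHom hA τ E x γ (conjHom hA τ E x δ f) := by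
  ext v
  simp only [conjHom_apply]
  rw [mul_inv_rev, map_mul τ.tilde, Module.End.mul_apply]
  exact (E.act_act _ _ (map_mul _ _ _) _ _).symm

theorem conjHom_ofCircle (c : Circle) (f : τ.V →ₗ[ℂ] E.fiber x) :
    conjHom hA τ E x (CentralExt.ofCircle c) f = f := by
  ext v
  have h1 : (CentralExt.ofCircle c : CentralExt (α.res A))⁻¹ = CentralExt.ofCircle c⁻¹ :=
    CentralExt.ext (by simp [CentralExt.ofCircle]) (by
      simp [CentralExt.ofCircle, CentralExt.inv_phase, NormalizedCocycle.map_one_left])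
  rw [conjHom_apply, h1, ProjRep.tilde_apply]
  have h2 := E.act_circle c (x := x) (one_smul G x)
  refine (h2 _).trans ?_
  simp [CentralExt.ofCircle, τ.map_one]

theorem conjHom_eq_lift (γ : CentralExt (α.res A)) (f : τ.V →ₗ[ℂ] E.fiber x) :
    conjHom hA τ E x γ f = conjHom hA τ E x (CentralExt.lift _ γ.base) f := by
  conv_lhs => rw [γ.eq_ofCircle_mul_lift, conjHom_mul, conjHom_ofCircle]

theorem mem_homFiber_iff (f : τ.V →ₗ[ℂ] E.fiber x) :
    f ∈ homFiber hA τ E x ↔ ∀ γ, conjHom hA τ E x γ f = f := by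
  constructor
  · intro hf γ
    ext v
    rw [conjHom_apply, ← hf γ, ← Module.End.mul_apply, ← map_mul, mul_inv_cancel, map_one,
      Module.End.one_apply]
  · intro hf γ v
    conv_lhs => rw [← hf γ]
    rw [conjHom_apply, ← Module.End.mul_apply, ← map_mul, inv_mul_cancel, map_one,
      Module.End.one_apply]

variable [Fintype A]

/-- The average over `A`, a projection onto the equivariant maps. -/
def average : (τ.V →ₗ[ℂ] E.fiber x) →ₗ[ℂ] (τ.V →ₗ[ℂ] E.fiber x) :=
  ((Fintype.card A : ℂ)⁻¹) • ∑ a : A, conjHom hA τ E x (CentralExt.lift _ a)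

theorem average_apply (f : τ.V →ₗ[ℂ] E.fiber x) :
    average hA τ E x f =
      ((Fintype.card A : ℂ)⁻¹) • ∑ a : A, conjHom hA τ E x (CentralExt.lift _ a) f := by
  simp [average]

theorem average_mem (f : τ.V →ₗ[ℂ] E.fiber x) : average hA τ E x f ∈ homFiber hA τ E x := by
  rw [mem_homFiber_iff]
  intro γ
  rw [average_apply, map_smul, map_sum]
  congr 1
  refine Fintype.sum_equiv (Equiv.mulLeft γ.base) _ _ fun a => ?_
  rw [← conjHom_mul, conjHom_eq_lift]
  rfl

theorem average_of_mem {f : τ.V →ₗ[ℂ] E.fiber x} (hf : f ∈ homFiber hA τ E x) :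
    average hA τ E x f = f := by
  rw [mem_homFiber_iff] at hf
  rw [average_apply]
  simp only [hf, Finset.sum_const, Finset.card_univ]
  rw [← Nat.cast_smul_eq_nsmul ℂ, smul_smul, inv_mul_cancel₀, one_smul]
  exact_mod_cast Fintype.card_ne_zero

end Average

section Coordinates

variable {X : Type u} [MulAction G X] (hA : ∀ (a : A) (x : X), (a : G) • x = x)
  (τ : ProjRep (α.res A)) (E : TwistedFamily α X) {n d : ℕ}
  (b : Module.Basis (Fin d) ℂ τ.V) {U : Set X} (φ : ∀ x : U, (Fin n → ℂ) ≃ₗ[ℂ] E.fiber x)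

/-- Coordinates on the space of linear maps `V_τ → E_x`. -/
def coord (x : U) : (Fin d → Fin n → ℂ) ≃ₗ[ℂ] (τ.V →ₗ[ℂ] E.fiber x) :=
  (b.constr ℂ).trans (LinearEquiv.congrRight (φ x))

theorem coord_apply (x : U) (h : Fin d → Fin n → ℂ) (v : τ.V) :
    coord τ E b φ x h v = φ x (b.constr ℂ h v) := rfl

theorem coord_symm_apply (x : U) (f : τ.V →ₗ[ℂ] E.fiber x) (i : Fin d) :
    (coord τ E b φ x).symm f i = (φ x).symm (f (b i)) := by
  obtain ⟨h, rfl⟩ := (coord τ E b φ x).surjective f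
  rw [LinearEquiv.symm_apply_apply, coord_apply, LinearEquiv.symm_apply_apply,
    Module.Basis.constr_basis]

variable [Fintype A]

/-- The averaging projection in coordinates. -/
def proj (x : U) : (Fin d → Fin n → ℂ) →L[ℂ] (Fin d → Fin n → ℂ) :=
  LinearMap.toContinuousLinearMap
    ((coord τ E b φ x).symm.toLinearMap ∘ₗ average hA τ E x ∘ₗ (coord τ E b φ x).toLinearMap)

theorem proj_apply (x : U) (h : Fin d → Fin n → ℂ) :
    proj hA τ E b φ x h = (coord τ E b φ x).symm (average hA τ E x (coord τ E b φ x h)) := rfl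

theorem coord_proj (x : U) (h : Fin d → Fin n → ℂ) :
    coord τ E b φ x (proj hA τ E b φ x h) = average hA τ E x (coord τ E b φ x h) := by
  rw [proj_apply, LinearEquiv.apply_symm_apply]

theorem proj_mul_proj (x : U) : proj hA τ E b φ x * proj hA τ E b φ x = proj hA τ E b φ x := by
  ext1 h
  apply (coord τ E b φ x).injective
  rw [mul_apply_eq_comp, coord_proj, coord_proj, average_of_mem]
  exact average_mem hA τ E x _

theorem continuous_proj' [TopologicalSpace X] (hE : E.IsBundle)
    (hφ : Topology.IsEmbedding (fun p : U × (Fin n → ℂ) => (⟨p.1, φ p.1 p.2⟩ : E.Total))) :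
    Continuous (proj hA τ E b φ) := by
  rw [continuous_clm_apply]
  intro h
  refine continuous_pi fun i => ?_
  have key : ∀ (a : A) (w : Fin n → ℂ), Continuous (fun x : U =>
      (φ x).symm (E.act (CentralExt.incl α A (CentralExt.lift _ a)) (hA a x) (φ x w))) := by
    intro a w
    have h1 : Continuous (fun x : U =>
        (⟨x, E.act (CentralExt.incl α A (CentralExt.lift _ a)) (hA a x) (φ x w)⟩ : E.Total)) := by
      refine (hE.continuous_act.comp ((continuous_const
        (y := CentralExt.incl α A (CentralExt.lift _ a))).prodMk
        (hφ.continuous.comp (continuous_id.prodMk (continuous_const (y := w)))))).congr ?_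
      intro x
      exact (E.mk_act _ _ _).symm
    have h2 : Continuous (fun x : U => (x, (φ x).symm
        (E.act (CentralExt.incl α A (CentralExt.lift _ a)) (hA a x) (φ x w)))) := by
      rw [hφ.isInducing.continuous_iff]
      refine h1.congr fun x => ?_
      simp
    exact _root_.continuous_snd.comp h2
  have h3 : ∀ x : U, proj hA τ E b φ x h i = ((Fintype.card A : ℂ)⁻¹) • ∑ a : A,
      (φ x).symm (E.act (CentralExt.incl α A (CentralExt.lift _ a)) (hA a x)
        (φ x (b.constr ℂ h (τ.tilde (CentralExt.lift _ a)⁻¹ (b i))))) := by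
    intro x
    rw [proj_apply, coord_symm_apply, average_apply, LinearMap.smul_apply, map_smul,
      LinearMap.sum_apply, map_sum]
    rfl
  simp only [h3]
  exact (continuous_finsetSum _ fun a _ => key a _).const_smul ((Fintype.card A : ℂ)⁻¹)

/-- The comparison of the projections at two points. -/
def transport (x₀ x : U) : (Fin d → Fin n → ℂ) →L[ℂ] (Fin d → Fin n → ℂ) :=
  proj hA τ E b φ x * proj hA τ E b φ x₀ + (1 - proj hA τ E b φ x) * (1 - proj hA τ E b φ x₀)

theorem transport_self (x₀ : U) : transport hA τ E b φ x₀ x₀ = 1 := by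
  have h := proj_mul_proj hA τ E b φ x₀
  simp only [transport, sub_mul, mul_sub, one_mul, mul_one, h]
  abel

theorem proj_mul_transport (x₀ x : U) :
    proj hA τ E b φ x * transport hA τ E b φ x₀ x =
      transport hA τ E b φ x₀ x * proj hA τ E b φ x₀ := by
  have h := proj_mul_proj hA τ E b φ x₀
  have h' := proj_mul_proj hA τ E b φ x
  simp only [transport, sub_mul, mul_sub, one_mul, mul_one, add_mul, mul_add, mul_assoc, h]
  simp only [← mul_assoc, h']
  abel

end Coordinates

section Main

variable [A.Normal] {τ : ProjRep (α.res A)} (hτ : τ.IsIrreducible) (F : Frame τ)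
  {X : Type u} [MulAction G X] [MulAction (G ⧸ A) X]
  (hX : ∀ (g : G) (x : X), (g : G ⧸ A) • x = g • x) {E : TwistedFamily α X}

theorem continuous_hom_eval (E : TwistedFamily α X) :
    Continuous (fun e : (E.hom hτ F hX).Total => (fun v => ⟨e.proj, e.snd.1 v⟩ : τ.V → E.Total)) :=
  continuous_induced_dom

theorem continuous_hom_eval_apply (E : TwistedFamily α X) (v : τ.V) :
    Continuous (fun e : (E.hom hτ F hX).Total => (⟨e.proj, e.snd.1 v⟩ : E.Total)) :=
  (continuous_apply v).comp (continuous_hom_eval hτ F hX E)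

variable [Finite A] [TopologicalSpace X]

theorem hom_locally_trivial (hE : E.IsBundle) (x₀ : X) : ∃ U : Set X, IsOpen U ∧ x₀ ∈ U ∧
    ∃ (n : ℕ) (φ : ∀ x : U, (Fin n → ℂ) ≃ₗ[ℂ] (E.hom hτ F hX).fiber x),
      Topology.IsEmbedding
        (fun p : U × (Fin n → ℂ) => (⟨p.1, φ p.1 p.2⟩ : (E.hom hτ F hX).Total)) := by
  have _ : Fintype A := Fintype.ofFinite A
  have hA := smul_eq_of_quotient (A := A) hX
  obtain ⟨U, hU, hxU, n, φ, hφ⟩ := hE.locally_trivial x₀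
  let b := Module.finBasis ℂ τ.V
  let y₀ : U := ⟨x₀, hxU⟩
  let P : U → _ := proj hA τ E b φ
  let T : U → _ := transport hA τ E b φ y₀
  have hPc : Continuous P := continuous_proj' hA τ E b φ hE hφ
  have hTc : Continuous T :=
    (hPc.mul continuous_const).add ((continuous_const.sub hPc).mul continuous_const)
  have hPT : ∀ x, P x * T x = T x * P y₀ := proj_mul_transport hA τ E b φ y₀
  let W : Set U := {x | IsUnit (T x)}
  have hW : IsOpen W := Units.isOpen.preimage hTc
  have hy₀ : y₀ ∈ W := by
    change IsUnit (T y₀)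
    rw [show T y₀ = 1 from transport_self hA τ E b φ y₀]
    exact isUnit_one
  let U' : Set X := {x | ∃ h : x ∈ U, (⟨x, h⟩ : U) ∈ W}
  have hU' : IsOpen U' := by
    convert! hU.isOpenMap_subtype_val W hW using 1
    ext x
    simp [U']
  let j : U' → U := fun x => ⟨x, x.2.choose⟩
  have hj : Continuous j := by fun_prop
  have hjW : ∀ x, IsUnit (T (j x)) := fun x => x.2.choose_spec
  let R : U' → _ := fun x => Ring.inverse (T (j x))
  have hRc : Continuous R := by
    rw [continuous_iff_continuousAt]
    intro x
    obtain ⟨u, hu⟩ := hjW x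
    have h1 := NormedRing.inverse_continuousAt u
    rw [hu] at h1
    exact ContinuousAt.comp (f := fun x => T (j x)) h1 (hTc.comp hj).continuousAt
  have hTR : ∀ x, T (j x) * R x = 1 := fun x => Ring.mul_inverse_cancel _ (hjW x)
  have hRT : ∀ x, R x * T (j x) = 1 := fun x => Ring.inverse_mul_cancel _ (hjW x)
  have hTRa : ∀ x h, T (j x) (R x h) = h := fun x h => congrArg (fun S => S h) (hTR x)
  have hRTa : ∀ x h, R x (T (j x) h) = h := fun x h => congrArg (fun S => S h) (hRT x)
  have hPTa : ∀ x h, P x (T x h) = T x (P y₀ h) := fun x h => congrArg (fun S => S h) (hPT x)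
  have hPP : ∀ h, P y₀ (P y₀ h) = P y₀ h := fun h =>
    congrArg (fun S => S h) (proj_mul_proj hA τ E b φ y₀)
  let S : Submodule ℂ (Fin (Module.finrank ℂ τ.V) → Fin n → ℂ) := LinearMap.range (P y₀).toLinearMap
  have hS : ∀ s : S, P y₀ s = s := by
    rintro ⟨_, h, rfl⟩
    exact hPP h
  have hcoord : ∀ (x : U) h, coord τ E b φ x (P x h) = average hA τ E x (coord τ E b φ x h) :=
    coord_proj hA τ E b φ
  let ψ : ∀ x : U', S ≃ₗ[ℂ] (E.hom hτ F hX).fiber x := fun x =>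
    { toFun := fun s => (⟨coord τ E b φ (j x) (T (j x) s), by
        rw [← hS s, ← hPTa, hcoord]
        exact average_mem hA τ E x _⟩ : homFiber hA τ E x)
      map_add' := fun s t => by
        refine Subtype.ext ?_
        change coord τ E b φ (j x) (T (j x) (s + t : S).1) =
          coord τ E b φ (j x) (T (j x) s.1) + coord τ E b φ (j x) (T (j x) t.1)
        rw [Submodule.coe_add, map_add, map_add]
      map_smul' := fun c s => by
        refine Subtype.ext ?_
        change coord τ E b φ (j x) (T (j x) (c • s : S).1) =
          c • coord τ E b φ (j x) (T (j x) s.1)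
        rw [Submodule.coe_smul, map_smul, map_smul]
      invFun := fun (f : homFiber hA τ E x) => ⟨R x ((coord τ E b φ (j x)).symm f.1), by
        have h1 : P (j x) ((coord τ E b φ (j x)).symm f.1) = (coord τ E b φ (j x)).symm f.1 := by
          apply (coord τ E b φ (j x)).injective
          rw [hcoord, LinearEquiv.apply_symm_apply, average_of_mem hA τ E _ f.2]
        refine ⟨R x ((coord τ E b φ (j x)).symm f.1), ?_⟩
        have h2 := hPTa (j x) (R x ((coord τ E b φ (j x)).symm f.1))
        rw [hTRa, h1] at h2
        have h3 := congrArg (R x) h2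
        rw [hRTa] at h3
        exact h3.symm⟩
      left_inv := fun s => Subtype.ext (by simp [hRTa])
      right_inv := fun (f : homFiber hA τ E x) => Subtype.ext (by simp [hTRa]) }
  let m := Module.finrank ℂ S
  let κ : (Fin m → ℂ) ≃L[ℂ] S := (Module.finBasis ℂ S).equivFun.symm.toContinuousLinearEquiv
  refine ⟨U', hU', ⟨hxU, hy₀⟩, m, fun x => κ.toLinearEquiv.trans (ψ x), ?_⟩
  let PS : (Fin (Module.finrank ℂ τ.V) → Fin n → ℂ) → S := fun h => ⟨P y₀ h, ⟨h, rfl⟩⟩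
  have hPS : Continuous PS := (P y₀).continuous.subtype_mk _
  have hPSs : ∀ s : S, PS s = s := fun s => Subtype.ext (hS s)
  have e1 : Topology.IsEmbedding (fun p : U' × (Fin m → ℂ) =>
      (p.1, T (j p.1) (κ p.2 : Fin (Module.finrank ℂ τ.V) → Fin n → ℂ))) := by
    refine Function.LeftInverse.isEmbedding
      (f := fun p : U' × (Fin (Module.finrank ℂ τ.V) → Fin n → ℂ) =>
        (p.1, κ.symm (PS (R p.1 p.2)))) ?_ ?_ ?_
    · intro p
      simp [hRTa, hPSs]
    · have := (hRc.comp _root_.continuous_fst).clm_apply (_root_.continuous_snd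
        (X := U') (Y := Fin (Module.finrank ℂ τ.V) → Fin n → ℂ))
      exact _root_.continuous_fst.prodMk (κ.symm.continuous.comp (hPS.comp this))
    · have := (hTc.comp (hj.comp _root_.continuous_fst)).clm_apply
        (continuous_subtype_val.comp (κ.continuous.comp
          (_root_.continuous_snd (X := U') (Y := Fin m → ℂ))))
      exact _root_.continuous_fst.prodMk this
  have e2 : Topology.IsEmbedding (fun p : U' × (Fin m → ℂ) => (fun v : τ.V =>
      ((j p.1, b.constr ℂ (T (j p.1) (κ p.2 : Fin (Module.finrank ℂ τ.V) → Fin n → ℂ)) v) :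
        U × (Fin n → ℂ)))) := by
    refine Topology.IsEmbedding.of_comp
      (g := fun k : τ.V → U × (Fin n → ℂ) => (((k 0).1 : X), fun i => (k (b i)).2)) ?_
      (by fun_prop) ?_
    · refine continuous_pi fun v => (hj.comp _root_.continuous_fst).prodMk ?_
      have h1 : Continuous (fun h : Fin (Module.finrank ℂ τ.V) → Fin n → ℂ =>
          b.constr ℂ h v) :=
        LinearMap.continuous_of_finiteDimensional
          ((LinearMap.applyₗ v : (τ.V →ₗ[ℂ] (Fin n → ℂ)) →ₗ[ℂ] (Fin n → ℂ)) ∘ₗ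
            (b.constr ℂ).toLinearMap)
      exact h1.comp (_root_.continuous_snd.comp e1.continuous)
    · convert! (Topology.IsEmbedding.subtypeVal.prodMap Topology.IsEmbedding.id).comp e1 using 1
      ext p
      · rfl
      · simp only [Function.comp_apply, Prod.map_snd, id_eq, Module.Basis.constr_basis]
  have e3 := (Topology.IsEmbedding.piMap (fun _ : τ.V => hφ)).comp e2
  exact Topology.IsEmbedding.of_comp (continuous_induced_rng.2 e3.continuous)
    (continuous_hom_eval hτ F hX E) e3

theorem isBundle_hom (hE : E.IsBundle) : (E.hom hτ F hX).IsBundle where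
  continuous_proj := hE.continuous_proj.comp (continuous_hom_eval_apply hτ F hX E 0)
  locally_trivial := hom_locally_trivial hτ F hX hE
  continuous_act := by
    refine CentralExt.continuous_of_base fun q => continuous_induced_rng.2 ?_
    refine continuous_pi fun v => ?_
    have h1 : Continuous (fun z : Circle => (⟨F.σ q, z⟩ : CentralExt α)) :=
      CentralExt.continuous_mk _
    refine (hE.continuous_act.comp (h1.prodMap
      (continuous_hom_eval_apply hτ F hX E (F.endMinv q v)))).congr ?_
    rintro ⟨z, x, f⟩
    have h2 := F.σ_smul hX (q := q) (x := x) rfl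
    change (⟨F.σ q • x, E.act ⟨F.σ q, z⟩ rfl (f.1 (F.endMinv q v))⟩ : E.Total) =
      ⟨q • x, (z : ℂ) • E.act (CentralExt.lift α (F.σ q)) h2 (f.1 (F.endMinv q v))⟩
    rw [← E.mk_act ⟨F.σ q, z⟩ h2]
    congr 1
    refine (E.act_act h2 (one_smul G _) (CentralExt.eq_ofCircle_mul_lift ⟨F.σ q, z⟩) h2 _).symm.trans ?_
    exact E.act_circle z (one_smul G _) _

end Main

end TwistedFamily

/-- The bundle `Hom_{Ã_α}(V_τ, E)`, for an irreducible `α`-representation `τ` of `A`. -/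
def TwistedBundle.hom [A.Normal] [Finite A] {τ : ProjRep (α.res A)} (hτ : τ.IsIrreducible)
    (F : Frame τ) {X : Type u} [TopologicalSpace X] [MulAction G X] [MulAction (G ⧸ A) X]
    (hX : ∀ (g : G) (x : X), (g : G ⧸ A) • x = g • x)
    (E : TwistedBundle α X) : TwistedBundle (F.beta hτ) X :=
  ⟨E.toTwistedFamily.hom hτ F hX, TwistedFamily.isBundle_hom hτ F hX E.isBundle⟩

end HomIsBundle

/-! ### Spaces on which `A` acts trivially -/

/-- A compact Hausdorff `G`-space on which the subgroup `A` acts trivially (as `G` is finite and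
discrete, the action is continuous when each element acts by a continuous map). -/
structure TrivSpace {G : Type w} [Group G] (A : Subgroup G) where
  carrier : Type u
  [topologicalSpace : TopologicalSpace carrier]
  [compactSpace : CompactSpace carrier]
  [t2Space : T2Space carrier]
  [mulAction : MulAction G carrier]
  [continuousConstSMul : ContinuousConstSMul G carrier]
  smul_eq : ∀ a ∈ A, ∀ x : carrier, a • x = x

attribute [instance] TrivSpace.topologicalSpace TrivSpace.compactSpace TrivSpace.t2Space
  TrivSpace.mulAction TrivSpace.continuousConstSMul

namespace TrivSpace

variable {G : Type w} [Group G] {A : Subgroup G} [A.Normal]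

instance : CoeSort (TrivSpace.{u} A) (Type u) := ⟨carrier⟩

/-- The induced action of `Q = G / A`. -/
instance quotientAction (X : TrivSpace.{u} A) : MulAction (G ⧸ A) X :=
  MulAction.compHom X (QuotientGroup.lift A (MulAction.toPermHom G X) fun a ha =>
    Equiv.ext (X.smul_eq a ha))

theorem mk_smul (X : TrivSpace.{u} A) (g : G) (x : X) : (g : G ⧸ A) • x = g • x := rfl

instance (X : TrivSpace.{u} A) : ContinuousConstSMul (G ⧸ A) X :=
  ⟨fun q => QuotientGroup.induction_on q fun g => continuous_const_smul (T := X) g⟩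

instance _root_.TwistedK.continuousConstSMul_subgroup {Γ : Type*} [Group Γ] (H : Subgroup Γ)
    {T : Type*} [TopologicalSpace T] [MulAction Γ T] [ContinuousConstSMul Γ T] :
    ContinuousConstSMul H T := ⟨fun h => continuous_const_smul (h : Γ)⟩

theorem mk_smul_susp (X : TrivSpace.{u} A) (n : ℕ) (g : G) (z : Susp n X) :
    (g : G ⧸ A) • z = g • z := rfl

theorem map_quotient_smul {X Y : TrivSpace.{u} A} {f : Y → X}
    (hf : ∀ (g : G) y, f (g • y) = g • f y) (H : Subgroup (G ⧸ A)) (q : H) (y : Y) :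
    f (q • y) = q • f y := by
  obtain ⟨q, hq⟩ := q
  exact QuotientGroup.induction_on (C := fun q => f (q • y) = q • f y) q fun g => hf g y

end TrivSpace

/-- For a `G`-orbit `o` in `Irr^α(A)`: an irreducible `α`-representation `τ` whose class lies in `o`,
together with the choices which define `β_{τ,α}`. -/
structure OrbitDatum {G : Type w} [Group G] (A : Subgroup G) [A.Normal] (α : NormalizedCocycle G)
    (o : MulAction.orbitRel.Quotient G (Irr (α.res A))) where
  τ : ProjRep (α.res A)
  irreducible : τ.IsIrreducible
  mem_orbit : Irr.mk τ irreducible ∈ o.orbit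
  frame : Frame τ

/-- The cocycle `β_{τ,α}` on `Q_[τ]`. -/
abbrev OrbitDatum.beta {G : Type w} [Group G] {A : Subgroup G} [A.Normal] {α : NormalizedCocycle G}
    {o : MulAction.orbitRel.Quotient G (Irr (α.res A))} (d : OrbitDatum A α o) :
    NormalizedCocycle d.τ.quotStab := d.frame.beta d.irreducible

end TwistedK

end

/-! Since `A` acts trivially on `X`, each fibre `E_x` is an `α`-representation of the finite group
`A`. It is therefore the direct sum of isotypic parts `V_τ ⊗ Hom_A(V_τ, E_x)`, with `τ` in
`Irr^α(A)`. An element `g` of `G` carries the `τ`-part over `x` onto the `g · τ`-part over `g x`. So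
`E` is determined by its `τ`-parts for one `τ` in each `G`-orbit, together with the action of
`G_[τ]` on them. On `V_τ` the assignment `σ(q) a ↦ M_q τ(a)` extends `τ` to `G_[τ]` up to the
inverse of `β_{τ,α}`. The multiplicity bundle `Hom(V_τ, E)` carries the compensating action of
`Q_[τ]`, twisted by `β_{τ,α}`. Conversely, a `β_{τ,α}`-twisted bundle `F` gives the bundle `V_τ ⊗ F`
for `G_[τ]`, where the two defects cancel, and this can be induced up to `G`.

The decomposition already holds for the monoids of isomorphism classes of bundles (`Vect.homEquiv`),
over any base on which `A` acts trivially.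

Injectivity: isomorphisms `φ_τ : Hom(V_τ, E) ≅ Hom(V_τ, E')` define `f(v) ↦ φ_τ(f)(v)` on the
`τ`-parts. The isotypic coefficients are linear combinations of the operators of `A` with constant
coefficients (`ProjRep.coeff`), so this map is defined and continuous on all of `E`. Conjugating by
the elements of `G` and summing gives `globalMap`. By Maschke's theorem the vectors `γ · f(v)` span
each fibre (`eq_top_of_forall_orbit`). On them `globalMap_act` computes the map, and this yields
equivariance and the inverse.

Surjectivity: `Iso.homInduce` identifies `F` with `Hom(V_τ, Ind(V_τ ⊗ F))`. By Schur's lemma the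
maps from a `V_τ'` of another orbit into the induced bundle vanish (`induceEval_eq_zero`).

As `Irr^α(A)` is finite (`Irr.finite`), only finitely many orbits occur, and the Grothendieck group
commutes with finite products. This settles `n = 0`. For `n > 0` the result is applied to `Σⁿ X₊`.
Naturality for the inclusion of the base point shows that the isomorphism restricts to the reduced
groups. -/

noncomputable section

namespace TwistedK

/-! ### Intertwining operators and averaging -/

namespace ProjRep

section Intertwiners

variable {B : Type w} [Group B] {β : NormalizedCocycle B}

/-- The space of intertwining operators between two projective representations. -/
def homs (τ W : ProjRep β) : Submodule ℂ (τ.V →ₗ[ℂ] W.V) where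
  carrier := {f | ∀ b v, f (τ.ρ b v) = W.ρ b (f v)}
  add_mem' hf hg b v := by simp [hf b v, hg b v]
  zero_mem' b v := by simp
  smul_mem' c f hf b v := by simp [hf b v]

variable {τ τ' W : ProjRep β}

theorem homs_tilde {f : τ.V →ₗ[ℂ] W.V} (hf : f ∈ homs τ W) (γ : CentralExt β) (v : τ.V) :
    f (τ.tilde γ v) = W.tilde γ (f v) := by
  simp [tilde_apply, hf γ.base v]

theorem tilde_ofCircle (τ : ProjRep β) (z : Circle) :
    τ.tilde (CentralExt.ofCircle z) = (z : ℂ) • (1 : Module.End ℂ τ.V) := by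
  rw [tilde_apply]
  change (z : ℂ) • τ.ρ 1 = _
  rw [τ.map_one]

theorem ofCircle_inv (z : Circle) :
    (CentralExt.ofCircle z : CentralExt β)⁻¹ = CentralExt.ofCircle z⁻¹ :=
  CentralExt.ext (by simp [CentralExt.ofCircle])
    (by simp [CentralExt.ofCircle, CentralExt.inv_phase, NormalizedCocycle.map_one_left])

/-- Conjugation of a linear map by an element of the central extension. -/
def twist (τ W : ProjRep β) (γ : CentralExt β) :
    (τ.V →ₗ[ℂ] W.V) →ₗ[ℂ] (τ.V →ₗ[ℂ] W.V) where
  toFun f := W.tilde γ ∘ₗ f ∘ₗ τ.tilde γ⁻¹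
  map_add' f g := by simp [LinearMap.comp_add, LinearMap.add_comp]
  map_smul' c f := by simp [LinearMap.comp_smul, LinearMap.smul_comp]

theorem twist_apply (γ : CentralExt β) (f : τ.V →ₗ[ℂ] W.V) (v : τ.V) :
    twist τ W γ f v = W.tilde γ (f (τ.tilde γ⁻¹ v)) := rfl

theorem twist_mul (γ δ : CentralExt β) (f : τ.V →ₗ[ℂ] W.V) :
    twist τ W (γ * δ) f = twist τ W γ (twist τ W δ f) := by
  ext v
  simp only [twist_apply, mul_inv_rev, _root_.map_mul, Module.End.mul_apply]

theorem twist_ofCircle (z : Circle) (f : τ.V →ₗ[ℂ] W.V) :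
    twist τ W (CentralExt.ofCircle z) f = f := by
  ext v
  rw [twist_apply, ofCircle_inv, tilde_ofCircle, tilde_ofCircle]
  simp

/-- The circle acts by inverse scalars on source and target, so conjugation factors through `B`.
This is why a finite sum over `B` can replace integration over the central extension. -/
theorem twist_eq_lift (γ : CentralExt β) (f : τ.V →ₗ[ℂ] W.V) :
    twist τ W γ f = twist τ W (CentralExt.lift β γ.base) f := by
  conv_lhs => rw [γ.eq_ofCircle_mul_lift, twist_mul, twist_ofCircle]

theorem tilde_inv_tilde (τ : ProjRep β) (γ : CentralExt β) (v : τ.V) :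
    τ.tilde γ⁻¹ (τ.tilde γ v) = v := by
  rw [← Module.End.mul_apply, ← _root_.map_mul, inv_mul_cancel, _root_.map_one,
    Module.End.one_apply]

theorem tilde_tilde_inv (τ : ProjRep β) (γ : CentralExt β) (v : τ.V) :
    τ.tilde γ (τ.tilde γ⁻¹ v) = v := by
  rw [← Module.End.mul_apply, ← _root_.map_mul, mul_inv_cancel, _root_.map_one,
    Module.End.one_apply]

theorem mem_homs_iff_twist (f : τ.V →ₗ[ℂ] W.V) :
    f ∈ homs τ W ↔ ∀ γ, twist τ W γ f = f := by
  constructor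
  · intro hf γ
    ext v
    rw [twist_apply, homs_tilde hf, tilde_tilde_inv]
  · intro h b v
    conv_lhs => rw [← h (CentralExt.lift β b)]
    rw [twist_apply, ← tilde_lift, tilde_inv_tilde, tilde_lift]

section Average

variable [Fintype B]

/-- The average of a linear map over the group, an intertwining operator. -/
def avg (τ W : ProjRep β) : (τ.V →ₗ[ℂ] W.V) →ₗ[ℂ] (τ.V →ₗ[ℂ] W.V) :=
  ((Fintype.card B : ℂ)⁻¹) • ∑ b : B, twist τ W (CentralExt.lift β b)

theorem avg_eq (f : τ.V →ₗ[ℂ] W.V) :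
    avg τ W f = ((Fintype.card B : ℂ)⁻¹) • ∑ b : B, twist τ W (CentralExt.lift β b) f := by
  simp [avg]

theorem avg_apply (f : τ.V →ₗ[ℂ] W.V) (v : τ.V) :
    avg τ W f v = ((Fintype.card B : ℂ)⁻¹) •
      ∑ b : B, W.ρ b (f (τ.tilde (CentralExt.lift β b)⁻¹ v)) := by
  simp only [avg_eq, LinearMap.smul_apply, LinearMap.sum_apply, twist_apply, tilde_lift]

/-- Twisting the average permutes its summands by left translation; the cocycle phases produced on
the way have no effect by `twist_eq_lift`. -/
theorem avg_mem (f : τ.V →ₗ[ℂ] W.V) : avg τ W f ∈ homs τ W := by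
  rw [mem_homs_iff_twist]
  intro γ
  rw [avg_eq, _root_.map_smul, map_sum]
  congr 1
  refine Fintype.sum_equiv (Equiv.mulLeft γ.base) _ _ fun a => ?_
  rw [← twist_mul, twist_eq_lift]
  rfl

theorem comp_avg {g : W.V →ₗ[ℂ] W'.V} (hg : g ∈ homs W W') (f : τ.V →ₗ[ℂ] W.V) :
    g ∘ₗ avg τ W f = avg τ W' (g ∘ₗ f) := by
  ext v
  simp only [LinearMap.comp_apply, avg_apply, _root_.map_smul, map_sum]
  congr 1
  exact Finset.sum_congr rfl fun b _ => hg b _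

theorem trace_avg (f : Module.End ℂ τ.V) :
    LinearMap.trace ℂ τ.V (avg τ τ f) = LinearMap.trace ℂ τ.V f := by
  have h : ∀ γ, LinearMap.trace ℂ τ.V (twist τ τ γ f) = LinearMap.trace ℂ τ.V f := by
    intro γ
    change LinearMap.trace ℂ τ.V (τ.tilde γ * (f * τ.tilde γ⁻¹)) = _
    rw [LinearMap.trace_mul_comm, mul_assoc, ← _root_.map_mul, inv_mul_cancel, _root_.map_one,
      mul_one]
  rw [avg_eq, _root_.map_smul, map_sum]
  simp only [h, Finset.sum_const, Finset.card_univ]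
  rw [← Nat.cast_smul_eq_nsmul ℂ, smul_smul, inv_mul_cancel₀, one_smul]
  exact_mod_cast Fintype.card_ne_zero

end Average

/-! ### Schur's lemma -/

theorem ker_eq_bot_or_eq_zero (hτ : τ.IsIrreducible) {f : τ.V →ₗ[ℂ] W.V} (hf : f ∈ homs τ W) :
    LinearMap.ker f = ⊥ ∨ f = 0 :=
  (hτ.2 (LinearMap.ker f) fun b v hv => by
    rw [LinearMap.mem_ker] at hv ⊢
    rw [hf, hv, map_zero]).imp_right LinearMap.ker_eq_top.1

/-- Schur's lemma: kernel and range are invariant subspaces, and irreducibility leaves only the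
trivial possibilities. -/
theorem isIso_of_homs_ne_zero (hτ : τ.IsIrreducible) (hτ' : τ'.IsIrreducible)
    {f : τ.V →ₗ[ℂ] τ'.V} (hf : f ∈ homs τ τ') (h0 : f ≠ 0) : τ.IsIso τ' := by
  have h1 := (ker_eq_bot_or_eq_zero hτ hf).resolve_right h0
  have h2 : LinearMap.range f = ⊤ := (hτ'.2 (LinearMap.range f) (by
    rintro b _ ⟨v, rfl⟩
    exact ⟨τ.ρ b v, hf b v⟩)).resolve_left fun h => h0 (LinearMap.range_eq_bot.1 h)
  exact ⟨LinearEquiv.ofBijective f ⟨LinearMap.ker_eq_bot.1 h1, LinearMap.range_eq_top.1 h2⟩,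
    fun b v => hf b v⟩

theorem homs_eq_zero (hτ : τ.IsIrreducible) (hτ' : τ'.IsIrreducible) (h : ¬ τ.IsIso τ')
    {f : τ.V →ₗ[ℂ] τ'.V} (hf : f ∈ homs τ τ') : f = 0 := by
  by_contra h0
  exact h (isIso_of_homs_ne_zero hτ hτ' hf h0)

theorem exists_eq_smul_one (hτ : τ.IsIrreducible) {f : Module.End ℂ τ.V} (hf : f ∈ homs τ τ) :
    ∃ c : ℂ, f = c • 1 := by
  have := hτ.1
  obtain ⟨c, hc⟩ := Module.End.exists_eigenvalue f
  have htop : Module.End.eigenspace f c = ⊤ := by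
    refine (hτ.2 _ fun a v hv => ?_).resolve_left hc
    rw [Module.End.mem_eigenspace_iff] at hv ⊢
    rw [hf, hv, _root_.map_smul]
  exact ⟨c, LinearMap.ext fun v => Module.End.mem_eigenspace_iff.1 (htop ▸ Submodule.mem_top)⟩

theorem finrank_ne_zero (hτ : τ.IsIrreducible) : (Module.finrank ℂ τ.V : ℂ) ≠ 0 := by
  have := hτ.1
  exact_mod_cast Module.finrank_pos.ne'

/-- The average is an intertwining operator, hence a scalar, and averaging preserves the trace;
dividing by the dimension identifies the scalar. -/
theorem avg_eq_trace_smul [Fintype B] (hτ : τ.IsIrreducible) (f : Module.End ℂ τ.V) :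
    avg τ τ f = (LinearMap.trace ℂ τ.V f * (Module.finrank ℂ τ.V : ℂ)⁻¹) • 1 := by
  obtain ⟨c, hc⟩ := exists_eq_smul_one hτ (avg_mem (τ := τ) (W := τ) f)
  have h := trace_avg f
  rw [hc, _root_.map_smul, LinearMap.trace_one, smul_eq_mul] at h
  rw [← h, mul_assoc, mul_inv_cancel₀ (finrank_ne_zero hτ), mul_one, ← hc]

/-! ### Isotypic coefficients -/

section Coeff

variable [Fintype B]

/-- The basis of the representation space used to define isotypic coefficients. -/
def basis (τ : ProjRep β) : Module.Basis (Fin (Module.finrank ℂ τ.V)) ℂ τ.V :=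
  Module.finBasis ℂ τ.V

/-- The coefficient maps `W → Hom(τ, W)`; on `f v` with `f` an intertwining operator, the `i`-th
one is `vᵢ f`. -/
def coeff (τ W : ProjRep β) (i : Fin (Module.finrank ℂ τ.V)) : W.V →ₗ[ℂ] (τ.V →ₗ[ℂ] W.V) :=
  (Module.finrank ℂ τ.V : ℂ) • (avg τ W ∘ₗ LinearMap.smulRightₗ (τ.basis.coord i))

theorem coeff_apply (i : Fin (Module.finrank ℂ τ.V)) (w : W.V) :
    coeff τ W i w = (Module.finrank ℂ τ.V : ℂ) • avg τ W ((τ.basis.coord i).smulRight w) := rfl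

theorem coeff_apply_apply (i : Fin (Module.finrank ℂ τ.V)) (w : W.V) (v : τ.V) :
    coeff τ W i w v = ∑ b : B, ((Module.finrank ℂ τ.V : ℂ) * (Fintype.card B : ℂ)⁻¹ *
      τ.basis.coord i (τ.tilde (CentralExt.lift β b)⁻¹ v)) • W.ρ b w := by
  rw [coeff_apply, LinearMap.smul_apply, avg_apply, smul_smul, Finset.smul_sum]
  refine Finset.sum_congr rfl fun b _ => ?_
  rw [LinearMap.smulRight_apply, _root_.map_smul, smul_smul]

theorem coeff_mem (i : Fin (Module.finrank ℂ τ.V)) (w : W.V) : coeff τ W i w ∈ homs τ W :=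
  Submodule.smul_mem _ _ (avg_mem _)

/-- The rank one map with value `f v` is `f` composed with a rank one endomorphism of `V_τ`. The
average of the latter is its trace `vᵢ` divided by the dimension, and the factor in `coeff` cancels
this denominator. -/
theorem coeff_apply_of_mem (hτ : τ.IsIrreducible) {f : τ.V →ₗ[ℂ] W.V} (hf : f ∈ homs τ W)
    (i : Fin (Module.finrank ℂ τ.V)) (v : τ.V) :
    coeff τ W i (f v) = τ.basis.coord i v • f := by
  have h : (τ.basis.coord i).smulRight (f v) = f ∘ₗ (τ.basis.coord i).smulRight v := by
    ext; simp
  rw [coeff_apply, h, ← comp_avg hf, avg_eq_trace_smul hτ, LinearMap.trace_smulRight]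
  ext u
  simp only [LinearMap.smul_apply, LinearMap.comp_apply, _root_.map_smul, smul_smul,
    Module.End.one_apply]
  congr 1
  have := finrank_ne_zero hτ
  field_simp

/-- The same factorization now passes through an averaged map between non-isomorphic irreducibles,
which Schur's lemma kills. -/
theorem coeff_apply_eq_zero (hτ : τ.IsIrreducible) (hτ' : τ'.IsIrreducible) (h : ¬ τ.IsIso τ')
    {f : τ'.V →ₗ[ℂ] W.V} (hf : f ∈ homs τ' W) (i : Fin (Module.finrank ℂ τ.V)) (v : τ'.V) :
    coeff τ W i (f v) = 0 := by
  have h1 : (τ.basis.coord i).smulRight (f v) = f ∘ₗ (τ.basis.coord i).smulRight v := by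
    ext; simp
  rw [coeff_apply, h1, ← comp_avg hf, homs_eq_zero hτ hτ' h (avg_mem _), LinearMap.comp_zero,
    smul_zero]

end Coeff

/-! ### Irreducible subrepresentations -/

/-- The representation on an invariant subspace. -/
def subrep (W : ProjRep β) (K : Submodule ℂ W.V) (hK : ∀ b, ∀ v ∈ K, W.ρ b v ∈ K) :
    ProjRep β where
  V := K
  ρ b := (W.ρ b).restrict (hK b)
  map_one := LinearMap.ext fun v => Subtype.ext
    (congrArg (fun T : Module.End ℂ W.V => T v) W.map_one)
  map_mul g h := LinearMap.ext fun v => Subtype.ext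
    (congrArg (fun T : Module.End ℂ W.V => T v) (W.map_mul g h))

theorem subtype_mem_homs (W : ProjRep β) (K : Submodule ℂ W.V) (hK : ∀ b, ∀ v ∈ K, W.ρ b v ∈ K) :
    K.subtype ∈ homs (W.subrep K hK) W := fun _ _ => rfl

/-- A minimal nonzero invariant subspace of `K` is irreducible; it exists because subspaces of a
finite-dimensional space are well-founded. -/
theorem exists_irreducible_le (W : ProjRep β) (K : Submodule ℂ W.V)
    (hK : ∀ b, ∀ v ∈ K, W.ρ b v ∈ K) (h0 : K ≠ ⊥) :
    ∃ τ : ProjRep β, τ.IsIrreducible ∧ ∃ f ∈ homs τ W, (∀ v, f v ∈ K) ∧ ∃ v, f v ≠ 0 := by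
  let S : Set (Submodule ℂ W.V) := {L | L ≤ K ∧ (∀ b, ∀ v ∈ L, W.ρ b v ∈ L) ∧ L ≠ ⊥}
  obtain ⟨L, ⟨hLK, hL, hL0⟩, hmin⟩ :=
    (wellFounded_lt (α := Submodule ℂ W.V)).has_min S ⟨K, le_rfl, hK, h0⟩
  have hnt : Nontrivial L := Submodule.nontrivial_iff_ne_bot.2 hL0
  refine ⟨W.subrep L hL, ⟨hnt, fun (M : Submodule ℂ L) hM => ?_⟩, L.subtype,
    subtype_mem_homs W L hL, fun v => hLK v.2, ?_⟩
  · by_contra! hne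
    have h1 : M.map L.subtype ≤ L := Submodule.map_subtype_le L M
    refine hmin (M.map L.subtype) ⟨h1.trans hLK, ?_, ?_⟩ (lt_of_le_of_ne h1 ?_)
    · rintro b _ ⟨v, hv, rfl⟩
      exact ⟨_, hM b v hv, rfl⟩
    · intro h
      exact hne.1 (Submodule.map_injective_of_injective L.injective_subtype
        (h.trans (Submodule.map_bot _).symm))
    · intro h
      exact hne.2 (Submodule.map_injective_of_injective L.injective_subtype
        (h.trans (Submodule.map_subtype_top L).symm))
  · obtain ⟨v, hv⟩ := exists_ne (0 : L)
    exact ⟨v, fun h => hv (Subtype.ext h)⟩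

/-- Maschke's theorem: the images of the intertwining operators from irreducible representations
span. -/
theorem eq_top_of_forall_homs [Finite B] (W : ProjRep β) (S : Submodule ℂ W.V)
    (h : ∀ τ : ProjRep β, τ.IsIrreducible → ∀ f ∈ homs τ W, ∀ v, f v ∈ S) : S = ⊤ := by
  have _ : Fintype B := Fintype.ofFinite B
  let I : Submodule ℂ W.V := Submodule.span ℂ
    {w | ∃ τ : ProjRep β, τ.IsIrreducible ∧ ∃ f ∈ homs τ W, ∃ v, f v = w}
  have hIS : I ≤ S := Submodule.span_le.2 (by
    rintro _ ⟨τ, hτ, f, hf, v, rfl⟩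
    exact h τ hτ f hf v)
  have hI : ∀ b, ∀ w ∈ I, W.ρ b w ∈ I := by
    intro b w hw
    have : I ≤ I.comap (W.ρ b) := Submodule.span_le.2 (by
      rintro _ ⟨τ, hτ, f, hf, v, rfl⟩
      exact Submodule.subset_span ⟨τ, hτ, f, hf, τ.ρ b v, hf b v⟩)
    exact this hw
  obtain ⟨p, hp⟩ := I.exists_isCompl
  let P : Module.End ℂ W.V := I.subtype ∘ₗ I.projectionOnto p hp
  have hPI : ∀ w, P w ∈ I := fun w => (I.projectionOnto p hp w).2
  have hPid : ∀ w ∈ I, P w = w := fun w hw =>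
    congrArg Subtype.val (Submodule.projectionOnto_apply_left hp ⟨w, hw⟩)
  have htI : ∀ γ, ∀ w ∈ I, W.tilde γ w ∈ I := fun γ w hw => I.smul_mem _ (hI _ _ hw)
  -- Averaging a linear projection onto the invariant subspace `I` keeps it a projection onto `I`
  -- and makes its kernel invariant. A nonzero kernel would contain the image of an irreducible
  -- representation, but such images lie in `I`, where `R` is the identity.
  let R := avg W W P
  have hR : R ∈ homs W W := avg_mem P
  have hRI : ∀ w, R w ∈ I := fun w => by
    change avg W W P w ∈ I
    rw [avg_apply]
    exact I.smul_mem _ (I.sum_mem fun b _ => hI b _ (hPI _))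
  have hRid : ∀ w ∈ I, R w = w := fun w hw => by
    change avg W W P w = w
    rw [avg_apply]
    have : ∀ b : B, W.ρ b (P (W.tilde (CentralExt.lift β b)⁻¹ w)) = w := fun b => by
      rw [hPid _ (htI _ _ hw), ← tilde_lift, tilde_tilde_inv]
    simp only [this, Finset.sum_const, Finset.card_univ]
    rw [← Nat.cast_smul_eq_nsmul ℂ, smul_smul, inv_mul_cancel₀, one_smul]
    exact_mod_cast Fintype.card_ne_zero
  have hker : LinearMap.ker R = ⊥ := by
    by_contra h0
    obtain ⟨τ, hτ, f, hf, hfK, v, hv⟩ := exists_irreducible_le W (LinearMap.ker R) (by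
      intro b w hw
      rw [LinearMap.mem_ker] at hw ⊢
      rw [hR, hw, map_zero]) h0
    exact hv ((hRid _ (Submodule.subset_span ⟨τ, hτ, f, hf, v, rfl⟩)).symm.trans (hfK v))
  refine eq_top_iff.2 fun w _ => hIS ?_
  have : R (w - R w) = 0 := by rw [map_sub, hRid _ (hRI w), sub_self]
  have h2 : w - R w ∈ LinearMap.ker R := this
  rw [hker, Submodule.mem_bot, sub_eq_zero] at h2
  exact h2 ▸ hRI w

end Intertwiners

end ProjRep

/-- A finite group has finitely many classes of irreducible projective representations with a given
cocycle. -/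
instance Irr.finite {B : Type w} [Group B] [Finite B] (β : NormalizedCocycle B) :
    Finite (Irr β) := by
  have _ : Fintype B := Fintype.ofFinite B
  let r : Irr β → ProjRep β := fun c => (Quotient.out c).1
  have hr : ∀ c, (r c).IsIrreducible := fun c => (Quotient.out c).2
  have hne : ∀ c c', c ≠ c' → ¬ (r c).IsIso (r c') := fun c c' h hi =>
    h ((Quotient.out_eq c).symm.trans ((Quotient.sound hi).trans (Quotient.out_eq c')))
  -- Weights for which `∑ b, e c b • ρ b` is the projection onto the `c`-isotypic part of any
  -- representation. Applying a linear relation among them to a vector of one irreducible isolates a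
  -- single coefficient. The family is thus independent in the finite-dimensional space `B → ℂ`, so
  -- its index set is finite.
  let e : Irr β → B → ℂ := fun c b => ∑ i, (Module.finrank ℂ (r c).V : ℂ) *
    (Fintype.card B : ℂ)⁻¹ * (r c).basis.coord i
      ((r c).tilde (CentralExt.lift β b)⁻¹ ((r c).basis i))
  have he : ∀ c (W : ProjRep β) (w : W.V),
      ∑ b, e c b • W.ρ b w = ∑ i, ProjRep.coeff (r c) W i w ((r c).basis i) := by
    intro c W w
    simp only [ProjRep.coeff_apply_apply, e, Finset.sum_smul]
    exact Finset.sum_comm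
  have hli : LinearIndependent ℂ e := by
    rw [linearIndependent_iff']
    intro s k hk c hc
    have := (hr c).1
    obtain ⟨v, hv⟩ := exists_ne (0 : (r c).V)
    have h1 : ∑ c' ∈ s, k c' • ∑ b, e c' b • (r c).ρ b v = 0 := by
      have h2 : ∀ b, ∑ c' ∈ s, k c' * e c' b = 0 := fun b => by
        simpa using congrFun hk b
      simp only [Finset.smul_sum, smul_smul]
      rw [Finset.sum_comm]
      simp only [← Finset.sum_smul, h2, zero_smul, Finset.sum_const_zero]
    have hid : (LinearMap.id : (r c).V →ₗ[ℂ] (r c).V) ∈ ProjRep.homs (r c) (r c) :=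
      fun _ _ => rfl
    rw [Finset.sum_eq_single c] at h1
    · rw [he] at h1
      have h3 : ∀ i, ProjRep.coeff (r c) (r c) i v = (r c).basis.coord i v • LinearMap.id :=
        fun i => ProjRep.coeff_apply_of_mem (hr c) hid i v
      simp only [h3, LinearMap.smul_apply, LinearMap.id_apply, Module.Basis.coord_apply,
        Module.Basis.sum_repr] at h1
      exact (smul_eq_zero.1 h1).resolve_right hv
    · intro c' _ hcc
      rw [he, Finset.sum_eq_zero, smul_zero]
      intro i _
      have := ProjRep.coeff_apply_eq_zero (hr c') (hr c) (hne c' c hcc) hid i v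
      rw [LinearMap.id_apply] at this
      rw [this, LinearMap.zero_apply]
    · exact fun h => absurd hc h
  exact hli.finite

/-! ### Invariant inner products and existence of the choices defining `β_{τ,α}` -/

namespace ProjRep

section InvariantForm

variable {B : Type w} [Group B] {β : NormalizedCocycle B}

theorem ρ_injective (τ : ProjRep β) (b : B) : Function.Injective (τ.ρ b) := by
  intro v v' h
  rw [← tilde_lift] at h
  rw [← tilde_inv_tilde τ (CentralExt.lift β b) v, h, tilde_inv_tilde]

theorem ρ_surjective (τ : ProjRep β) (b : B) : Function.Surjective (τ.ρ b) := fun v =>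
  ⟨τ.tilde (CentralExt.lift β b)⁻¹ v, by rw [← tilde_lift, tilde_tilde_inv]⟩

/-- An inner product which is invariant under a projective representation of a finite group. -/
abbrev invariantForm [Fintype B] (τ : ProjRep β) : InnerProductSpace.Core ℂ τ.V where
  inner v w := ∑ b, ∑ i, starRingEnd ℂ (τ.basis.repr (τ.ρ b v) i) * τ.basis.repr (τ.ρ b w) i
  conj_inner_symm v w := by simp [map_sum, mul_comm]
  re_inner_nonneg v := by
    rw [map_sum]
    refine Finset.sum_nonneg fun b _ => ?_
    rw [map_sum]
    refine Finset.sum_nonneg fun i _ => ?_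
    rw [Complex.conj_mul', ← Complex.ofReal_pow]
    exact sq_nonneg ‖τ.basis.repr (τ.ρ b v) i‖
  add_left u v w := by simp [add_mul, Finset.sum_add_distrib]
  smul_left u v c := by simp [Finset.mul_sum, mul_assoc]
  definite v h := by
    have h1 : ∑ b, ∑ i, ‖τ.basis.repr (τ.ρ b v) i‖ ^ 2 = 0 := by
      have : ((∑ b, ∑ i, ‖τ.basis.repr (τ.ρ b v) i‖ ^ 2 : ℝ) : ℂ) = 0 := by
        push_cast
        simpa only [Complex.conj_mul'] using h
      exact_mod_cast this
    rw [Finset.sum_eq_zero_iff_of_nonneg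
      fun b _ => Finset.sum_nonneg fun i _ => sq_nonneg _] at h1
    -- All summands of the vanishing sum are nonnegative, and the one at the identity is the
    -- standard norm in the chosen basis, which already forces `v = 0`.
    have h2 := h1 1 (Finset.mem_univ _)
    rw [Finset.sum_eq_zero_iff_of_nonneg fun i _ => sq_nonneg _] at h2
    refine τ.basis.repr.map_eq_zero_iff.1 (Finsupp.ext fun i => ?_)
    have h3 := h2 i (Finset.mem_univ _)
    rw [τ.map_one, Module.End.one_apply] at h3
    simpa using h3

/-- Replacing `b` by `b a` permutes the sum, and the cocycle values, having modulus one, cancel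
against their conjugates. -/
theorem invariantForm_unitary [Fintype B] (τ : ProjRep β) (a : B) (v w : τ.V) :
    τ.invariantForm.inner (τ.ρ a v) (τ.ρ a w) = τ.invariantForm.inner v w := by
  change ∑ b, ∑ i, starRingEnd ℂ (τ.basis.repr (τ.ρ b (τ.ρ a v)) i) *
      τ.basis.repr (τ.ρ b (τ.ρ a w)) i =
    ∑ b, ∑ i, starRingEnd ℂ (τ.basis.repr (τ.ρ b v) i) * τ.basis.repr (τ.ρ b w) i
  refine Fintype.sum_equiv (Equiv.mulRight a) _ _ fun b => Finset.sum_congr rfl fun i _ => ?_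
  have h : ∀ v, τ.ρ b (τ.ρ a v) = (β b a : ℂ) • τ.ρ (b * a) v := fun v =>
    congrArg (fun T : Module.End ℂ τ.V => T v) (τ.map_mul b a)
  have hz : starRingEnd ℂ (β b a : ℂ) * (β b a : ℂ) = 1 := by
    rw [← Circle.coe_inv_eq_conj, ← Circle.coe_mul, inv_mul_cancel, Circle.coe_one]
  rw [h, h]
  simp only [_root_.map_smul, Finsupp.smul_apply, smul_eq_mul, Equiv.coe_mulRight, _root_.map_mul]
  linear_combination (starRingEnd ℂ (τ.basis.repr (τ.ρ (b * a) v) i) *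
    τ.basis.repr (τ.ρ (b * a) w) i) * hz

end InvariantForm

end ProjRep

open scoped InnerProductSpace in
/-- A linear automorphism `f` of an inner product space for which `f^* f` is a scalar can be
rescaled to a unitary map. -/
theorem exists_unitary_scaling {V : Type*} [NormedAddCommGroup V] [InnerProductSpace ℂ V]
    [FiniteDimensional ℂ V] [Nontrivial V] (f : V ≃ₗ[ℂ] V)
    (h : ∀ S : Module.End ℂ V, (∀ v w, ⟪v, S w⟫_ℂ = ⟪f v, f w⟫_ℂ) → ∃ c : ℂ, S = c • 1) :
    ∃ k : ℂ, k ≠ 0 ∧ ∀ v w, ⟪k • f v, k • f w⟫_ℂ = ⟪v, w⟫_ℂ := by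
  obtain ⟨c, hc⟩ := h (LinearMap.adjoint f.toLinearMap ∘ₗ f.toLinearMap) fun v w => by
    rw [LinearMap.comp_apply, LinearMap.adjoint_inner_right]
    rfl
  have hc' : ∀ v w, ⟪f v, f w⟫_ℂ = c * ⟪v, w⟫_ℂ := fun v w => by
    have h1 := congrArg (fun S : Module.End ℂ V => ⟪v, S w⟫_ℂ) hc
    simp only [LinearMap.comp_apply, LinearMap.adjoint_inner_right, LinearMap.smul_apply,
      Module.End.one_apply, inner_smul_right] at h1
    exact h1
  obtain ⟨v, hv⟩ := exists_ne (0 : V)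
  have hv' : (‖v‖ : ℂ) ≠ 0 := by exact_mod_cast norm_ne_zero_iff.2 hv
  have hfv : (‖f v‖ : ℂ) ≠ 0 := by
    exact_mod_cast norm_ne_zero_iff.2 (f.map_ne_zero_iff.2 hv)
  have hn := hc' v v
  rw [inner_self_eq_norm_sq_to_K, inner_self_eq_norm_sq_to_K] at hn
  simp only [Complex.coe_algebraMap] at hn
  -- The scalar `c` of `f^* f` is `‖f v‖² / ‖v‖²` for any nonzero `v`, and the scaling factor is its
  -- inverse square root.
  refine ⟨‖v‖ * (‖f v‖ : ℂ)⁻¹, mul_ne_zero hv' (inv_ne_zero hfv), fun x y => ?_⟩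
  rw [inner_smul_left, inner_smul_right, hc']
  simp only [map_mul, map_inv₀, Complex.conj_ofReal]
  field_simp
  rw [hn]
  ring

open ProjRep in
/-- The choices defining `β_{τ,α}` exist. -/
theorem nonempty_frame {G : Type w} [Group G] {α : NormalizedCocycle G} {A : Subgroup G} [A.Normal]
    [Finite A] {τ : ProjRep (α.res A)} (hτ : τ.IsIrreducible) : Nonempty (Frame τ) := by
  have _ : Fintype A := Fintype.ofFinite A
  have hnt := hτ.1
  have hσ : ∀ q : τ.quotStab, ∃ g : G, g ∈ τ.stab ∧ (g : G ⧸ A) = q ∧ (q = 1 → g = 1) := by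
    rintro ⟨_, g, hg, rfl⟩
    by_cases h : (QuotientGroup.mk' A g) = 1
    · exact ⟨1, τ.stab.one_mem, h.symm, fun _ => rfl⟩
    · exact ⟨g, hg, rfl, fun h1 => absurd (congrArg Subtype.val h1) h⟩
  choose σ hσ1 hσ2 hσ3 using hσ
  let form := τ.invariantForm
  have hform : ∀ a v w, form.inner (τ.ρ a v) (τ.ρ a w) = form.inner v w :=
    τ.invariantForm_unitary
  have hcirc : ∀ (z : Circle) (v w : τ.V),
      form.inner ((z : ℂ) • v) ((z : ℂ) • w) = form.inner v w := fun z v w => by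
    rw [form.smul_left, ← form.conj_inner_symm, form.smul_left, _root_.map_mul, form.conj_inner_symm,
      RingHomCompTriple.comp_apply, RingHom.id_apply, ← mul_assoc, ← Circle.coe_inv_eq_conj,
      ← Circle.coe_mul, inv_mul_cancel, Circle.coe_one, one_mul]
  have htr : ∀ (g : G) a v w, form.inner ((τ.translate g).ρ a v) ((τ.translate g).ρ a w) =
      form.inner v w := fun g a v w => (hcirc _ _ _).trans (hform _ _ _)
  have hM : ∀ q : τ.quotStab, ∃ M : τ.V ≃ₗ[ℂ] τ.V,
      (∀ v w, form.inner (M v) (M w) = form.inner v w) ∧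
      (∀ a v, (τ.translate (σ q)).ρ a v = M.symm (τ.ρ a (M v))) ∧
      (q = 1 → M = LinearEquiv.refl ℂ τ.V) := by
    intro q
    by_cases hq : q = 1
    · refine ⟨LinearEquiv.refl ℂ τ.V, fun _ _ => rfl, fun a v => ?_, fun _ => rfl⟩
      rw [hσ3 q hq]
      exact congrArg (fun T : Module.End ℂ τ.V => T v) (translate_one τ a)
    · obtain ⟨f, hf⟩ := hσ1 q
      let f' : τ.V ≃ₗ[ℂ] τ.V := f
      let _ : NormedAddCommGroup τ.V := form.toNormedAddCommGroup
      let _ : InnerProductSpace ℂ τ.V := InnerProductSpace.ofCore form.toCore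
      -- `S` plays the role of `f^* f`. Both `τ` and its translate preserve the form and `f`
      -- intertwines them, so `S` commutes with the irreducible translate and Schur's lemma makes it
      -- a scalar.
      have hS : ∀ S : Module.End ℂ τ.V,
          (∀ v w, form.inner v (S w) = form.inner (f' v) (f' w)) → ∃ c : ℂ, S = c • 1 := by
        intro S hS
        refine exists_eq_smul_one (hτ.translate (σ q)) (f := S) fun a w => ?_
        refine ext_inner_left ℂ (E := τ.V) fun u => ?_
        obtain ⟨v, rfl⟩ := (τ.translate (σ q)).ρ_surjective a u
        exact (hS _ _).trans (((congrArg₂ form.inner (hf a v) (hf a w)).trans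
          (hform _ _ _)).trans ((hS v w).symm.trans (htr _ a v (S w)).symm))
      obtain ⟨k, hk, hu⟩ := exists_unitary_scaling f' hS
      refine ⟨f'.trans (LinearEquiv.smulOfNeZero ℂ τ.V k hk), hu, fun a v => ?_,
        fun h => absurd h hq⟩
      refine (LinearEquiv.eq_symm_apply (f'.trans (LinearEquiv.smulOfNeZero ℂ τ.V k hk))).2 ?_
      exact (congrArg (k • ·) (hf a v)).trans ((τ.ρ a).map_smul k (f' v)).symm
  choose M hM1 hM2 hM3 using hM
  exact ⟨⟨form, hform, σ, hσ1, hσ2, hσ3 1 rfl, M, hM1, hM3 1 rfl, hM2⟩⟩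

/-! ### Functoriality of `Hom(V_τ, E)` -/

namespace TwistedFamily

section HomFunctor

variable {G : Type w} [Group G] {α : NormalizedCocycle G} {A : Subgroup G} [A.Normal]
  {τ : ProjRep (α.res A)} (hτ : τ.IsIrreducible) (F : Frame τ)
  {X : Type u} [MulAction G X] [MulAction (G ⧸ A) X]
  (hX : ∀ (g : G) (x : X), (g : G ⧸ A) • x = g • x)

theorem continuous_hom_rng {T : Type*} [TopologicalSpace T] {E : TwistedFamily α X}
    {k : T → (E.hom hτ F hX).Total}
    (h : ∀ v : τ.V, Continuous (fun t => (⟨(k t).proj, (k t).snd.1 v⟩ : E.Total))) :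
    Continuous k :=
  continuous_induced_rng.2 (continuous_pi h)

/-- The isomorphism of spaces of equivariant maps induced by an isomorphism of families. -/
def homFiberCongr {E E' : TwistedFamily α X} (i : Iso E E') (x : X) :
    homFiber (smul_eq_of_quotient hX) τ E x ≃ₗ[ℂ] homFiber (smul_eq_of_quotient hX) τ E' x where
  toFun f := ⟨(i.toEquiv x).toLinearMap ∘ₗ f.1, fun γ v =>
    (congrArg (i.toEquiv x) (f.2 γ v)).trans (i.map_act _ _ _)⟩
  invFun f := ⟨(i.toEquiv x).symm.toLinearMap ∘ₗ f.1, fun γ v =>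
    (congrArg (i.toEquiv x).symm (f.2 γ v)).trans (i.symm.map_act _ _ _)⟩
  map_add' _ _ := Subtype.ext (LinearMap.ext fun _ => (i.toEquiv x).map_add _ _)
  map_smul' _ _ := Subtype.ext (LinearMap.ext fun _ => (i.toEquiv x).map_smul _ _)
  left_inv _ := Subtype.ext (LinearMap.ext fun _ => (i.toEquiv x).symm_apply_apply _)
  right_inv _ := Subtype.ext (LinearMap.ext fun _ => (i.toEquiv x).apply_symm_apply _)

/-- `Hom(V_τ, ·)` on isomorphisms. -/
def Iso.hom {E E' : TwistedFamily α X} (i : Iso E E') :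
    Iso (E.hom hτ F hX) (E'.hom hτ F hX) where
  toEquiv x := homFiberCongr hX i x
  continuous_toFun := continuous_hom_rng hτ F hX fun v =>
    i.continuous_toFun.comp (continuous_hom_eval_apply hτ F hX E v)
  continuous_invFun := continuous_hom_rng hτ F hX fun v =>
    i.continuous_invFun.comp (continuous_hom_eval_apply hτ F hX E' v)
  map_act γ _ y _ _ := Subtype.ext (LinearMap.ext fun _ =>
    ((i.toEquiv y).map_smul _ _).trans (congrArg ((γ.phase : ℂ) • ·) (i.map_act _ _ _)))

/-- Equivariant maps into a direct sum. -/
def homFiberSum (E E' : TwistedFamily α X) (x : X) :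
    homFiber (smul_eq_of_quotient hX) τ (E.sum E') x ≃ₗ[ℂ]
      homFiber (smul_eq_of_quotient hX) τ E x × homFiber (smul_eq_of_quotient hX) τ E' x where
  toFun f := (⟨LinearMap.fst ℂ (E.fiber x) (E'.fiber x) ∘ₗ f.1,
      fun γ v => congrArg Prod.fst (f.2 γ v)⟩,
    ⟨LinearMap.snd ℂ (E.fiber x) (E'.fiber x) ∘ₗ f.1, fun γ v => congrArg Prod.snd (f.2 γ v)⟩)
  invFun f := ⟨LinearMap.prod f.1.1 f.2.1, fun γ v => Prod.ext (f.1.2 γ v) (f.2.2 γ v)⟩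
  map_add' _ _ := rfl
  map_smul' _ _ := rfl
  left_inv _ := rfl
  right_inv _ := rfl

/-- `Hom(V_τ, ·)` commutes with direct sums. -/
def Iso.homSum (E E' : TwistedFamily α X) :
    Iso ((E.sum E').hom hτ F hX) ((E.hom hτ F hX).sum (E'.hom hτ F hX)) where
  toEquiv x := homFiberSum hX E E' x
  continuous_toFun := continuous_sum_rng
    (continuous_hom_rng hτ F hX fun v =>
      (continuous_fst E E').comp (continuous_hom_eval_apply hτ F hX _ v))
    (continuous_hom_rng hτ F hX fun v =>
      (continuous_snd E E').comp (continuous_hom_eval_apply hτ F hX _ v))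
  continuous_invFun := continuous_hom_rng hτ F hX fun v => continuous_sum_rng
    ((continuous_hom_eval_apply hτ F hX E v).comp (continuous_fst _ _))
    ((continuous_hom_eval_apply hτ F hX E' v).comp (continuous_snd _ _))
  map_act _ _ _ _ _ := rfl

/-- A family with trivial equivariant maps from `V_τ` has `Hom(V_τ, E) = 0`. -/
def Iso.homZero [TopologicalSpace X] {E : TwistedFamily α X} (hE : E.IsBundle)
    (h0 : ∀ x, ∀ f ∈ homFiber (smul_eq_of_quotient hX) τ E x, f = 0)
    (hc : Continuous (fun x : X => (⟨x, 0⟩ : E.Total))) :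
    Iso (E.hom hτ F hX) (zero : TwistedFamily (F.beta hτ) X) where
  toEquiv x :=
    { toFun := fun _ => PUnit.unit
      map_add' := fun _ _ => rfl
      map_smul' := fun _ _ => rfl
      invFun := fun _ => 0
      left_inv := fun f => Subtype.ext (h0 x f.1 f.2).symm
      right_inv := fun _ => rfl }
  continuous_toFun := continuous_induced_rng.2
    (hE.continuous_proj.comp (continuous_hom_eval_apply hτ F hX E 0))
  continuous_invFun := continuous_hom_rng hτ F hX fun _ => hc.comp
    (continuous_induced_dom (f := fun e : (zero : TwistedFamily (F.beta hτ) X).Total => e.proj))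
  map_act _ _ _ _ _ := rfl

/-- `Hom(V_τ, ·)` commutes with pullbacks. -/
def Iso.homPullback {Y : Type v} [TopologicalSpace Y] [MulAction G Y] [MulAction (G ⧸ A) Y]
    (hY : ∀ (g : G) (y : Y), (g : G ⧸ A) • y = g • y) {f : Y → X}
    (hf : ∀ (g : G) y, f (g • y) = g • f y)
    (hf' : ∀ (q : τ.quotStab) y, f (q • y) = q • f y) (E : TwistedFamily α X) :
    Iso ((E.pullback f hf).hom hτ F hY) ((E.hom hτ F hX).pullback f hf') where
  toEquiv y := LinearEquiv.refl ℂ (homFiber (smul_eq_of_quotient hX) τ E (f y))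
  continuous_toFun := continuous_pullback_rng f hf' _
    ((continuous_pullback_proj f hf E).comp (continuous_hom_eval_apply hτ F hY _ 0))
    (continuous_hom_rng hτ F hX fun v =>
      (continuous_pullback_total f hf E).comp (continuous_hom_eval_apply hτ F hY _ v))
  continuous_invFun := continuous_hom_rng hτ F hY fun v => continuous_pullback_rng f hf E
    (continuous_pullback_proj f hf' _)
    ((continuous_hom_eval_apply hτ F hX E v).comp (continuous_pullback_total f hf' _))
  map_act _ _ _ _ _ := rfl

end HomFunctor

/-! ### Continuity of linear combinations -/

section LinearCombinations

variable {G : Type w} [Group G] {α : NormalizedCocycle G} {X : Type u} [MulAction G X]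
  [TopologicalSpace X] {E : TwistedFamily α X}

/-- A `TwistedFamily` carries only a topology on its total space; continuity of fibrewise addition
comes from the local trivializations, where the sum is one in `ℂⁿ`. -/
theorem IsBundle.continuous_sum_smul (hE : E.IsBundle) {T : Type*} [TopologicalSpace T]
    {ι : Type*} [Fintype ι] {p : T → X} (hp : Continuous p) (c : ι → ℂ)
    {a : ι → ∀ t, E.fiber (p t)} (ha : ∀ i, Continuous (fun t => (⟨p t, a i t⟩ : E.Total))) :
    Continuous (fun t => (⟨p t, ∑ i, c i • a i t⟩ : E.Total)) := by
  rw [continuous_iff_continuousAt]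
  intro t₀
  obtain ⟨U, hU, hxU, n, φ, hφ⟩ := hE.locally_trivial (p t₀)
  let V : Set T := p ⁻¹' U
  have hV : IsOpen V := hU.preimage hp
  refine ContinuousOn.continuousAt (s := V) ?_ (hV.mem_nhds hxU)
  rw [continuousOn_iff_continuous_domRestrict]
  let P : V → U := fun t => ⟨p t, t.2⟩
  have key : ∀ i, Continuous (fun t : V => (φ (P t)).symm (a i t)) := fun i => by
    have h2 : Continuous (fun t : V => (P t, (φ (P t)).symm (a i t))) := by
      rw [hφ.isInducing.continuous_iff]
      refine ((ha i).comp continuous_subtype_val).congr fun t => ?_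
      simp [P]
    exact _root_.continuous_snd.comp h2
  have hP : Continuous P := (hp.comp continuous_subtype_val).subtype_mk _
  have h3 : Continuous (fun t : V => ∑ i, c i • (φ (P t)).symm (a i t)) :=
    continuous_finsetSum _ fun i _ => (key i).const_smul (c i)
  refine (hφ.continuous.comp (hP.prodMk h3)).congr fun t => ?_
  simp [P, Set.domRestrict]

theorem IsBundle.continuous_zero_section (hE : E.IsBundle) {T : Type*} [TopologicalSpace T]
    {p : T → X} (hp : Continuous p) : Continuous (fun t => (⟨p t, 0⟩ : E.Total)) :=
  (hE.continuous_sum_smul (ι := Empty) hp (fun _ => 0) (a := fun i => i.elim)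
    (fun i => i.elim)).congr fun t => by simp

theorem IsBundle.continuous_const_smul (hE : E.IsBundle) {T : Type*} [TopologicalSpace T]
    {p : T → X} (hp : Continuous p) (c : ℂ) {a : ∀ t, E.fiber (p t)}
    (ha : Continuous (fun t => (⟨p t, a t⟩ : E.Total))) :
    Continuous (fun t => (⟨p t, c • a t⟩ : E.Total)) :=
  (hE.continuous_sum_smul (ι := Unit) hp (fun _ => c) (a := fun _ => a) fun _ => ha).congr
    fun t => by simp

theorem IsBundle.continuous_act_const (hE : E.IsBundle) {T : Type*} [TopologicalSpace T]
    (γ : CentralExt α) {p q : T → X} (h : ∀ t, γ.base • p t = q t) {a : ∀ t, E.fiber (p t)}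
    (ha : Continuous (fun t => (⟨p t, a t⟩ : E.Total))) :
    Continuous (fun t => (⟨q t, E.act γ (h t) (a t)⟩ : E.Total)) :=
  (hE.continuous_act.comp ((continuous_const (y := γ)).prodMk ha)).congr fun _ =>
    (E.mk_act _ _ _).symm

theorem IsBundle.finiteDimensional (hE : E.IsBundle) (x : X) :
    FiniteDimensional ℂ (E.fiber x) := by
  obtain ⟨U, -, hxU, n, φ, -⟩ := hE.locally_trivial x
  exact (φ ⟨x, hxU⟩).finiteDimensional

end LinearCombinations

end TwistedFamily

namespace CentralExt

variable {G : Type w} [Group G] {α : NormalizedCocycle G}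

/-- An element of the central extension lying over a subgroup. -/
def ofMem {A : Subgroup G} (x : CentralExt α) (h : x.base ∈ A) : CentralExt (α.res A) :=
  ⟨⟨x.base, h⟩, x.phase⟩

theorem incl_ofMem {A : Subgroup G} (x : CentralExt α) (h : x.base ∈ A) :
    incl α A (x.ofMem h) = x := rfl

theorem lift_smul_inv_smul {X : Type u} [MulAction G X] (g : G) (x : X) :
    (lift α g).base • g⁻¹ • x = x := smul_inv_smul g x

theorem lift_inv_smul {X : Type u} [MulAction G X] (g : G) (x : X) :
    (lift α g)⁻¹.base • x = g⁻¹ • x := rfl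

/-- Elements with the same base differ by a central element, which conjugates trivially. -/
theorem conj_congr {A : Subgroup G} [A.Normal] {γ δ : CentralExt α} (h : γ.base = δ.base)
    (x : CentralExt (α.res A)) : conj γ x = conj δ x := by
  have key : ∀ γ : CentralExt α, conj γ x = conj (lift α γ.base) x := fun γ => by
    conv_lhs => rw [γ.eq_ofCircle_mul_lift, conj_mul]
    congr 1
    apply incl_injective A
    rw [incl_conj, mul_assoc, ← ofCircle_comm, inv_mul_cancel_left]
  rw [key γ, key δ, h]

end CentralExt

/-! ### Reconstruction of a bundle from its isotypic parts -/

namespace ProjRep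

variable {G : Type w} [Group G] {α : NormalizedCocycle G} {A : Subgroup G} [A.Normal]

theorem translate_tilde_base (γ : CentralExt α) (τ : ProjRep (α.res A))
    (x : CentralExt (α.res A)) :
    (τ.translate γ.base).tilde x = τ.tilde (CentralExt.conj γ x) := by
  rw [translate_tilde]
  exact congrArg τ.tilde
    (CentralExt.conj_congr (γ := CentralExt.lift α γ.base) (δ := γ) rfl x)

end ProjRep

namespace TwistedFamily

section Isotypic

variable {G : Type w} [Group G] {α : NormalizedCocycle G} {A : Subgroup G}
  {X : Type u} [MulAction G X] [TopologicalSpace X]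
  (hA : ∀ (a : A) (x : X), (a : G) • x = x) {E : TwistedFamily α X} (hE : E.IsBundle)

/-- The fibre of a bundle as a projective representation of a subgroup acting trivially on the
base. -/
def fiberRep (x : X) : ProjRep (α.res A) where
  V := E.fiber x
  finiteDimensional := hE.finiteDimensional x
  ρ a := E.act (CentralExt.incl α A (CentralExt.lift _ a)) (hA a x)
  map_one := LinearMap.ext fun e => E.act_one _ e
  map_mul a b := LinearMap.ext fun e => by
    have h : CentralExt.incl α A (CentralExt.lift _ a) * CentralExt.incl α A (CentralExt.lift _ b) =
        CentralExt.ofCircle (α a b) * CentralExt.incl α A (CentralExt.lift _ (a * b)) :=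
      CentralExt.ext (by simp [CentralExt.lift, CentralExt.ofCircle])
        (by simp [CentralExt.lift, CentralExt.ofCircle, NormalizedCocycle.map_one_left])
    refine (E.act_act (hA b x) (hA a x) h.symm ?_ _).trans
      ((E.act_mul _ _ (hA (a * b) x) (one_smul G x) _ e).trans (E.act_circle _ _ _))
    change ((1 : G) * ((a * b : A) : G)) • x = x
    rw [one_mul]
    exact hA _ x

theorem fiberRep_tilde (x : X) (γ : CentralExt (α.res A)) (e : E.fiber x) :
    (fiberRep hA hE x).tilde γ e = E.act (CentralExt.incl α A γ) (hA γ.base x) e := by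
  have h : CentralExt.incl α A γ =
      CentralExt.ofCircle γ.phase * CentralExt.incl α A (CentralExt.lift _ γ.base) :=
    CentralExt.eq_ofCircle_mul_lift _
  exact (E.act_act (hA γ.base x) (one_smul G x) h (hA γ.base x) e).symm.trans
    (E.act_circle _ _ _) |>.symm

theorem mem_homFiber_iff_homs {τ : ProjRep (α.res A)} {x : X} {f : τ.V →ₗ[ℂ] E.fiber x} :
    f ∈ homFiber hA τ E x ↔ f ∈ ProjRep.homs τ (fiberRep hA hE x) := by
  constructor
  · intro hf a v
    rw [← ProjRep.tilde_lift]
    exact hf _ v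
  · intro hf γ v
    rw [← fiberRep_tilde hA hE]
    exact ProjRep.homs_tilde hf γ v

/-- From `a δ = δ (δ⁻¹ a δ)`: moving an equivariant map by `δ` conjugates the argument in `A`, which
is precisely what translating `τ` does. This is how `G` permutes the isotypic parts. -/
theorem act_comp_mem_homs [A.Normal] {τ : ProjRep (α.res A)} {x y : X} {f : τ.V →ₗ[ℂ] E.fiber x}
    (hf : f ∈ homFiber hA τ E x) (δ : CentralExt α) (h : δ.base • x = y) :
    (E.act δ h ∘ₗ f : (τ.translate δ.base).V →ₗ[ℂ] E.fiber y) ∈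
      ProjRep.homs (τ.translate δ.base) (fiberRep hA hE y) := fun a v => by
  rw [← ProjRep.tilde_lift, ← ProjRep.tilde_lift, ProjRep.translate_tilde_base]
  refine (congrArg (E.act δ h) (hf _ v)).trans ?_
  refine Eq.trans ?_ (fiberRep_tilde hA hE y _ _).symm
  have h2 : (δ * CentralExt.incl α A (CentralExt.conj δ (CentralExt.lift _ a))).base • x = y := by
    rw [CentralExt.mul_base, mul_smul, CentralExt.incl_base, hA, h]
  exact (E.act_act _ _ rfl h2 _).trans
    (E.act_act _ _ (by rw [CentralExt.incl_conj]; group) h2 _).symm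

variable [Fintype A]

/-- The isotypic coefficients `E_x → Hom_{Ã_α}(V_τ, E_x)`. -/
def homCoeff (τ : ProjRep (α.res A)) (x : X) (i : Fin (Module.finrank ℂ τ.V)) :
    E.fiber x →ₗ[ℂ] homFiber hA τ E x where
  toFun e := ⟨ProjRep.coeff τ (fiberRep hA hE x) i e,
    (mem_homFiber_iff_homs hA hE).2 (ProjRep.coeff_mem (τ := τ) (W := fiberRep hA hE x) i e)⟩
  map_add' e e' := by
    apply Subtype.ext
    exact LinearMap.map_add (ProjRep.coeff τ (fiberRep hA hE x) i) e e'
  map_smul' c e := by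
    apply Subtype.ext
    exact LinearMap.map_smul (ProjRep.coeff τ (fiberRep hA hE x) i) c e

/-- The coefficients depend neither on `x` nor on `e`, so the isotypic coefficients vary
continuously along the bundle. -/
theorem homCoeff_apply_apply (τ : ProjRep (α.res A)) (x : X) (i : Fin (Module.finrank ℂ τ.V))
    (e : E.fiber x) (v : τ.V) :
    (homCoeff hA hE τ x i e).1 v = ∑ a : A, ((Module.finrank ℂ τ.V : ℂ) *
      (Fintype.card A : ℂ)⁻¹ * τ.basis.coord i (τ.tilde (CentralExt.lift _ a)⁻¹ v)) •
      E.act (CentralExt.incl α A (CentralExt.lift _ a)) (hA a x) e :=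
  ProjRep.coeff_apply_apply (τ := τ) (W := fiberRep hA hE x) i e v

end Isotypic

/-! ### Maps on isotypic parts induced by isomorphisms of the bundles `Hom(V_τ, E)` -/

section IsotypicMap

variable {G : Type w} [Group G] {α : NormalizedCocycle G} {A : Subgroup G} [A.Normal]
  {τ : ProjRep (α.res A)} {hτ : τ.IsIrreducible} {F : Frame τ}
  {X : Type u} [MulAction G X] [MulAction (G ⧸ A) X]
  {hX : ∀ (g : G) (x : X), (g : G ⧸ A) • x = g • x} {E E' : TwistedFamily α X}

theorem hom_act_lift (E : TwistedFamily α X) {q : τ.quotStab} {x y : X} (h : q • x = y)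
    (f : homFiber (smul_eq_of_quotient hX) τ E x) (v : τ.V) :
    ((E.hom hτ F hX).act (CentralExt.lift _ q) h f : homFiber (smul_eq_of_quotient hX) τ E y).1 v =
      E.act (CentralExt.lift α (F.σ q)) (F.σ_smul hX h) (f.1 (F.endMinv q v)) := by
  refine Eq.trans ?_ (one_smul ℂ _)
  rfl

/-- The formula `(q · f)(v) = σ(q) · f(M_q⁻¹ v)` solved for the action on `E`. The component in `A`
is first absorbed into `v` by equivariance of `f`. -/
theorem act_eq_hom_act (E : TwistedFamily α X) {q : τ.quotStab} {x y : X} (hq : q • x = y)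
    {δ : CentralExt α} {a : CentralExt (α.res A)}
    (hδ : δ = CentralExt.lift α (F.σ q) * CentralExt.incl α A a) (h : δ.base • x = y)
    (f : homFiber (smul_eq_of_quotient hX) τ E x) (v : τ.V) :
    E.act δ h (f.1 v) = ((E.hom hτ F hX).act (CentralExt.lift _ q) hq f :
      homFiber (smul_eq_of_quotient hX) τ E y).1 (F.M q (τ.tilde a v)) := by
  rw [hom_act_lift]
  have h1 : F.endMinv q (F.M q (τ.tilde a v)) = τ.tilde a v := (F.M q).symm_apply_apply _
  rw [h1, f.2]
  exact (E.act_act _ _ hδ h _).symm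

theorem exists_lift_mul_incl (F : Frame τ) {δ : CentralExt α} (hδ : δ.base ∈ τ.stab) :
    ∃ q : τ.quotStab, (q : G ⧸ A) = δ.base ∧
      ∃ a, δ = CentralExt.lift α (F.σ q) * CentralExt.incl α A a := by
  let q : τ.quotStab := ⟨δ.base, δ.base, hδ, rfl⟩
  have hm : ((CentralExt.lift α (F.σ q))⁻¹ * δ).base ∈ A :=
    QuotientGroup.eq.1 (F.mk_σ q)
  exact ⟨q, rfl, CentralExt.ofMem _ hm, by rw [CentralExt.incl_ofMem, mul_inv_cancel_left]⟩

variable [TopologicalSpace X] [Fintype A] (hE : E.IsBundle)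

/-- The map `E_x → E'_x` on the `τ`-isotypic parts induced by an isomorphism
`Hom(V_τ, E) ≅ Hom(V_τ, E')`; it vanishes on the other isotypic parts. -/
def isotypicMap (φ : Iso (E.hom hτ F hX) (E'.hom hτ F hX)) (x : X) :
    E.fiber x →ₗ[ℂ] E'.fiber x :=
  ∑ i, LinearMap.applyₗ (τ.basis i) ∘ₗ (homFiber (smul_eq_of_quotient hX) τ E' x).subtype ∘ₗ
    (φ.toEquiv x).toLinearMap ∘ₗ homCoeff (smul_eq_of_quotient hX) hE τ x i

theorem isotypicMap_apply (φ : Iso (E.hom hτ F hX) (E'.hom hτ F hX)) (x : X) (e : E.fiber x) :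
    isotypicMap hE φ x e = ∑ i, (φ.toEquiv x (homCoeff (smul_eq_of_quotient hX) hE τ x i e) :
      homFiber (smul_eq_of_quotient hX) τ E' x).1 (τ.basis i) := by
  simp only [isotypicMap, LinearMap.sum_apply]
  rfl

/-- The coefficients of `f(v)` are `vᵢ f`, so applying `φ` and evaluating at the basis reassembles
`φ(f)(∑ vᵢ eᵢ)`. -/
theorem isotypicMap_of_mem (φ : Iso (E.hom hτ F hX) (E'.hom hτ F hX)) (x : X)
    (f : homFiber (smul_eq_of_quotient hX) τ E x) (v : τ.V) :
    isotypicMap hE φ x (f.1 v) =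
      (φ.toEquiv x f : homFiber (smul_eq_of_quotient hX) τ E' x).1 v := by
  have h : ∀ i, homCoeff (smul_eq_of_quotient hX) hE τ x i (f.1 v) = τ.basis.coord i v • f :=
    fun i => Subtype.ext
      (ProjRep.coeff_apply_of_mem (W := fiberRep _ hE x) hτ ((mem_homFiber_iff_homs _ hE).1 f.2) i v)
  rw [isotypicMap_apply]
  conv_rhs => rw [← τ.basis.sum_repr v, map_sum]
  refine Finset.sum_congr rfl fun i _ => ?_
  rw [h, _root_.map_smul]
  exact ((φ.toEquiv x).map_smul (τ.basis.coord i v) f ▸ rfl)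

/-- Writing `δ = σ(q) a`, both sides become `φ(q · f)` evaluated at `M_q τ(a) v`. The equivariance
of `φ` under `Q_[τ]` is exactly what makes the induced map commute with `G_[τ]`. -/
theorem isotypicMap_act (φ : Iso (E.hom hτ F hX) (E'.hom hτ F hX)) {x y : X}
    (f : homFiber (smul_eq_of_quotient hX) τ E x) (v : τ.V) {δ : CentralExt α}
    (hδ : δ.base ∈ τ.stab) (h : δ.base • x = y) :
    isotypicMap hE φ y (E.act δ h (f.1 v)) =
      E'.act δ h ((φ.toEquiv x f : homFiber (smul_eq_of_quotient hX) τ E' x).1 v) := by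
  obtain ⟨q, hq, a, ha⟩ := exists_lift_mul_incl F hδ
  have hqx : q • x = y := by
    rw [← h, ← hX, ← hq]
    rfl
  refine (congrArg _ (act_eq_hom_act (hτ := hτ) (hX := hX) E hqx ha h f v)).trans
    (((isotypicMap_of_mem hE φ y _ _).trans ?_).trans
    (act_eq_hom_act (hτ := hτ) (hX := hX) E' hqx ha h _ v).symm)
  exact congrArg (fun k : homFiber (smul_eq_of_quotient hX) τ E' y => k.1 _)
    (φ.map_act (CentralExt.lift _ q) hqx f)

/-- The vector `δ · f(v)` lies in the image of an intertwining operator from `δ · τ'`, and its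
`τ`-coefficients vanish by Schur's lemma. -/
theorem isotypicMap_eq_zero (φ : Iso (E.hom hτ F hX) (E'.hom hτ F hX)) {τ' : ProjRep (α.res A)}
    (hτ' : τ'.IsIrreducible) {x y : X}
    (f : homFiber (smul_eq_of_quotient hX) τ' E x) (v : τ'.V) {δ : CentralExt α}
    (hδ : ¬ τ.IsIso (τ'.translate δ.base)) (h : δ.base • x = y) :
    isotypicMap hE φ y (E.act δ h (f.1 v)) = 0 := by
  rw [isotypicMap_apply]
  refine Finset.sum_eq_zero fun i _ => ?_
  have h1 : homCoeff (smul_eq_of_quotient hX) hE τ y i (E.act δ h (f.1 v)) = 0 := Subtype.ext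
    (ProjRep.coeff_apply_eq_zero (W := fiberRep _ hE y) hτ (hτ'.translate δ.base) hδ
      (act_comp_mem_homs _ hE f.2 δ h) i v)
  rw [h1]
  have h2 : φ.toEquiv y 0 = 0 := map_zero _
  exact congrArg (fun k : homFiber (smul_eq_of_quotient hX) τ E' y => k.1 (τ.basis i)) h2

theorem continuous_isotypicMap (φ : Iso (E.hom hτ F hX) (E'.hom hτ F hX)) (hE' : E'.IsBundle) :
    Continuous (fun e : E.Total => (⟨e.proj, isotypicMap hE φ e.proj e.snd⟩ : E'.Total)) := by
  have h1 : ∀ i, Continuous (fun e : E.Total => (⟨e.proj,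
      homCoeff (smul_eq_of_quotient hX) hE τ e.proj i e.snd⟩ : (E.hom hτ F hX).Total)) :=
    fun i => continuous_hom_rng hτ F hX fun v =>
      (hE.continuous_sum_smul hE.continuous_proj
        (fun a : A => (Module.finrank ℂ τ.V : ℂ) * (Fintype.card A : ℂ)⁻¹ *
          τ.basis.coord i (τ.tilde (CentralExt.lift _ a)⁻¹ v)) fun a =>
        hE.continuous_act_const (CentralExt.incl α A (CentralExt.lift _ a))
          (fun e : E.Total => smul_eq_of_quotient hX a e.proj)
          continuous_id).congr fun e =>
        congrArg (Bundle.TotalSpace.mk e.proj) (homCoeff_apply_apply _ hE τ e.proj i e.snd v).symm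
  have h2 := fun i => (continuous_hom_eval_apply hτ F hX E' (τ.basis i)).comp
    (φ.continuous_toFun.comp (h1 i))
  refine (hE'.continuous_sum_smul hE.continuous_proj (fun _ => 1) h2).congr fun e => ?_
  refine congrArg (Bundle.TotalSpace.mk e.proj) ?_
  rw [isotypicMap_apply]
  simp only [one_smul]
  rfl

end IsotypicMap

/-! ### Assembling the isotypic maps into an isomorphism of bundles -/

section Reconstruction

variable {G : Type w} [Group G] {α : NormalizedCocycle G} {A : Subgroup G} [A.Normal]
  (d : ∀ o : MulAction.orbitRel.Quotient G (Irr (α.res A)), OrbitDatum A α o)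
  {X : Type u} [MulAction G X] [MulAction (G ⧸ A) X] [TopologicalSpace X]
  (hX : ∀ (g : G) (x : X), (g : G ⧸ A) • x = g • x) {E E' : TwistedFamily α X}

theorem _root_.TwistedK.OrbitDatum.eq_of_translate_isIso {o o' : MulAction.orbitRel.Quotient G
    (Irr (α.res A))} (g : G) (h : ((d o).τ.translate g).IsIso (d o').τ) :
    o = o' := by
  have h1 : g • Irr.mk (d o).τ (d o).irreducible = Irr.mk (d o').τ (d o').irreducible :=
    Quotient.sound h
  have e1 := MulAction.orbitRel.Quotient.mem_orbit.1 (d o).mem_orbit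
  have e2 := MulAction.orbitRel.Quotient.mem_orbit.1 (d o').mem_orbit
  rw [← e1, ← e2, ← h1]
  exact Quotient.sound ⟨g⁻¹, inv_smul_smul _ _⟩

theorem exists_translate_isIso (ρ : ProjRep (α.res A)) (hρ : ρ.IsIrreducible) :
    ∃ o, ∃ g : G, ((d o).τ.translate g).IsIso ρ := by
  let o : MulAction.orbitRel.Quotient G (Irr (α.res A)) := Quotient.mk _ (Irr.mk ρ hρ)
  have h := MulAction.orbitRel.Quotient.mem_orbit.1 (d o).mem_orbit
  obtain ⟨g, hg⟩ := Quotient.exact h.symm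
  exact ⟨o, g, Quotient.exact hg⟩

/-- The fibres of a bundle are spanned by the translates of the images of equivariant maps from the
chosen representations. -/
theorem eq_top_of_forall_orbit [Finite A] (hE : E.IsBundle) (x : X) (S : Submodule ℂ (E.fiber x))
    (h : ∀ o (y : X) (γ : CentralExt α) (hγ : γ.base • y = x),
      ∀ f ∈ homFiber (smul_eq_of_quotient hX) (d o).τ E y, ∀ v, E.act γ hγ (f v) ∈ S) :
    S = ⊤ := by
  have hA := smul_eq_of_quotient (A := A) hX
  refine ProjRep.eq_top_of_forall_homs (fiberRep hA hE x) S fun ρ hρ f hf u => ?_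
  obtain ⟨o, g, j, hj⟩ := exists_translate_isIso d ρ hρ
  have hjt : ∀ (γ : CentralExt (α.res A)) v,
      j (((d o).τ.translate g).tilde γ v) = ρ.tilde γ (j v) :=
    fun γ v => ProjRep.homs_tilde (f := j.toLinearMap) hj γ v
  let δ : CentralExt α := CentralExt.lift α g
  have hδ : δ⁻¹.base • x = g⁻¹ • x := rfl
  have hδ' : δ.base • g⁻¹ • x = x := smul_inv_smul g x
  -- The map `f` out of `ρ ≅ g · τ` is moved back by `g⁻¹`, which turns it into an equivariant map
  -- out of the chosen `τ` over `g⁻¹ x`. Acting by `g` then recovers the values of `f`.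
  let k : (d o).τ.V →ₗ[ℂ] E.fiber (g⁻¹ • x) := E.act δ⁻¹ hδ ∘ₗ f ∘ₗ j.toLinearMap
  have hk : k ∈ homFiber hA (d o).τ E (g⁻¹ • x) := by
    intro γ v
    have h1 : (d o).τ.tilde γ v =
        ((d o).τ.translate g).tilde (CentralExt.conj δ⁻¹ γ) v := by
      rw [ProjRep.translate_tilde, ← CentralExt.conj_mul, inv_mul_cancel, CentralExt.conj_one]
      rfl
    have h2 : f (j ((d o).τ.tilde γ v)) =
        E.act (CentralExt.incl α A (CentralExt.conj δ⁻¹ γ)) (hA _ x) (f (j v)) :=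
      (congrArg f ((congrArg j h1).trans (hjt _ v))).trans
        ((mem_homFiber_iff_homs hA hE).2 hf _ _)
    have h3 : (CentralExt.incl α A γ * δ⁻¹).base • x = g⁻¹ • x := by
      rw [CentralExt.mul_base, mul_smul, hδ, CentralExt.incl_base, hA]
    refine (congrArg (E.act δ⁻¹ hδ) h2).trans ?_
    exact (E.act_act _ _ (by rw [CentralExt.incl_conj]; group) h3 _).trans
      (E.act_act _ _ rfl h3 _).symm
  have hu : E.act δ hδ' (k (j.symm u)) = f u := by
    have h1 : k (j.symm u) = E.act δ⁻¹ hδ (f u) :=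
      congrArg (fun t => E.act δ⁻¹ hδ (f t)) (j.apply_symm_apply u)
    rw [h1]
    exact (E.act_act hδ hδ' (mul_inv_cancel δ).symm (one_smul G x) _).trans (E.act_one _ _)
  exact hu ▸ h o _ δ hδ' k hk _

variable [Fintype A] [Fintype G] [Fintype (MulAction.orbitRel.Quotient G (Irr (α.res A)))]
  (hE : E.IsBundle)
  (φ : ∀ o, Iso (E.hom (d o).irreducible (d o).frame hX) (E'.hom (d o).irreducible (d o).frame hX))

/-- The map `E_x → E'_x` induced by isomorphisms `Hom(V_τ, E) ≅ Hom(V_τ, E')`. -/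
def globalMap (x : X) : E.fiber x →ₗ[ℂ] E'.fiber x :=
  ∑ o, ∑ g : G, (Nat.card (d o).τ.stab : ℂ)⁻¹ •
    (E'.act (CentralExt.lift α g) (CentralExt.lift_smul_inv_smul g x) ∘ₗ
      isotypicMap hE (φ o) (g⁻¹ • x) ∘ₗ
      E.act (CentralExt.lift α g)⁻¹ (CentralExt.lift_inv_smul g x))

theorem globalMap_apply (x : X) (e : E.fiber x) :
    globalMap d hX hE φ x e = ∑ o, ∑ g : G, (Nat.card (d o).τ.stab : ℂ)⁻¹ •
      E'.act (CentralExt.lift α g) (CentralExt.lift_smul_inv_smul g x) (isotypicMap hE (φ o) (g⁻¹ • x)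
        (E.act (CentralExt.lift α g)⁻¹ (CentralExt.lift_inv_smul g _) e)) := by
  simp only [globalMap, LinearMap.sum_apply]
  rfl

/-- Only the orbit of `τ` contributes, and within it only those `g` with `g⁻¹ γ` in `G_[τ]`; by
`isotypicMap_act` each of these gives the same vector. The values on such vectors determine the map,
since they span the fibres. -/
theorem globalMap_act {o : MulAction.orbitRel.Quotient G (Irr (α.res A))} {x y : X}
    (f : homFiber (smul_eq_of_quotient hX) (d o).τ E x) (v : (d o).τ.V) {γ : CentralExt α}
    (h : γ.base • x = y) :
    globalMap d hX hE φ y (E.act γ h (f.1 v)) = E'.act γ h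
      (((φ o).toEquiv x f : homFiber (smul_eq_of_quotient hX) (d o).τ E' x).1 v) := by
  classical
  have hh : ∀ g : G, ((CentralExt.lift α g)⁻¹ * γ).base • x = g⁻¹ • y := fun g => by
    rw [← h]
    exact mul_smul _ _ _
  have h1 : ∀ g : G, E.act (CentralExt.lift α g)⁻¹ (CentralExt.lift_inv_smul g y) (E.act γ h (f.1 v)) =
      E.act ((CentralExt.lift α g)⁻¹ * γ) (hh g) (f.1 v) := fun g =>
    E.act_act _ (CentralExt.lift_inv_smul g y) rfl _ _
  have h2 : ∀ g : G, ∀ w, E'.act (CentralExt.lift α g) (CentralExt.lift_smul_inv_smul g y)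
      (E'.act ((CentralExt.lift α g)⁻¹ * γ) (hh g) w) = E'.act γ h w := fun g w =>
    E'.act_act _ _ (mul_inv_cancel_left _ _).symm _ _
  rw [globalMap_apply, Finset.sum_eq_single o]
  · have h3 : ∀ g : G, (Nat.card (d o).τ.stab : ℂ)⁻¹ •
        E'.act (CentralExt.lift α g) (CentralExt.lift_smul_inv_smul g y) (isotypicMap hE (φ o) (g⁻¹ • y)
          (E.act (CentralExt.lift α g)⁻¹ (CentralExt.lift_inv_smul g _) (E.act γ h (f.1 v)))) =
        if g⁻¹ * γ.base ∈ (d o).τ.stab then (Nat.card (d o).τ.stab : ℂ)⁻¹ • E'.act γ h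
          (((φ o).toEquiv x f : homFiber (smul_eq_of_quotient hX) (d o).τ E' x).1 v) else 0 := by
      intro g
      rw [h1]
      split_ifs with hg
      · rw [isotypicMap_act hE (φ o) f v (δ := (CentralExt.lift α g)⁻¹ * γ) hg, h2]
      · rw [isotypicMap_eq_zero hE (φ o) (d o).irreducible f v
          (δ := (CentralExt.lift α g)⁻¹ * γ) (fun hi => hg hi.symm), map_zero,
          smul_zero]
    simp only [h3]
    rw [← Finset.sum_filter, Finset.sum_const]
    -- The contributing `g` form the coset of `γ` modulo `G_[τ]`, via `g ↦ g⁻¹ γ`. Hence there are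
    -- as many as elements of `G_[τ]`, the normalization used in `globalMap`.
    have hc : (Finset.univ.filter fun g : G => g⁻¹ * γ.base ∈ (d o).τ.stab).card =
        Nat.card (d o).τ.stab := by
      rw [Nat.card_eq_fintype_card, Fintype.card_subtype]
      refine Finset.card_bij (fun g _ => g⁻¹ * γ.base) (fun g hg => by simpa using hg)
        (fun g _ g' _ he => by simpa using he) fun k hk => ⟨γ.base * k⁻¹, ?_, ?_⟩
      · simpa using hk
      · group
    rw [hc, ← Nat.cast_smul_eq_nsmul ℂ, smul_smul, mul_inv_cancel₀, one_smul]
    exact_mod_cast Nat.card_pos.ne'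
  · intro o' _ ho
    refine Finset.sum_eq_zero fun g _ => ?_
    rw [h1, isotypicMap_eq_zero hE (φ o') (d o).irreducible f v
      (δ := (CentralExt.lift α g)⁻¹ * γ)
      (fun hi => ho (OrbitDatum.eq_of_translate_isIso d _ hi.symm).symm), map_zero, smul_zero]
  · exact fun ho => absurd (Finset.mem_univ _) ho

theorem continuous_globalMap (hE' : E'.IsBundle) [ContinuousConstSMul G X] :
    Continuous (fun e : E.Total => (⟨e.proj, globalMap d hX hE φ e.proj e.snd⟩ : E'.Total)) := by
  have h1 : ∀ i : MulAction.orbitRel.Quotient G (Irr (α.res A)) × G,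
      Continuous (fun e : E.Total => (⟨e.proj, E'.act (CentralExt.lift α i.2)
        (CentralExt.lift_smul_inv_smul i.2 e.proj) (isotypicMap hE (φ i.1) (i.2⁻¹ • e.proj)
          (E.act (CentralExt.lift α i.2)⁻¹ (CentralExt.lift_inv_smul i.2 _) e.snd))⟩ : E'.Total)) := fun i =>
    hE'.continuous_act_const _ (fun e : E.Total => CentralExt.lift_smul_inv_smul i.2 e.proj)
      ((continuous_isotypicMap hE (φ i.1) hE').comp
        (hE.continuous_act_const (CentralExt.lift α i.2)⁻¹
          (fun e : E.Total => CentralExt.lift_inv_smul i.2 e.proj) continuous_id))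
  refine (hE'.continuous_sum_smul hE.continuous_proj
    (fun i : MulAction.orbitRel.Quotient G (Irr (α.res A)) × G =>
      (Nat.card (d i.1).τ.stab : ℂ)⁻¹) h1).congr fun e => ?_
  refine congrArg (Bundle.TotalSpace.mk e.proj) ?_
  rw [globalMap_apply, Fintype.sum_prod_type]

/-- On the spanning vectors `γ · f(v)` the two maps replace `f` by `φ(f)` and then by `φ⁻¹(φ(f)) =
f`. -/
theorem globalMap_globalMap (hE' : E'.IsBundle) (x : X) (e : E.fiber x) :
    globalMap d hX hE' (fun o => (φ o).symm) x (globalMap d hX hE φ x e) = e := by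
  have h := eq_top_of_forall_orbit d hX hE x
    (LinearMap.eqLocus (globalMap d hX hE' (fun o => (φ o).symm) x ∘ₗ globalMap d hX hE φ x)
      LinearMap.id) fun o y γ hγ f hf v => by
    have h1 := globalMap_act d hX hE φ ⟨f, hf⟩ v hγ
    have h2 := globalMap_act d hX hE' (fun o => (φ o).symm) ((φ o).toEquiv y ⟨f, hf⟩) v hγ
    rw [LinearMap.mem_eqLocus, LinearMap.comp_apply]
    refine (congrArg _ h1).trans (h2.trans ?_)
    exact congrArg (fun k : homFiber (smul_eq_of_quotient hX) (d o).τ E y => E.act γ hγ (k.1 v))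
      (((φ o).toEquiv y).symm_apply_apply ⟨f, hf⟩)
  have h2 : e ∈ (⊤ : Submodule ℂ (E.fiber x)) := trivial
  rw [← h] at h2
  exact h2

theorem globalMap_map_act {x y : X} (γ : CentralExt α) (hγ : γ.base • x = y) (e : E.fiber x) :
    globalMap d hX hE φ y (E.act γ hγ e) = E'.act γ hγ (globalMap d hX hE φ x e) := by
  have h := eq_top_of_forall_orbit d hX hE x
    (LinearMap.eqLocus (globalMap d hX hE φ y ∘ₗ E.act γ hγ)
      (E'.act γ hγ ∘ₗ globalMap d hX hE φ x)) fun o z δ hδ f hf v => by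
    have hz : (γ * δ).base • z = y := by rw [CentralExt.mul_base, mul_smul, hδ, hγ]
    rw [LinearMap.mem_eqLocus, LinearMap.comp_apply, LinearMap.comp_apply,
      globalMap_act d hX hE φ ⟨f, hf⟩ v hδ, E.act_act hδ hγ rfl hz,
      globalMap_act d hX hE φ ⟨f, hf⟩ v hz, E'.act_act hδ hγ rfl hz]
  have h2 : e ∈ (⊤ : Submodule ℂ (E.fiber x)) := trivial
  rw [← h] at h2
  exact h2

/-- Two bundles for which all the `Hom(V_τ, ·)` are isomorphic are isomorphic. -/
def Iso.ofHom (hE' : E'.IsBundle) [ContinuousConstSMul G X] : Iso E E' where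
  toEquiv x := LinearEquiv.ofLinearMap (globalMap d hX hE φ x)
    (globalMap d hX hE' (fun o => (φ o).symm) x)
    (LinearMap.ext fun e => globalMap_globalMap d hX hE' (fun o => (φ o).symm) hE x e)
    (LinearMap.ext fun e => globalMap_globalMap d hX hE φ hE' x e)
  continuous_toFun := continuous_globalMap d hX hE φ hE'
  continuous_invFun := continuous_globalMap d hX hE' (fun o => (φ o).symm) hE
  map_act γ _ _ h e := globalMap_map_act d hX hE φ γ h e

end Reconstruction

end TwistedFamily

/-! ### The tensor product of `V_τ` with a bundle -/

/-- For `a` in `A` the operator `τ(a)` is itself an isomorphism from `a · τ` to `τ`. -/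
theorem ProjRep.le_stab {G : Type w} [Group G] {α : NormalizedCocycle G} {A : Subgroup G}
    [A.Normal] (τ : ProjRep (α.res A)) : A ≤ τ.stab := fun a ha => by
  let b : A := ⟨a, ha⟩
  refine ⟨LinearEquiv.ofBijective (τ.ρ b) ⟨τ.ρ_injective b, τ.ρ_surjective b⟩, fun c v => ?_⟩
  have h : (τ.translate a).ρ c = τ.tilde (CentralExt.conj (CentralExt.lift α a)
      (CentralExt.lift _ c)) := by
    rw [← translate_tilde, tilde_lift]
  have h1 : CentralExt.conj (CentralExt.lift α a) (CentralExt.lift (α.res A) c) =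
      (CentralExt.lift _ b)⁻¹ * CentralExt.lift _ c * CentralExt.lift _ b :=
    CentralExt.conj_incl (CentralExt.lift _ b) _
  refine (congrArg (fun T : Module.End ℂ τ.V => τ.ρ b (T v)) h).trans ?_
  have h2 : τ.ρ b * τ.tilde (CentralExt.conj (CentralExt.lift α a) (CentralExt.lift _ c)) =
      τ.ρ c * τ.ρ b := by
    rw [h1, ← τ.tilde_lift b, ← τ.tilde_lift c, ← _root_.map_mul, ← _root_.map_mul]
    congr 1
    group
  exact congrArg (fun T : Module.End ℂ τ.V => T v) h2

/-! ### Extension of `τ` to a projective action of `G_[τ]` -/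

namespace Frame

variable {G : Type w} [Group G] {α : NormalizedCocycle G} {A : Subgroup G} [A.Normal]
  {τ : ProjRep (α.res A)} (F : Frame τ)

/-- The projection `G_[τ] → Q_[τ]`. -/
def stabQuot (g : τ.stab) : τ.quotStab := ⟨(g : G), g, g.2, rfl⟩

theorem stabQuot_smul {X : Type u} [MulAction G X] [MulAction (G ⧸ A) X]
    (hX : ∀ (g : G) (x : X), (g : G ⧸ A) • x = g • x) {g : τ.stab} {x y : X} (h : g • x = y) :
    stabQuot g • x = y := (hX g x).trans h

/-- The component in `A` of an element of `G_[τ]`, with respect to the section `σ`. -/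
def stabPart (γ : CentralExt (α.res τ.stab)) : CentralExt (α.res A) :=
  CentralExt.ofMem ((CentralExt.lift α (F.σ (stabQuot γ.base)))⁻¹ * CentralExt.incl α τ.stab γ)
    (QuotientGroup.eq.1 (F.mk_σ (stabQuot γ.base)))

theorem incl_stabPart (γ : CentralExt (α.res τ.stab)) : CentralExt.incl α A (F.stabPart γ) =
    (CentralExt.lift α (F.σ (stabQuot γ.base)))⁻¹ * CentralExt.incl α τ.stab γ := rfl

/-- The projective action of `G_[τ]` on `V_τ`, given by `σ(q) a ↦ M_q τ(a)`. -/
def stabEnd (γ : CentralExt (α.res τ.stab)) : Module.End ℂ τ.V :=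
  F.endM (stabQuot γ.base) * τ.tilde (F.stabPart γ)

/-- The factorization `γ = σ(q) a` is unique, so any factorization at hand may be used to compute
the operator. -/
theorem stabEnd_eq {γ : CentralExt (α.res τ.stab)} {q : τ.quotStab} (hq : stabQuot γ.base = q)
    {a : CentralExt (α.res A)}
    (h : CentralExt.incl α τ.stab γ = CentralExt.lift α (F.σ q) * CentralExt.incl α A a) :
    F.stabEnd γ = F.endM q * τ.tilde a := by
  subst hq
  have : F.stabPart γ = a := CentralExt.incl_injective A (by
    rw [incl_stabPart, h, inv_mul_cancel_left])
  rw [stabEnd, this]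

theorem endM_one : F.endM 1 = 1 := by
  rw [endM, F.M_one]
  rfl

theorem lift_σ_one : CentralExt.lift α (F.σ 1) = 1 := by
  rw [F.σ_one]
  rfl

/-- The normalizations `σ(1) = 1` and `M_1 = 1` make the action of `G_[τ]` a genuine extension of
`τ`. -/
theorem stabEnd_of_incl {γ : CentralExt (α.res τ.stab)} {a : CentralExt (α.res A)}
    (h : CentralExt.incl α τ.stab γ = CentralExt.incl α A a) : F.stabEnd γ = τ.tilde a := by
  have hq : stabQuot γ.base = 1 := by
    refine Subtype.ext ((QuotientGroup.eq_one_iff (γ.base : G)).2 ?_)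
    have := congrArg CentralExt.base h
    rw [CentralExt.incl_base, CentralExt.incl_base] at this
    exact this ▸ a.base.2
  rw [F.stabEnd_eq hq (a := a) (by rw [lift_σ_one, one_mul, h]), endM_one, one_mul]

theorem stabEnd_ofCircle_mul (z : Circle) (γ : CentralExt (α.res τ.stab)) :
    F.stabEnd (CentralExt.ofCircle z * γ) = (z : ℂ) • F.stabEnd γ := by
  have hq : stabQuot (CentralExt.ofCircle z * γ).base = stabQuot γ.base := by
    rw [CentralExt.mul_base]
    exact congrArg stabQuot (one_mul γ.base)
  rw [F.stabEnd_eq hq (a := CentralExt.ofCircle z * F.stabPart γ), _root_.map_mul,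
    ProjRep.tilde_ofCircle, smul_mul_assoc, one_mul, mul_smul_comm]
  · rfl
  · have h1 : CentralExt.incl α A (CentralExt.ofCircle z) = CentralExt.ofCircle z := rfl
    have h2 : CentralExt.incl α τ.stab (CentralExt.ofCircle z) = CentralExt.ofCircle z := rfl
    rw [_root_.map_mul, _root_.map_mul, h1, h2, incl_stabPart, ← mul_assoc (CentralExt.lift α _),
      ← CentralExt.ofCircle_comm, mul_assoc, mul_inv_cancel_left]

/-- The product of `σ(q₁) a` and `σ(q₂) b` is `σ(q₁ q₂)` times `χ(q₁, q₂)`, a conjugate of `a`, and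
`b`. The definition of `β` rearranges to `M_{q₁q₂} τ̃(χ) = β M_{q₁} M_{q₂}`. The defect of this
action is therefore inverse to that of a `β`-twisted bundle, and the two cancel in a tensor product.
-/
theorem stabEnd_mul (hτ : τ.IsIrreducible) (γ δ : CentralExt (α.res τ.stab)) :
    F.stabEnd (γ * δ) = (F.beta hτ (stabQuot γ.base) (stabQuot δ.base) : ℂ) •
      (F.stabEnd γ * F.stabEnd δ) := by
  set q₁ := stabQuot γ.base with hq₁
  set q₂ := stabQuot δ.base with hq₂
  have hpart : CentralExt.incl α τ.stab (γ * δ) = CentralExt.lift α (F.σ (q₁ * q₂)) *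
      CentralExt.incl α A (F.chi q₁ q₂ * CentralExt.conj (CentralExt.lift α (F.σ q₂))
        (F.stabPart γ) * F.stabPart δ) := by
    simp only [_root_.map_mul, incl_chi, CentralExt.incl_conj, incl_stabPart, ← hq₁, ← hq₂]
    group
  rw [F.stabEnd_eq (q := q₁ * q₂) rfl hpart]
  have h1 : F.endM (q₁ * q₂) * τ.tilde (F.chi q₁ q₂) =
      (F.beta hτ q₁ q₂ : ℂ) • (F.endM q₁ * F.endM q₂) := by
    have h := congrArg (fun T => F.endM (q₁ * q₂) * T * F.endM q₁ * F.endM q₂)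
      (F.beta_endMinv hτ q₁ q₂)
    simp only [mul_assoc, mul_smul_comm, smul_mul_assoc] at h
    rw [← mul_assoc (F.endMinv q₁) (F.endM q₁), endMinv_mul_endM, one_mul, endMinv_mul_endM,
      mul_one, ← mul_assoc (F.endM (q₁ * q₂)) (F.endMinv (q₁ * q₂)), endM_mul_endMinv,
      one_mul] at h
    exact h
  rw [_root_.map_mul, _root_.map_mul, tilde_conj, ← mul_assoc, ← mul_assoc, h1]
  simp only [stabEnd, ← hq₁, ← hq₂, smul_mul_assoc, mul_assoc]
  rw [← mul_assoc (F.endM q₂) (F.endMinv q₂), endM_mul_endMinv, one_mul]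

end Frame

namespace TwistedFamily

theorem act_eq_phase_smul {G : Type w} [Group G] {α : NormalizedCocycle G} {X : Type u}
    [MulAction G X] (E : TwistedFamily α X) (γ : CentralExt α) {x y : X} (h : γ.base • x = y)
    (h' : (CentralExt.lift α γ.base).base • x = y) (e : E.fiber x) :
    E.act γ h e = (γ.phase : ℂ) • E.act (CentralExt.lift α γ.base) h' e :=
  (E.act_act h' (one_smul G y) γ.eq_ofCircle_mul_lift h e).symm.trans (E.act_circle _ _ _)

/-- A local trivialization with an arbitrary finite-dimensional model gives one with model `ℂⁿ`. -/
theorem exists_trivialization {G : Type w} [Group G] {α : NormalizedCocycle G} {X : Type u}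
    [MulAction G X] [TopologicalSpace X] {E : TwistedFamily α X} {U : Set X} {S : Type*}
    [NormedAddCommGroup S] [NormedSpace ℂ S] [FiniteDimensional ℂ S]
    (ψ : ∀ x : U, S ≃ₗ[ℂ] E.fiber x)
    (h : Topology.IsEmbedding (fun p : U × S => (⟨p.1, ψ p.1 p.2⟩ : E.Total))) :
    ∃ (n : ℕ) (φ : ∀ x : U, (Fin n → ℂ) ≃ₗ[ℂ] E.fiber x),
      Topology.IsEmbedding (fun p : U × (Fin n → ℂ) => (⟨p.1, φ p.1 p.2⟩ : E.Total)) := by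
  let κ : (Fin (Module.finrank ℂ S) → ℂ) ≃L[ℂ] S :=
    (Module.finBasis ℂ S).equivFun.symm.toContinuousLinearEquiv
  exact ⟨_, fun x => κ.toLinearEquiv.trans (ψ x),
    h.comp (Topology.IsEmbedding.id.prodMap κ.toHomeomorph.isEmbedding)⟩

section Tensor

variable {G : Type w} [Group G] {α : NormalizedCocycle G} {A : Subgroup G} [A.Normal]
  {τ : ProjRep (α.res A)} (hτ : τ.IsIrreducible) (F : Frame τ)
  {X : Type u} [MulAction G X] [MulAction (G ⧸ A) X]
  (hX : ∀ (g : G) (x : X), (g : G ⧸ A) • x = g • x)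

/-- The family `V_τ ⊗ E = Hom(V_τ^*, E)` over the central extension of `G_[τ]`. -/
def tensor (E : TwistedFamily (F.beta hτ) X) : TwistedFamily (α.res τ.stab) X where
  fiber x := Module.Dual ℂ τ.V →ₗ[ℂ] E.fiber x
  top := TopologicalSpace.induced
    (fun e => (fun ξ => ⟨e.proj, e.snd ξ⟩ : Module.Dual ℂ τ.V → E.Total)) inferInstance
  act γ _ _ h :=
    { toFun := fun k => E.act (CentralExt.lift _ (Frame.stabQuot γ.base))
        (Frame.stabQuot_smul hX h) ∘ₗ k ∘ₗ LinearMap.dualMap (F.stabEnd γ)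
      map_add' := fun k k' => by simp [LinearMap.add_comp, LinearMap.comp_add]
      map_smul' := fun c k => by simp [LinearMap.smul_comp, LinearMap.comp_smul] }
  act_one {x} h k := LinearMap.ext fun ξ => by
    have h1 : F.stabEnd 1 = 1 := by
      rw [F.stabEnd_of_incl (a := 1) (by rw [map_one, map_one]), map_one]
    have h2 : (F.stabEnd 1).dualMap ξ = ξ := by rw [h1]; rfl
    change E.act (CentralExt.lift _ (Frame.stabQuot 1)) _ (k ((F.stabEnd 1).dualMap ξ)) = k ξ
    rw [h2]
    exact E.act_one (one_smul _ x) _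
  act_mul γ δ x y z hδ hγ h k := LinearMap.ext fun ξ => by
    -- Transposing reverses the order of the two operators and keeps the factor `β(q₁, q₂)`. The
    -- same factor is the phase of the product of the two lifts acting on `E`, so both sides agree.
    have h1 : (F.stabEnd (γ * δ)).dualMap ξ =
        (F.beta hτ (Frame.stabQuot γ.base) (Frame.stabQuot δ.base) : ℂ) •
          (F.stabEnd δ).dualMap ((F.stabEnd γ).dualMap ξ) := by
      rw [F.stabEnd_mul hτ]
      ext v
      simp
    change E.act (CentralExt.lift _ (Frame.stabQuot (γ.base * δ.base))) _
        (k ((F.stabEnd (γ * δ)).dualMap ξ)) =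
      E.act (CentralExt.lift _ (Frame.stabQuot γ.base)) (Frame.stabQuot_smul hX hγ)
        (E.act (CentralExt.lift _ (Frame.stabQuot δ.base)) (Frame.stabQuot_smul hX hδ)
          (k ((F.stabEnd δ).dualMap ((F.stabEnd γ).dualMap ξ))))
    have h2 : (CentralExt.lift (F.beta hτ) (Frame.stabQuot γ.base) *
        CentralExt.lift (F.beta hτ) (Frame.stabQuot δ.base)).base • x = z :=
      Frame.stabQuot_smul hX h
    have h3 : (CentralExt.lift (F.beta hτ) (Frame.stabQuot γ.base) *
        CentralExt.lift (F.beta hτ) (Frame.stabQuot δ.base)).phase =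
        F.beta hτ (Frame.stabQuot γ.base) (Frame.stabQuot δ.base) := by
      simp [CentralExt.lift]
    refine Eq.trans ?_ (E.act_act (Frame.stabQuot_smul hX hδ) (Frame.stabQuot_smul hX hγ) rfl h2
      _).symm
    rw [h1, map_smul, map_smul, E.act_eq_phase_smul _ h2 h2, h3]
    rfl
  act_circle c x h k := LinearMap.ext fun ξ => by
    have h1 : F.stabEnd (CentralExt.ofCircle c) = (c : ℂ) • 1 := by
      rw [F.stabEnd_of_incl (a := CentralExt.ofCircle c) rfl, ProjRep.tilde_ofCircle]
    have h2 : (F.stabEnd (CentralExt.ofCircle c)).dualMap ξ = (c : ℂ) • ξ := by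
      rw [h1]
      ext v
      simp
    change E.act (CentralExt.lift _ (Frame.stabQuot 1)) _
      (k ((F.stabEnd (CentralExt.ofCircle c)).dualMap ξ)) = (c : ℂ) • k ξ
    rw [h2, map_smul, map_smul]
    exact congrArg _ (E.act_one (one_smul _ x) _)

variable {hτ F hX} {E : TwistedFamily (F.beta hτ) X}

/-- Evaluation of elements of `V_τ ⊗ E_x` at linear forms. -/
def tensorEval (hτ : τ.IsIrreducible) (F : Frame τ)
    (hX : ∀ (g : G) (x : X), (g : G ⧸ A) • x = g • x) (E : TwistedFamily (F.beta hτ) X) (x : X)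
    (ξ : Module.Dual ℂ τ.V) : (E.tensor hτ F hX).fiber x →ₗ[ℂ] E.fiber x :=
  LinearMap.applyₗ ξ

theorem tensor_ext {x : X} {k k' : (E.tensor hτ F hX).fiber x}
    (h : ∀ ξ, tensorEval hτ F hX E x ξ k = tensorEval hτ F hX E x ξ k') : k = k' :=
  LinearMap.ext (f := (k : Module.Dual ℂ τ.V →ₗ[ℂ] E.fiber x)) h

theorem tensorEval_smul {x : X} (c : ℂ) (ξ : Module.Dual ℂ τ.V)
    (k : (E.tensor hτ F hX).fiber x) :
    tensorEval hτ F hX E x (c • ξ) k = c • tensorEval hτ F hX E x ξ k :=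
  LinearMap.map_smul (k : Module.Dual ℂ τ.V →ₗ[ℂ] E.fiber x) c ξ

theorem tensor_act_apply {γ : CentralExt (α.res τ.stab)} {x y : X} (h : γ.base • x = y)
    (k : (E.tensor hτ F hX).fiber x) (ξ : Module.Dual ℂ τ.V) :
    tensorEval hτ F hX E y ξ ((E.tensor hτ F hX).act γ h k) =
      E.act (CentralExt.lift _ (Frame.stabQuot γ.base)) (Frame.stabQuot_smul hX h)
        (tensorEval hτ F hX E x ((F.stabEnd γ).dualMap ξ) k) := rfl

/-- An element of `A` has trivial image in `Q_[τ]`, so it acts on the `V_τ` factor alone. -/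
theorem tensor_act_of_incl {γ : CentralExt (α.res τ.stab)} {a : CentralExt (α.res A)}
    (ha : CentralExt.incl α τ.stab γ = CentralExt.incl α A a) {x : X} (h : γ.base • x = x)
    (k : (E.tensor hτ F hX).fiber x) (ξ : Module.Dual ℂ τ.V) :
    tensorEval hτ F hX E x ξ ((E.tensor hτ F hX).act γ h k) =
      tensorEval hτ F hX E x ((τ.tilde a).dualMap ξ) k := by
  rw [tensor_act_apply, F.stabEnd_of_incl ha]
  have hq : Frame.stabQuot γ.base = 1 := by
    refine Subtype.ext ((QuotientGroup.eq_one_iff (γ.base : G)).2 ?_)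
    have := congrArg CentralExt.base ha
    rw [CentralExt.incl_base, CentralExt.incl_base] at this
    exact this ▸ a.base.2
  have h1 : CentralExt.lift (F.beta hτ) (Frame.stabQuot γ.base) = 1 := by
    rw [hq]
    rfl
  exact (E.act_congr h1 _ (one_smul _ x) _).trans (E.act_one _ _)

theorem continuous_tensor_eval (ξ : Module.Dual ℂ τ.V) :
    Continuous (fun e : (E.tensor hτ F hX).Total =>
      (⟨e.proj, tensorEval hτ F hX E e.proj ξ e.snd⟩ : E.Total)) :=
  (continuous_apply ξ).comp (continuous_induced_dom
    (f := fun e : (E.tensor hτ F hX).Total =>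
      (fun ξ => ⟨e.proj, tensorEval hτ F hX E e.proj ξ e.snd⟩ : Module.Dual ℂ τ.V → E.Total)))

theorem continuous_tensor_rng {T : Type*} [TopologicalSpace T]
    {k : T → (E.tensor hτ F hX).Total}
    (h : ∀ ξ : Module.Dual ℂ τ.V, Continuous
      (fun t => (⟨(k t).proj, tensorEval hτ F hX E (k t).proj ξ (k t).snd⟩ : E.Total))) :
    Continuous k :=
  continuous_induced_rng.2 (continuous_pi h)

theorem tensor_locally_trivial [TopologicalSpace X] (hE : E.IsBundle) (x₀ : X) :
    ∃ U : Set X, IsOpen U ∧ x₀ ∈ U ∧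
      ∃ (n : ℕ) (φ : ∀ x : U, (Fin n → ℂ) ≃ₗ[ℂ] (E.tensor hτ F hX).fiber x),
        Topology.IsEmbedding
          (fun p : U × (Fin n → ℂ) => (⟨p.1, φ p.1 p.2⟩ : (E.tensor hτ F hX).Total)) := by
  obtain ⟨U, hU, hxU, n, φ, hφ⟩ := hE.locally_trivial x₀
  refine ⟨U, hU, hxU, ?_⟩
  let b := Module.finBasis ℂ (Module.Dual ℂ τ.V)
  let d := Module.finrank ℂ (Module.Dual ℂ τ.V)
  refine exists_trivialization (S := Fin d → Fin n → ℂ)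
    (fun x => (b.constr ℂ).trans (LinearEquiv.congrRight (φ x))) ?_
  have e2 : Topology.IsEmbedding (fun p : U × (Fin d → Fin n → ℂ) =>
      (fun ξ : Module.Dual ℂ τ.V => ((p.1, b.constr ℂ p.2 ξ) : U × (Fin n → ℂ)))) := by
    -- Evaluating at the zero form recovers the base point, and evaluating at a basis of the dual
    -- recovers the coordinates. This gives a continuous left inverse.
    refine Function.LeftInverse.isEmbedding
      (f := fun k : Module.Dual ℂ τ.V → U × (Fin n → ℂ) => ((k 0).1, fun i => (k (b i)).2)) ?_
      (by fun_prop) ?_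
    · intro p
      simp
    · refine continuous_pi fun ξ => _root_.continuous_fst.prodMk ?_
      have h1 : Continuous (fun h : Fin d → Fin n → ℂ => b.constr ℂ h ξ) :=
        LinearMap.continuous_of_finiteDimensional
          ((LinearMap.applyₗ ξ : (Module.Dual ℂ τ.V →ₗ[ℂ] (Fin n → ℂ)) →ₗ[ℂ] (Fin n → ℂ)) ∘ₗ
            (b.constr ℂ).toLinearMap)
      exact h1.comp _root_.continuous_snd
  have e3 := (Topology.IsEmbedding.piMap (fun _ : Module.Dual ℂ τ.V => hφ)).comp e2
  exact Topology.IsEmbedding.of_comp (continuous_induced_rng.2 e3.continuous)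
    (continuous_induced_dom (f := fun e : (E.tensor hτ F hX).Total =>
      (fun ξ => ⟨e.proj, tensorEval hτ F hX E e.proj ξ e.snd⟩ : Module.Dual ℂ τ.V → E.Total))) e3

theorem isBundle_tensor [TopologicalSpace X] (hE : E.IsBundle) :
    (E.tensor hτ F hX).IsBundle where
  continuous_proj := hE.continuous_proj.comp (continuous_tensor_eval 0)
  locally_trivial := tensor_locally_trivial hE
  continuous_act := by
    refine CentralExt.continuous_of_base fun g => continuous_tensor_rng fun ξ => ?_
    refine (hE.continuous_act.comp ((CentralExt.continuous_mk (Frame.stabQuot g)).prodMap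
      (continuous_tensor_eval ((F.stabEnd (CentralExt.lift _ g)).dualMap ξ)))).congr ?_
    rintro ⟨z, x, k⟩
    have h1 : F.stabEnd ⟨g, z⟩ = (z : ℂ) • F.stabEnd (CentralExt.lift _ g) := by
      rw [← F.stabEnd_ofCircle_mul]
      exact congrArg F.stabEnd (CentralExt.eq_ofCircle_mul_lift ⟨g, z⟩)
    have h2 : (F.stabEnd ⟨g, z⟩).dualMap ξ =
        (z : ℂ) • (F.stabEnd (CentralExt.lift _ g)).dualMap ξ := by
      rw [h1]
      ext v
      simp
    have hgx : Frame.stabQuot g • x = g • x := Frame.stabQuot_smul hX rfl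
    have h3 : E.act (⟨Frame.stabQuot g, z⟩ : CentralExt (F.beta hτ)) hgx
        (tensorEval hτ F hX E x ((F.stabEnd (CentralExt.lift _ g)).dualMap ξ) k) =
        tensorEval hτ F hX E (g • x) ξ ((E.tensor hτ F hX).act ⟨g, z⟩ rfl k) := by
      rw [tensor_act_apply, h2, tensorEval_smul, map_smul]
      exact E.act_eq_phase_smul _ hgx hgx _
    exact (E.mk_act _ hgx _).symm.trans (congrArg (Bundle.TotalSpace.mk (g • x)) h3)

end Tensor

end TwistedFamily

/-! ### Induced bundles -/

section Cosets

variable {G : Type w} [Group G] (H : Subgroup G) [Finite (G ⧸ H)]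

/-- The number of the coset `g H`. -/
def cosetIdx (g : G) : Fin (Nat.card (G ⧸ H)) := Finite.equivFin (G ⧸ H) g

/-- A representative of the coset with a given number. -/
def cosetRep (c : Fin (Nat.card (G ⧸ H))) : G := ((Finite.equivFin (G ⧸ H)).symm c).out

theorem cosetIdx_rep (c : Fin (Nat.card (G ⧸ H))) : cosetIdx H (cosetRep H c) = c := by
  rw [cosetIdx, cosetRep, QuotientGroup.out_eq', Equiv.apply_symm_apply]

variable {H}

theorem cosetIdx_eq_iff {g g' : G} : cosetIdx H g = cosetIdx H g' ↔ g⁻¹ * g' ∈ H := by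
  rw [cosetIdx, cosetIdx, EmbeddingLike.apply_eq_iff_eq, QuotientGroup.eq]

theorem inv_mul_rep_mem (g : G) : g⁻¹ * cosetRep H (cosetIdx H g) ∈ H := by
  rw [← cosetIdx_eq_iff, cosetIdx_rep]

/-- The lift of a coset representative to the central extension. -/
def liftRep (α : NormalizedCocycle G) (c : Fin (Nat.card (G ⧸ H))) : CentralExt α :=
  CentralExt.lift α (cosetRep H c)

theorem inv_mul_liftRep_mem {α : NormalizedCocycle G} (γ : CentralExt α) :
    (γ⁻¹ * liftRep α (cosetIdx H γ.base)).base ∈ H := inv_mul_rep_mem γ.base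

theorem cosetIdx_eq_of_incl {α : NormalizedCocycle G} {γ : CentralExt α}
    {c : Fin (Nat.card (G ⧸ H))} {δ : CentralExt (α.res H)}
    (h : CentralExt.incl α H δ = γ⁻¹ * liftRep α c) : cosetIdx H γ.base = c := by
  conv_rhs => rw [← cosetIdx_rep H c]
  have h1 : (δ.base : G) = γ.base⁻¹ * cosetRep H c := congrArg CentralExt.base h
  rw [cosetIdx_eq_iff, ← h1]
  exact δ.base.2

end Cosets

namespace TwistedFamily

/-! ### Induction of twisted families from a subgroup `H` to `G` -/

section Induce

variable {G : Type w} [Group G] {α : NormalizedCocycle G} {H : Subgroup G}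
  {X : Type u} [MulAction G X]

theorem incl_smul {δ : CentralExt (α.res H)} {ε : CentralExt α}
    (h : CentralExt.incl α H δ = ε) {x y : X} (hx : ε.base • x = y) : δ.base • x = y := by
  subst h
  exact hx

theorem inv_mul_smul {γ δ : CentralExt α} {x y z : X} (hδ : δ.base • x = z)
    (hγ : γ.base • y = z) : (δ⁻¹ * γ).base • y = x := by
  rw [CentralExt.mul_base, mul_smul, hγ, ← hδ]
  exact inv_smul_smul _ _

variable [Finite (G ⧸ H)]

theorem liftRep_smul (c : Fin (Nat.card (G ⧸ H))) (x : X) :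
    (liftRep α c).base • (cosetRep H c)⁻¹ • x = x := smul_inv_smul _ _

theorem liftRep_inv_smul (c : Fin (Nat.card (G ⧸ H))) (hc : (liftRep α c)⁻¹.base ∈ H) (x : X) :
    (CentralExt.ofMem (liftRep α c)⁻¹ hc).base • x = (cosetRep H c)⁻¹ • x := rfl

/-- The fibre of the induced family: a vector for each coset of `H`. -/
abbrev InduceFiber (E : TwistedFamily (α.res H) X) (x : X) : Type :=
  ∀ c : Fin (Nat.card (G ⧸ H)), E.fiber ((cosetRep H c)⁻¹ • x)

theorem inv_mul_liftRep_smul {γ : CentralExt α} {x y : X} (h : γ.base • y = x)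
    (c : Fin (Nat.card (G ⧸ H))) :
    (γ⁻¹ * liftRep α c).base • (cosetRep H c)⁻¹ • x = y := by
  rw [← h, CentralExt.mul_base, mul_smul]
  exact (congrArg (γ.base⁻¹ • ·) (smul_inv_smul (cosetRep H c) _)).trans (inv_smul_smul _ _)

/-- The evaluation of an element of the induced family at an element of the central extension. -/
def evalFiber (E : TwistedFamily (α.res H) X) (γ : CentralExt α) {x y : X} (h : γ.base • y = x) :
    InduceFiber E x →ₗ[ℂ] E.fiber y :=
  E.act (CentralExt.ofMem (γ⁻¹ * liftRep α (cosetIdx H γ.base)) (inv_mul_liftRep_mem γ))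
    (incl_smul rfl (inv_mul_liftRep_smul h _)) ∘ₗ LinearMap.proj (cosetIdx H γ.base)

/-- A point of the induced fibre over `x` stands for a function `s` on the central extension with
`s(γ η⁻¹) = η · s(γ)` for `η` over `H`, stored through its values at coset representatives. In `γ =
rep_c δ⁻¹` both `c` and `δ` are forced, so any such presentation computes `s(γ)`. -/
theorem evalFiber_eq (E : TwistedFamily (α.res H) X) {γ : CentralExt α} {x y : X}
    (h : γ.base • y = x) {c : Fin (Nat.card (G ⧸ H))} {δ : CentralExt (α.res H)}
    (hδ : CentralExt.incl α H δ = γ⁻¹ * liftRep α c) (s : InduceFiber E x) :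
    evalFiber E γ h s = E.act δ (incl_smul hδ (inv_mul_liftRep_smul h c)) (s c) := by
  obtain rfl := cosetIdx_eq_of_incl hδ
  obtain rfl : δ = CentralExt.ofMem (γ⁻¹ * liftRep α (cosetIdx H γ.base))
      (inv_mul_liftRep_mem γ) := CentralExt.incl_injective H hδ
  rfl

theorem evalFiber_congr (E : TwistedFamily (α.res H) X) {γ γ' : CentralExt α} (hh : γ = γ')
    {x y : X} (h : γ.base • y = x) (h' : γ'.base • y = x) (s : InduceFiber E x) :
    evalFiber E γ h s = evalFiber E γ' h' s := by
  subst hh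
  rfl

/-- The action on the induced family. -/
def induceAct (E : TwistedFamily (α.res H) X) (γ : CentralExt α) {x y : X} (h : γ.base • x = y) :
    InduceFiber E x →ₗ[ℂ] InduceFiber E y :=
  LinearMap.pi fun c => evalFiber E (γ⁻¹ * liftRep α c) (inv_mul_liftRep_smul h c)

/-- The action is translation of functions, `(δ s)(γ) = s(δ⁻¹ γ)`. Both sides act on the same stored
component, and the two elements over `H` multiply to the required one. -/
theorem evalFiber_induceAct (E : TwistedFamily (α.res H) X) {γ δ : CentralExt α} {x y z : X}
    (hδ : δ.base • x = z) (hγ : γ.base • y = z) (s : InduceFiber E x) :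
    evalFiber E γ hγ (induceAct E δ hδ s) = evalFiber E (δ⁻¹ * γ) (inv_mul_smul hδ hγ) s := by
  let c := cosetIdx H γ.base
  let ε := δ⁻¹ * liftRep α c
  let η₁ : CentralExt (α.res H) := CentralExt.ofMem (γ⁻¹ * liftRep α c) (inv_mul_liftRep_mem γ)
  let η₂ : CentralExt (α.res H) := CentralExt.ofMem (ε⁻¹ * liftRep α (cosetIdx H ε.base))
    (inv_mul_liftRep_mem ε)
  have h1 : CentralExt.incl α H (η₁ * η₂) = (δ⁻¹ * γ)⁻¹ * liftRep α (cosetIdx H ε.base) := by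
    have h2 : CentralExt.incl α H η₁ = γ⁻¹ * liftRep α c := rfl
    have h3 : CentralExt.incl α H η₂ = ε⁻¹ * liftRep α (cosetIdx H ε.base) := rfl
    rw [map_mul, h2, h3]
    simp only [ε]
    group
  rw [evalFiber_eq E _ h1]
  exact E.act_act _ _ rfl _ _

/-- The family induced from a subgroup `H` to `G`. -/
def induce (E : TwistedFamily (α.res H) X) [TopologicalSpace X] : TwistedFamily α X where
  fiber x := InduceFiber E x
  top := TopologicalSpace.induced (fun e => ((e.proj, fun c => ⟨(cosetRep H c)⁻¹ • e.proj, e.snd c⟩) :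
    X × (Fin (Nat.card (G ⧸ H)) → E.Total))) inferInstance
  act γ _ _ h := induceAct E γ h
  act_one h e := funext fun c => (evalFiber_eq E (c := c) (δ := 1) (inv_mul_liftRep_smul h c) (by
    rw [map_one]; group) e).trans (E.act_one _ _)
  act_mul γ δ x y z hδ hγ h e := funext fun c => by
    refine Eq.trans ?_ (evalFiber_induceAct E hδ (inv_mul_liftRep_smul hγ c) e).symm
    exact evalFiber_congr E (by group) (inv_mul_liftRep_smul h c) _ e
  act_circle z x h e := funext fun c => (evalFiber_eq E (c := c) (δ := CentralExt.ofCircle z)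
    (inv_mul_liftRep_smul h c) (by
    rw [mul_inv_rev, inv_inv, mul_assoc, CentralExt.ofCircle_comm, inv_mul_cancel_left]
    rfl) e).trans (E.act_circle _ _ _)

variable [TopologicalSpace X] {E : TwistedFamily (α.res H) X}

/-- The evaluation of an element of the induced family at an element of the central extension. -/
def induceEval (E : TwistedFamily (α.res H) X) (γ : CentralExt α) {x y : X}
    (h : γ.base • y = x) : E.induce.fiber x →ₗ[ℂ] E.fiber y := evalFiber E γ h

theorem induceEval_act {γ δ : CentralExt α} {x y z : X}
    (hδ : δ.base • x = z) (hγ : γ.base • y = z) (s : E.induce.fiber x) :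
    induceEval E γ hγ (E.induce.act δ hδ s) = induceEval E (δ⁻¹ * γ) (inv_mul_smul hδ hγ) s :=
  evalFiber_induceAct E hδ hγ s

theorem induceEval_congr {γ γ' : CentralExt α} (hh : γ = γ') {x y : X} (h : γ.base • y = x)
    (h' : γ'.base • y = x) (s : E.induce.fiber x) :
    induceEval E γ h s = induceEval E γ' h' s := evalFiber_congr E hh h h' s

theorem induceEval_mul_incl {γ : CentralExt α} {η : CentralExt (α.res H)} {x y z : X}
    (hγ : γ.base • y = x) (hη : η.base • y = z) (h : (γ * CentralExt.incl α H η⁻¹).base • z = x)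
    (s : E.induce.fiber x) :
    induceEval E (γ * CentralExt.incl α H η⁻¹) h s = E.act η hη (induceEval E γ hγ s) := by
  refine (evalFiber_eq E (c := cosetIdx H γ.base) (δ := η * CentralExt.ofMem
    (γ⁻¹ * liftRep α (cosetIdx H γ.base)) (inv_mul_liftRep_mem γ)) h ?_ s).trans
    (E.act_mul _ _ _ _ _ _)
  rw [map_mul, CentralExt.incl_ofMem, map_inv]
  group

theorem induceEval_liftRep (c : Fin (Nat.card (G ⧸ H))) {x : X} (s : E.induce.fiber x) :
    induceEval E (liftRep α c) (liftRep_smul c x) s = (s : InduceFiber E x) c :=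
  (evalFiber_eq E (c := c) (δ := 1) _ (by rw [map_one, inv_mul_cancel]) s).trans (E.act_one _ _)

theorem induce_ext {x : X} {s s' : E.induce.fiber x}
    (h : ∀ c : Fin (Nat.card (G ⧸ H)), induceEval E (liftRep α c) (liftRep_smul c x) s =
      induceEval E (liftRep α c) (liftRep_smul c x) s') : s = s' :=
  funext fun c => by
    have := h c
    rwa [induceEval_liftRep, induceEval_liftRep] at this

open Classical in
/-- The inclusion of a family over `H` into the induced family. -/
def toInduce (E : TwistedFamily (α.res H) X) (x : X) : E.fiber x →ₗ[ℂ] E.induce.fiber x :=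
  LinearMap.pi (φ := fun c => E.fiber ((cosetRep H c)⁻¹ • x)) fun c =>
    if hc : (liftRep α c)⁻¹.base ∈ H then
      E.act (CentralExt.ofMem (liftRep α c)⁻¹ hc) (liftRep_inv_smul c hc x) else 0

open Classical in
theorem toInduce_apply_of_mem {x : X} (c : Fin (Nat.card (G ⧸ H)))
    (hc : (liftRep α c)⁻¹.base ∈ H) (e : E.fiber x) : (toInduce E x e : InduceFiber E x) c =
      E.act (CentralExt.ofMem (liftRep α c)⁻¹ hc) (liftRep_inv_smul c hc x) e := by
  change (dite _ _ _ : E.fiber x →ₗ[ℂ] E.fiber ((cosetRep H c)⁻¹ • x)) e = _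
  rw [dif_pos hc]

open Classical in
theorem toInduce_apply_of_notMem {x : X} (c : Fin (Nat.card (G ⧸ H)))
    (hc : (liftRep α c)⁻¹.base ∉ H) (e : E.fiber x) :
    (toInduce E x e : InduceFiber E x) c = 0 := by
  change (dite _ _ _ : E.fiber x →ₗ[ℂ] E.fiber ((cosetRep H c)⁻¹ • x)) e = _
  rw [dif_neg hc]
  rfl

theorem liftRep_cosetIdx_mem_iff {γ : CentralExt α} :
    (liftRep α (cosetIdx H γ.base))⁻¹.base ∈ H ↔ γ.base ∈ H := by
  have h : γ.base⁻¹ * cosetRep H (cosetIdx H γ.base) ∈ H := inv_mul_rep_mem γ.base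
  change (cosetRep H (cosetIdx H γ.base))⁻¹ ∈ H ↔ _
  rw [H.inv_mem_iff]
  constructor
  · intro h1
    have := H.mul_mem h1 (H.inv_mem h)
    simpa using this
  · intro h1
    have := H.mul_mem h1 h
    simpa using this

theorem induceEval_toInduce_of_mem {γ : CentralExt α} {x y : X} (h : γ.base • y = x)
    {δ : CentralExt (α.res H)} (hδ : CentralExt.incl α H δ = γ⁻¹) (hx : δ.base • x = y)
    (e : E.fiber x) : induceEval E γ h (toInduce E x e) = E.act δ hx e := by
  have hm : γ.base ∈ H := by
    have := congrArg CentralExt.base hδ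
    rw [CentralExt.incl_base, CentralExt.inv_base] at this
    exact H.inv_mem_iff.1 (this ▸ δ.base.2)
  refine (congrArg _ (toInduce_apply_of_mem (cosetIdx H γ.base)
    (liftRep_cosetIdx_mem_iff.2 hm) e)).trans (E.act_act _ _ ?_ hx e)
  apply CentralExt.incl_injective H
  rw [map_mul, CentralExt.incl_ofMem, CentralExt.incl_ofMem, mul_inv_cancel_right, hδ]

/-- `toInduce` sends `e` to the function supported on `H` with value `e` at the identity, so it
vanishes on the other cosets. -/
theorem induceEval_toInduce_of_notMem {γ : CentralExt α} {x y : X} (h : γ.base • y = x)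
    (hγ : γ.base ∉ H) (e : E.fiber x) : induceEval E γ h (toInduce E x e) = 0 :=
  (congrArg _ (toInduce_apply_of_notMem (cosetIdx H γ.base)
    (fun hm => hγ (liftRep_cosetIdx_mem_iff.1 hm)) e)).trans (LinearMap.map_zero _)

/-- Translating by an element over `H` preserves the support `H`; on it, both functions are computed
by the action of `H` on `E`. -/
theorem induce_act_toInduce {x y : X} {γ : CentralExt α} {η : CentralExt (α.res H)}
    (hη : CentralExt.incl α H η = γ) (h : γ.base • x = y) (h' : η.base • x = y) (e : E.fiber x) :
    E.induce.act γ h (toInduce E x e) = toInduce E y (E.act η h' e) := by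
  subst hη
  refine induce_ext fun c => ?_
  rw [induceEval_act]
  by_cases hc : (liftRep α c)⁻¹.base ∈ H
  · let ε : CentralExt (α.res H) := CentralExt.ofMem (liftRep α c)⁻¹ hc
    have hε : ε.base • y = (cosetRep H c)⁻¹ • y := liftRep_inv_smul c hc y
    have hεη : (ε * η).base • x = (cosetRep H c)⁻¹ • y := by
      rw [CentralExt.mul_base, mul_smul, h', hε]
    rw [induceEval_toInduce_of_mem (δ := ε * η) _ (by
        rw [map_mul, mul_inv_rev, inv_inv]; rfl) hεη,
      induceEval_toInduce_of_mem (δ := ε) _ rfl hε, E.act_act h' hε rfl hεη]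
  · rw [induceEval_toInduce_of_notMem, induceEval_toInduce_of_notMem]
    · exact fun hm => hc (H.inv_mem hm)
    · intro hm
      refine hc (H.inv_mem ?_)
      have := H.mul_mem η.base.2 hm
      rw [CentralExt.mul_base, CentralExt.inv_base, CentralExt.incl_base, mul_inv_cancel_left]
        at this
      exact this

/-! ### Topology of the induced family -/

theorem continuous_induce_proj : Continuous (fun e : E.induce.Total => e.proj) :=
  _root_.continuous_fst.comp (continuous_induced_dom (f := fun e : E.induce.Total =>
    ((e.proj, fun c => ⟨(cosetRep H c)⁻¹ • e.proj, (e.snd : InduceFiber E e.proj) c⟩) :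
      X × (Fin (Nat.card (G ⧸ H)) → E.Total))))

theorem continuous_induce_apply (c : Fin (Nat.card (G ⧸ H))) :
    Continuous (fun e : E.induce.Total =>
      (⟨(cosetRep H c)⁻¹ • e.proj, (e.snd : InduceFiber E e.proj) c⟩ : E.Total)) :=
  (continuous_apply c).comp (_root_.continuous_snd.comp
    (continuous_induced_dom (f := fun e : E.induce.Total =>
    ((e.proj, fun c => ⟨(cosetRep H c)⁻¹ • e.proj, (e.snd : InduceFiber E e.proj) c⟩) :
      X × (Fin (Nat.card (G ⧸ H)) → E.Total)))))

theorem continuous_induce_rng {T : Type*} [TopologicalSpace T] {k : T → E.induce.Total}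
    (h : Continuous (fun t => (k t).proj))
    (h' : ∀ c, Continuous (fun t => (⟨(cosetRep H c)⁻¹ • (k t).proj,
      ((k t).snd : InduceFiber E (k t).proj) c⟩ : E.Total))) : Continuous k :=
  continuous_induced_rng.2 (h.prodMk (continuous_pi h'))

theorem continuous_induceEval_one (hE : E.IsBundle) :
    Continuous (fun e : E.induce.Total =>
      (⟨e.proj, induceEval E 1 (one_smul G e.proj) e.snd⟩ : E.Total)) :=
  hE.continuous_act_const
    (CentralExt.ofMem ((1 : CentralExt α)⁻¹ * liftRep α (cosetIdx H (1 : CentralExt α).base))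
      (inv_mul_liftRep_mem (1 : CentralExt α)))
    (fun e : E.induce.Total => incl_smul rfl
      (inv_mul_liftRep_smul (γ := (1 : CentralExt α)) (one_smul G e.proj) _))
    (continuous_induce_apply _)

variable [ContinuousConstSMul G X]

theorem induce_locally_trivial (hE : E.IsBundle) (x₀ : X) :
    ∃ U : Set X, IsOpen U ∧ x₀ ∈ U ∧
      ∃ (n : ℕ) (φ : ∀ x : U, (Fin n → ℂ) ≃ₗ[ℂ] E.induce.fiber x),
        Topology.IsEmbedding
          (fun p : U × (Fin n → ℂ) => (⟨p.1, φ p.1 p.2⟩ : E.induce.Total)) := by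
  have ht := fun c : Fin (Nat.card (G ⧸ H)) => hE.locally_trivial ((cosetRep H c)⁻¹ • x₀)
  choose U hU hxU n φ hφ using ht
  let V : Set X := ⋂ c, (fun x => (cosetRep H c)⁻¹ • x) ⁻¹' U c
  have hV : IsOpen V := isOpen_iInter_of_finite fun c => (hU c).preimage (continuous_const_smul _)
  have hxV : x₀ ∈ V := Set.mem_iInter.2 hxU
  let j : ∀ c, V → U c := fun c x => ⟨(cosetRep H c)⁻¹ • x, Set.mem_iInter.1 x.2 c⟩
  have hj : ∀ c, Continuous (j c) := fun c =>
    ((continuous_const_smul _).comp continuous_subtype_val).subtype_mk _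
  refine ⟨V, hV, hxV, exists_trivialization (S := ∀ c, Fin (n c) → ℂ)
    (fun x => (LinearEquiv.piCongrRight fun c => φ c (j c x) :
      (∀ c, Fin (n c) → ℂ) ≃ₗ[ℂ] InduceFiber E x)) ?_⟩
  have e1 : Topology.IsEmbedding (fun p : V × (∀ c, Fin (n c) → ℂ) =>
      (((p.1 : X), fun c => (j c p.1, p.2 c)) : X × (∀ c, U c × (Fin (n c) → ℂ)))) := by
    refine Topology.IsEmbedding.of_comp
      (g := fun p : X × (∀ c, U c × (Fin (n c) → ℂ)) => (p.1, fun c => (p.2 c).2)) ?_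
      (by fun_prop) (Topology.IsEmbedding.subtypeVal.prodMap Topology.IsEmbedding.id)
    exact (continuous_subtype_val.comp _root_.continuous_fst).prodMk (continuous_pi fun c =>
      ((hj c).comp _root_.continuous_fst).prodMk
        ((continuous_apply c).comp _root_.continuous_snd))
  have e2 := (Topology.IsEmbedding.id.prodMap (Topology.IsEmbedding.piMap hφ)).comp e1
  exact Topology.IsEmbedding.of_comp (continuous_induced_rng.2 e2.continuous)
    (continuous_induced_dom (f := fun e : E.induce.Total =>
    ((e.proj, fun c => ⟨(cosetRep H c)⁻¹ • e.proj, (e.snd : InduceFiber E e.proj) c⟩) :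
      X × (Fin (Nat.card (G ⧸ H)) → E.Total)))) e2

theorem isBundle_induce (hE : E.IsBundle) : E.induce.IsBundle where
  continuous_proj := continuous_induce_proj
  locally_trivial := induce_locally_trivial hE
  continuous_act := by
    refine continuous_induce_rng (CentralExt.continuous_base_smul.comp
      (continuous_id.prodMap continuous_induce_proj)) fun c =>
      CentralExt.continuous_of_base fun g => ?_
    let ε : CentralExt α := (CentralExt.lift α g)⁻¹ * liftRep α c
    let c' := cosetIdx H ε.base
    let η : CentralExt (α.res H) := CentralExt.ofMem (ε⁻¹ * liftRep α c') (inv_mul_liftRep_mem ε)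
    -- With `g` fixed, varying the phase `z` does not change the coset index and multiplies the
    -- component over `H` by the central element `z`. Continuity then follows from the continuous
    -- action on `E`.
    have hη : Continuous (fun z : Circle =>
        (⟨η.base, z * η.phase⟩ : CentralExt (α.res H))) :=
      (CentralExt.continuous_mk η.base).comp (continuous_mul_const η.phase)
    refine (hE.continuous_act.comp (hη.prodMap (continuous_induce_apply c'))).congr ?_
    rintro ⟨z, x, s⟩
    have hηz : CentralExt.incl α H ⟨η.base, z * η.phase⟩ =
        ((⟨g, z⟩ : CentralExt α)⁻¹ * liftRep α c)⁻¹ * liftRep α c' := by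
      have h1 : (⟨η.base, z * η.phase⟩ : CentralExt (α.res H)) = CentralExt.ofCircle z * η :=
        CentralExt.ext (by simp [CentralExt.ofCircle])
          (by simp [CentralExt.ofCircle, NormalizedCocycle.map_one_left])
      have h2 : (⟨g, z⟩ : CentralExt α) = CentralExt.ofCircle z * CentralExt.lift α g :=
        CentralExt.eq_ofCircle_mul_lift _
      have h3 : CentralExt.incl α H (CentralExt.ofCircle z) = CentralExt.ofCircle z := rfl
      have h5 : CentralExt.incl α H η = ε⁻¹ * liftRep α c' := rfl
      rw [h1, h2, map_mul, h3, h5, CentralExt.ofCircle_comm,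
        CentralExt.ofCircle_comm z (CentralExt.lift α g)]
      simp only [ε, mul_inv_rev, inv_inv, mul_assoc]
      rw [CentralExt.ofCircle_comm]
    have h4 := evalFiber_eq E (inv_mul_liftRep_smul (γ := (⟨g, z⟩ : CentralExt α))
      (y := x) (x := g • x) rfl c)
      hηz s
    refine Eq.trans ?_ (congrArg (Bundle.TotalSpace.mk ((cosetRep H c)⁻¹ • g • x)) h4.symm)
    exact (E.mk_act _ _ _).symm

theorem continuous_toInduce (hE : E.IsBundle) :
    Continuous (fun e : E.Total => (⟨e.proj, toInduce E e.proj e.snd⟩ : E.induce.Total)) := by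
  refine continuous_induce_rng hE.continuous_proj fun c => ?_
  by_cases hc : (liftRep α c)⁻¹.base ∈ H
  · exact (hE.continuous_act_const _ (fun e : E.Total => liftRep_inv_smul c hc e.proj)
      continuous_id).congr fun e => congrArg (Bundle.TotalSpace.mk ((cosetRep H c)⁻¹ • e.proj))
        (toInduce_apply_of_mem c hc e.snd).symm
  · exact (hE.continuous_zero_section ((continuous_const_smul (cosetRep H c)⁻¹).comp
      hE.continuous_proj)).congr fun e =>
        congrArg (Bundle.TotalSpace.mk ((cosetRep H c)⁻¹ • e.proj))
        (toInduce_apply_of_notMem c hc e.snd).symm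

end Induce

end TwistedFamily

/-! ### Every family of bundles is realized -/

namespace ProjRep

section DualPairing

variable {B : Type w} [Group B] {β : NormalizedCocycle B} {τ τ' : ProjRep β} {W : Type*}
  [AddCommGroup W] [Module ℂ W] {κ : τ'.V →ₗ[ℂ] Module.Dual ℂ τ.V →ₗ[ℂ] W}

/-- Composition of a map `V_τ' → V_τ ⊗ W` with a linear form on `W`. -/
def contract (κ : τ'.V →ₗ[ℂ] Module.Dual ℂ τ.V →ₗ[ℂ] W) (η : Module.Dual ℂ W) : τ'.V →ₗ[ℂ] τ.V :=
  (Module.evalEquiv ℂ τ.V).symm.toLinearMap ∘ₗ LinearMap.compRight ℂ η ∘ₗ κ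

theorem apply_contract (η : Module.Dual ℂ W) (v : τ'.V) (ξ : Module.Dual ℂ τ.V) :
    ξ (contract κ η v) = η (κ v ξ) :=
  Module.apply_evalEquiv_symm_apply ℂ τ.V ξ (η ∘ₗ κ v)

theorem contract_mem_homs (hκ : ∀ b v ξ, κ (τ'.ρ b v) ξ = κ v ((τ.ρ b).dualMap ξ))
    (η : Module.Dual ℂ W) : contract κ η ∈ homs τ' τ := fun b v => by
  refine (Module.evalEquiv ℂ τ.V).injective (LinearMap.ext fun ξ => ?_)
  change ξ (contract κ η (τ'.ρ b v)) = (τ.ρ b).dualMap ξ (contract κ η v)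
  rw [apply_contract, hκ, apply_contract]

/-- Contracting with a linear form on `W` gives an intertwining operator `V_τ' → V_τ`, which is zero
by Schur's lemma; linear forms separate the points of `W`. -/
theorem eq_zero_of_not_isIso (hτ : τ.IsIrreducible) (hτ' : τ'.IsIrreducible)
    (h : ¬ τ'.IsIso τ) (hκ : ∀ b v ξ, κ (τ'.ρ b v) ξ = κ v ((τ.ρ b).dualMap ξ)) : κ = 0 := by
  refine LinearMap.ext fun v => LinearMap.ext fun ξ =>
    (Module.forall_dual_apply_eq_zero_iff ℂ _).1 fun η => ?_
  rw [← apply_contract, homs_eq_zero hτ' hτ h (contract_mem_homs hκ η), LinearMap.zero_apply,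
    map_zero]

/-- Every equivariant map `V_τ → V_τ ⊗ W` is `v ↦ v ⊗ w`: each contraction with a form on `W` is a
scalar. The normalized pair `v₀`, `ξ₀` reads off `w = κ v₀ ξ₀`. -/
theorem apply_eq_smul {κ : τ.V →ₗ[ℂ] Module.Dual ℂ τ.V →ₗ[ℂ] W} (hτ : τ.IsIrreducible)
    (hκ : ∀ b v ξ, κ (τ.ρ b v) ξ = κ v ((τ.ρ b).dualMap ξ)) {v₀ : τ.V} {ξ₀ : Module.Dual ℂ τ.V}
    (h₀ : ξ₀ v₀ = 1) (v : τ.V) (ξ : Module.Dual ℂ τ.V) : κ v ξ = ξ v • κ v₀ ξ₀ := by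
  rw [← sub_eq_zero]
  refine (Module.forall_dual_apply_eq_zero_iff ℂ _).1 fun η => ?_
  obtain ⟨c, hc⟩ := exists_eq_smul_one hτ (contract_mem_homs hκ η)
  rw [map_sub, map_smul, ← apply_contract, ← apply_contract, hc]
  simp [h₀, mul_comm]

end DualPairing

theorem eq_zero_of_not_isIso_translate {G : Type w} [Group G] {α : NormalizedCocycle G}
    {A : Subgroup G} [A.Normal] {τ τ' : ProjRep (α.res A)} {W : Type*} [AddCommGroup W] [Module ℂ W]
    {κ : τ'.V →ₗ[ℂ] Module.Dual ℂ τ.V →ₗ[ℂ] W} {g : G} (hτ : τ.IsIrreducible)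
    (hτ' : τ'.IsIrreducible) (h : ¬ τ'.IsIso (τ.translate g))
    (hκ : ∀ a v ξ, κ (τ'.ρ a v) ξ =
      κ v (LinearMap.dualMap ((τ.translate g).ρ a : Module.End ℂ τ.V) ξ)) : κ = 0 :=
  eq_zero_of_not_isIso (τ := τ.translate g) (κ := κ) (hτ.translate g) hτ' h hκ

theorem exists_dual_apply_eq_one {B : Type w} [Group B] {β : NormalizedCocycle B} {τ : ProjRep β}
    (hτ : τ.IsIrreducible) : ∃ (v₀ : τ.V) (ξ₀ : Module.Dual ℂ τ.V), ξ₀ v₀ = 1 := by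
  have := hτ.1
  let i : Fin (Module.finrank ℂ τ.V) := ⟨0, Module.finrank_pos⟩
  exact ⟨τ.basis i, τ.basis.coord i, by simp⟩

end ProjRep

namespace TwistedFamily

/-! ### Equivariant maps into the induced bundle of `V_τ ⊗ E` -/

section HomInduce

variable {G : Type w} [Group G] {α : NormalizedCocycle G} {A : Subgroup G} [A.Normal]
  {τ : ProjRep (α.res A)} {hτ : τ.IsIrreducible} {F : Frame τ}
  {X : Type u} [MulAction G X] [MulAction (G ⧸ A) X]
  {hX : ∀ (g : G) (x : X), (g : G ⧸ A) • x = g • x} {E : TwistedFamily (F.beta hτ) X}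

/-- The elementary tensors `v ⊗ f`. -/
def tensorMk (hτ : τ.IsIrreducible) (F : Frame τ)
    (hX : ∀ (g : G) (x : X), (g : G ⧸ A) • x = g • x) (E : TwistedFamily (F.beta hτ) X) (x : X) :
    E.fiber x →ₗ[ℂ] τ.V →ₗ[ℂ] (E.tensor hτ F hX).fiber x :=
  (LinearMap.mk₂ ℂ (fun f v => (Module.Dual.eval ℂ τ.V v).smulRight f)
      (fun f f' v => by ext; simp) (fun c f v => by ext; simp [smul_comm c])
      (fun f v v' => by ext; simp [add_smul]) (fun c f v => by ext; simp [mul_smul]) :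
    E.fiber x →ₗ[ℂ] τ.V →ₗ[ℂ] Module.Dual ℂ τ.V →ₗ[ℂ] E.fiber x)

theorem tensorEval_tensorMk (x : X) (f : E.fiber x) (v : τ.V) (ξ : Module.Dual ℂ τ.V) :
    tensorEval hτ F hX E x ξ (tensorMk hτ F hX E x f v) = ξ v • f := rfl

theorem tensor_act_tensorMk {γ : CentralExt (α.res τ.stab)} {x y : X} (h : γ.base • x = y)
    (f : E.fiber x) (v : τ.V) :
    (E.tensor hτ F hX).act γ h (tensorMk hτ F hX E x f v) = tensorMk hτ F hX E y
      (E.act (CentralExt.lift _ (Frame.stabQuot γ.base)) (Frame.stabQuot_smul hX h) f)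
      (F.stabEnd γ v) := tensor_ext fun ξ => by
  rw [tensor_act_apply, tensorEval_tensorMk, tensorEval_tensorMk, map_smul]
  rfl

variable [Finite G] [TopologicalSpace X]

/-- Translation by `a` followed by evaluation at `γ` is evaluation at `a⁻¹ γ = γ (γ⁻¹ a γ)⁻¹`. Since
`γ⁻¹ a γ` lies over `A`, it acts only on the `V_τ` factor. -/
theorem induceEval_homFiber {τ' : ProjRep (α.res A)} {x y : X}
    {k : τ'.V →ₗ[ℂ] (E.tensor hτ F hX).induce.fiber x}
    (hk : k ∈ homFiber (smul_eq_of_quotient hX) τ' (E.tensor hτ F hX).induce x)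
    {γ : CentralExt α} (h : γ.base • y = x) (a : CentralExt (α.res A)) (v : τ'.V)
    (ξ : Module.Dual ℂ τ.V) :
    tensorEval hτ F hX E y ξ (induceEval _ γ h (k (τ'.tilde a v))) =
      tensorEval hτ F hX E y ((τ.tilde (CentralExt.conj γ a)).dualMap ξ)
        (induceEval _ γ h (k v)) := by
  have hA := smul_eq_of_quotient (A := A) hX
  let η : CentralExt (α.res τ.stab) :=
    CentralExt.ofMem (CentralExt.incl α A (CentralExt.conj γ a)) (τ.le_stab (Subtype.prop _))
  have hη : CentralExt.incl α τ.stab η = CentralExt.incl α A (CentralExt.conj γ a) := rfl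
  have hηy : η.base • y = y := hA (CentralExt.conj γ a).base y
  have h1 : (CentralExt.incl α A a)⁻¹ * γ = γ * CentralExt.incl α τ.stab η⁻¹ := by
    rw [map_inv, hη, CentralExt.incl_conj]
    group
  have hax : (CentralExt.incl α A a).base • x = x := hA a.base x
  have h2 := inv_mul_smul hax h
  have h3 : (γ * CentralExt.incl α τ.stab η⁻¹).base • y = x := h1 ▸ h2
  refine (congrArg (fun s => tensorEval hτ F hX E y ξ (induceEval _ γ h s)) (hk a v)).trans ?_
  refine (congrArg (tensorEval hτ F hX E y ξ) (((induceEval_act hax h (k v)).trans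
    (induceEval_congr h1 h2 h3 _)).trans (induceEval_mul_incl h hηy h3 (k v)))).trans ?_
  exact tensor_act_of_incl hη hηy _ ξ

/-- The linear map `V_τ' → V_τ ⊗ E_y` obtained by evaluating a map to the induced family. -/
def evalMap {τ' : ProjRep (α.res A)} {x y : X}
    (k : τ'.V →ₗ[ℂ] (E.tensor hτ F hX).induce.fiber x) (γ : CentralExt α) (h : γ.base • y = x) :
    τ'.V →ₗ[ℂ] Module.Dual ℂ τ.V →ₗ[ℂ] E.fiber y :=
  (induceEval (E.tensor hτ F hX) γ h) ∘ₗ k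

/-- Evaluation at `γ` intertwines `τ'` with the translate of `τ` by `γ`, so it vanishes when these
are not isomorphic. For `τ' = τ` this removes the components outside `G_[τ]`; for `τ'` in another
orbit it removes all of them. -/
theorem induceEval_eq_zero {τ' : ProjRep (α.res A)} (hτ' : τ'.IsIrreducible) {x y : X}
    {k : τ'.V →ₗ[ℂ] (E.tensor hτ F hX).induce.fiber x}
    (hk : k ∈ homFiber (smul_eq_of_quotient hX) τ' (E.tensor hτ F hX).induce x)
    {γ : CentralExt α} (h : γ.base • y = x) (hγ : ¬ τ'.IsIso (τ.translate γ.base)) (v : τ'.V) :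
    induceEval _ γ h (k v) = 0 := by
  have h1 := ProjRep.eq_zero_of_not_isIso_translate (κ := evalMap k γ h) hτ hτ' hγ fun a v ξ => by
    have h2 : (τ.translate γ.base).ρ a = τ.tilde (CentralExt.conj γ (CentralExt.lift _ a)) := by
      rw [← ProjRep.tilde_lift, ProjRep.translate_tilde_base]
    have h3 := induceEval_homFiber hk h (CentralExt.lift _ a) v ξ
    rw [ProjRep.tilde_lift, ← h2] at h3
    exact h3
  exact congrArg (fun κ : τ'.V →ₗ[ℂ] Module.Dual ℂ τ.V →ₗ[ℂ] E.fiber y => κ v) h1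

/-- At the identity the evaluated map `V_τ → V_τ ⊗ E_x` is equivariant, so by Schur's lemma it is `v
↦ v ⊗ f` for a single `f` in `E_x`. -/
theorem induceEval_one_eq {x : X} {k : τ.V →ₗ[ℂ] (E.tensor hτ F hX).induce.fiber x}
    (hk : k ∈ homFiber (smul_eq_of_quotient hX) τ (E.tensor hτ F hX).induce x)
    {v₀ : τ.V} {ξ₀ : Module.Dual ℂ τ.V} (h₀ : ξ₀ v₀ = 1) (v : τ.V) :
    induceEval _ 1 (one_smul G x) (k v) = tensorMk hτ F hX E x
      (tensorEval hτ F hX E x ξ₀ (induceEval _ 1 (one_smul G x) (k v₀))) v :=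
  tensor_ext fun ξ => ProjRep.apply_eq_smul (κ := evalMap k 1 (one_smul G x)) hτ
    (fun a v ξ => by
      have := induceEval_homFiber (γ := 1) hk (one_smul G x) (CentralExt.lift _ a) v ξ
      rw [CentralExt.conj_one, ProjRep.tilde_lift] at this
      exact this) h₀ v ξ

theorem induceEval_one_toInduce {H : Subgroup G} {E : TwistedFamily (α.res H) X} {x : X}
    (e : E.fiber x) : induceEval E 1 (one_smul G x) (toInduce E x e) = e :=
  (induceEval_toInduce_of_mem (δ := 1) _ (by rw [map_one, inv_one]) (one_smul H x) e).trans
    (E.act_one _ _)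

theorem toInduce_tensorMk_mem (x : X) (f : E.fiber x) :
    toInduce (E.tensor hτ F hX) x ∘ₗ tensorMk hτ F hX E x f ∈
      homFiber (smul_eq_of_quotient hX) τ (E.tensor hτ F hX).induce x := fun a v => by
  let η : CentralExt (α.res τ.stab) :=
    CentralExt.ofMem (CentralExt.incl α A a) (τ.le_stab a.base.2)
  have hη : CentralExt.incl α τ.stab η = CentralExt.incl α A a := rfl
  have hηx : η.base • x = x := smul_eq_of_quotient hX a.base x
  refine Eq.trans ?_ (induce_act_toInduce hη hηx hηx (tensorMk hτ F hX E x f v)).symm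
  refine congrArg (toInduce (E.tensor hτ F hX) x) (tensor_ext fun ξ => ?_)
  rw [tensor_act_of_incl hη, tensorEval_tensorMk, tensorEval_tensorMk]
  rfl

/-- The fibrewise isomorphism `E ≅ Hom(V_τ, Ind(V_τ ⊗ E))`. -/
def homInduceEquiv {v₀ : τ.V} {ξ₀ : Module.Dual ℂ τ.V} (h₀ : ξ₀ v₀ = 1) (x : X) :
    E.fiber x ≃ₗ[ℂ] homFiber (smul_eq_of_quotient hX) τ (E.tensor hτ F hX).induce x where
  toFun f := ⟨toInduce (E.tensor hτ F hX) x ∘ₗ tensorMk hτ F hX E x f, toInduce_tensorMk_mem x f⟩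
  map_add' f f' := Subtype.ext ((congrArg (toInduce (E.tensor hτ F hX) x ∘ₗ ·)
    ((tensorMk hτ F hX E x).map_add f f')).trans (LinearMap.comp_add _ _ _))
  map_smul' c f := Subtype.ext ((congrArg (toInduce (E.tensor hτ F hX) x ∘ₗ ·)
    ((tensorMk hτ F hX E x).map_smul c f)).trans (LinearMap.comp_smul _ _ _))
  invFun k := tensorEval hτ F hX E x ξ₀ (induceEval _ 1 (one_smul G x) (k.1 v₀))
  left_inv f := by
    change tensorEval hτ F hX E x ξ₀ (induceEval _ 1 (one_smul G x)
      (toInduce (E.tensor hτ F hX) x (tensorMk hτ F hX E x f v₀))) = f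
    rw [induceEval_one_toInduce, tensorEval_tensorMk, h₀, one_smul]
  right_inv k := by
    refine Subtype.ext (LinearMap.ext fun v => induce_ext fun c => ?_)
    rw [LinearMap.comp_apply]
    -- On the coset of `G_[τ]` itself both functions are determined by their values at the identity,
    -- where `induceEval_one_eq` applies. On the other cosets both vanish.
    by_cases hc : (liftRep α c).base ∈ τ.stab
    · let η : CentralExt (α.res τ.stab) := CentralExt.ofMem (liftRep α c)⁻¹ (inv_mem hc)
      have hη : (liftRep α c : CentralExt α) = 1 * CentralExt.incl α τ.stab η⁻¹ := by
        rw [map_inv, one_mul, CentralExt.incl_ofMem, inv_inv]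
      have h1 := liftRep_smul (α := α) c x
      have h2 : η.base • x = (cosetRep τ.stab c)⁻¹ • x := rfl
      rw [induceEval_congr hη _ (hη ▸ h1), induceEval_mul_incl (one_smul G x) h2,
        induceEval_congr hη _ (hη ▸ h1), induceEval_mul_incl (one_smul G x) h2,
        induceEval_one_toInduce, induceEval_one_eq k.2 h₀]
    · rw [induceEval_toInduce_of_notMem _ hc, induceEval_eq_zero hτ k.2 _ fun hi => hc hi.symm]

variable [ContinuousConstSMul G X]

/-- The isomorphism `E ≅ Hom(V_τ, Ind(V_τ ⊗ E))`. -/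
def Iso.homInduce (hE : E.IsBundle) {v₀ : τ.V} {ξ₀ : Module.Dual ℂ τ.V} (h₀ : ξ₀ v₀ = 1) :
    Iso E ((E.tensor hτ F hX).induce.hom hτ F hX) where
  toEquiv x := homInduceEquiv h₀ x
  continuous_toFun := continuous_hom_rng hτ F hX fun v =>
    (continuous_toInduce (isBundle_tensor hE)).comp
      (continuous_tensor_rng (k := fun e : E.Total => ⟨e.proj, tensorMk hτ F hX E e.proj e.snd v⟩)
        fun ξ => hE.continuous_const_smul hE.continuous_proj (ξ v) continuous_id)
  continuous_invFun := (continuous_tensor_eval ξ₀).comp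
    ((continuous_induceEval_one (isBundle_tensor hE)).comp
      (continuous_hom_eval_apply hτ F hX (E.tensor hτ F hX).induce v₀))
  map_act γ x y h f := by
    refine Subtype.ext (LinearMap.ext fun v => ?_)
    change toInduce (E.tensor hτ F hX) y (tensorMk hτ F hX E y (E.act γ h f) v) =
      (γ.phase : ℂ) • (E.tensor hτ F hX).induce.act (CentralExt.lift α (F.σ γ.base))
        (F.σ_smul hX h) (toInduce (E.tensor hτ F hX) x
          (tensorMk hτ F hX E x f (F.endMinv γ.base v)))
    let g : τ.stab := ⟨F.σ γ.base, F.σ_mem γ.base⟩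
    have hq : Frame.stabQuot g = γ.base := Subtype.ext (F.mk_σ γ.base)
    have hη : CentralExt.incl α τ.stab (CentralExt.lift _ g) =
      CentralExt.lift α (F.σ γ.base) := rfl
    have hg : (CentralExt.lift (α.res τ.stab) g).base • x = y := F.σ_smul hX h
    -- At `σ(q)` the extended action on `V_τ` is `M_q`, which cancels the `M_q⁻¹` in the action on
    -- `Hom`, leaving only the action of `q` on `E`.
    have hT : F.stabEnd (CentralExt.lift _ g) = F.endM γ.base := by
      rw [F.stabEnd_eq hq (a := 1) (by rw [map_one, mul_one, hη]), map_one, mul_one]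
    have hM : F.endM γ.base (F.endMinv γ.base v) = v := (F.M γ.base).apply_symm_apply v
    have hqq : CentralExt.lift (F.beta hτ) (Frame.stabQuot g) = CentralExt.lift _ γ.base := by
      rw [hq]
    have h4 : E.act (CentralExt.lift _ (Frame.stabQuot (CentralExt.lift (α.res τ.stab) g).base))
        (Frame.stabQuot_smul hX hg) f = E.act (CentralExt.lift _ γ.base) h f :=
      E.act_congr hqq _ h f
    have h5 := (induce_act_toInduce hη (F.σ_smul hX h) hg
      (tensorMk hτ F hX E x f (F.endMinv γ.base v))).trans (congrArg _ (tensor_act_tensorMk hg f _))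
    rw [hT, hM, h4] at h5
    refine Eq.trans ?_ (congrArg ((γ.phase : ℂ) • ·) h5.symm)
    rw [E.act_eq_phase_smul γ h h, map_smul, LinearMap.smul_apply, map_smul]

end HomInduce

end TwistedFamily

/-! ### The decomposition of the monoid of isomorphism classes -/

namespace Vect

section Hom

variable {G : Type w} [Group G] {α : NormalizedCocycle G} {A : Subgroup G} [A.Normal] [Finite A]
  {τ : ProjRep (α.res A)} (hτ : τ.IsIrreducible) (F : Frame τ)
  {X : Type u} [TopologicalSpace X] [MulAction G X] [MulAction (G ⧸ A) X]
  [ContinuousConstSMul G X] [ContinuousConstSMul (G ⧸ A) X]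
  (hX : ∀ (g : G) (x : X), (g : G ⧸ A) • x = g • x)

/-- The homomorphism `[E] ↦ [Hom(V_τ, E)]`. -/
def hom : Vect α X →+ Vect (F.beta hτ) X where
  toFun := Quotient.map (fun E => E.hom hτ F hX) fun _ _ ⟨i⟩ => ⟨i.hom hτ F hX⟩
  map_zero' := Quotient.sound ⟨.homZero hτ F hX TwistedFamily.isBundle_zero
    (fun _ _ _ => LinearMap.ext fun _ => Subsingleton.elim (α := PUnit) _ _)
    (TwistedFamily.isBundle_zero.continuous_zero_section continuous_id)⟩
  map_add' a b := Quotient.inductionOn₂ a b fun _ _ => Quotient.sound ⟨.homSum hτ F hX _ _⟩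

theorem hom_map {Y : Type v} [TopologicalSpace Y] [MulAction G Y] [MulAction (G ⧸ A) Y]
    [ContinuousConstSMul G Y] [ContinuousConstSMul (G ⧸ A) Y]
    (hY : ∀ (g : G) (y : Y), (g : G ⧸ A) • y = g • y) (f : C(Y, X))
    (hf : ∀ (g : G) y, f (g • y) = g • f y)
    (hf' : ∀ (q : τ.quotStab) y, f (q • y) = q • f y) (a : Vect α X) :
    hom hτ F hY (map f hf a) = map f hf' (hom hτ F hX a) :=
  Quotient.inductionOn a fun E =>
    Quotient.sound ⟨.homPullback hτ F hX hY hf hf' E.toTwistedFamily⟩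

end Hom

section Decomposition

variable {G : Type w} [Group G] [Finite G] {α : NormalizedCocycle G} {A : Subgroup G} [A.Normal]
  (d : ∀ o : MulAction.orbitRel.Quotient G (Irr (α.res A)), OrbitDatum A α o)
  {X : Type u} [TopologicalSpace X] [MulAction G X] [MulAction (G ⧸ A) X]
  [ContinuousConstSMul G X] [ContinuousConstSMul (G ⧸ A) X]
  (hX : ∀ (g : G) (x : X), (g : G ⧸ A) • x = g • x)

/-- The homomorphism `[E] ↦ ([Hom(V_τ, E)])_[τ]`. -/
def homPi : Vect α X →+ ∀ o, Vect (d o).beta X :=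
  AddMonoidHom.pi fun o => hom (d o).irreducible (d o).frame hX

theorem homPi_injective : Function.Injective (homPi d hX) := by
  have := Fintype.ofFinite A
  have := Fintype.ofFinite G
  have := Fintype.ofFinite (MulAction.orbitRel.Quotient G (Irr (α.res A)))
  intro a b
  refine Quotient.inductionOn₂ a b fun E E' h => Quotient.sound ⟨?_⟩
  have h1 : ∀ o, Nonempty (TwistedFamily.Iso
      (E.toTwistedFamily.hom (d o).irreducible (d o).frame hX)
      (E'.toTwistedFamily.hom (d o).irreducible (d o).frame hX)) :=
    fun o => Quotient.exact (congrFun h o)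
  exact TwistedFamily.Iso.ofHom d hX E.isBundle (fun o => (h1 o).some) E'.isBundle

open Classical in
-- The bundle `Ind(V_τ ⊗ E)` has `Hom(V_τ, ·) ≅ E`, and every equivariant map into it from a `V_τ'`
-- of another orbit is zero. Finite sums of such classes then give surjectivity.
theorem exists_homPi_eq_single (o : MulAction.orbitRel.Quotient G (Irr (α.res A)))
    (b : Vect (d o).beta X) : ∃ a, homPi d hX a = Pi.single o b := by
  obtain ⟨E, rfl⟩ : ∃ E, mk E = b := Quotient.exists_rep b
  obtain ⟨v₀, ξ₀, h₀⟩ := ProjRep.exists_dual_apply_eq_one (d o).irreducible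
  have hI := TwistedFamily.isBundle_induce (TwistedFamily.isBundle_tensor
    (hτ := (d o).irreducible) (F := (d o).frame) (hX := hX) E.isBundle)
  refine ⟨mk ⟨_, hI⟩, funext fun o' => ?_⟩
  obtain rfl | ho := eq_or_ne o' o
  · rw [Pi.single_eq_same]
    exact Quotient.sound ⟨(TwistedFamily.Iso.homInduce E.isBundle h₀).symm⟩
  · rw [Pi.single_eq_of_ne ho]
    refine Quotient.sound ⟨.homZero _ _ hX hI (fun x k hk => LinearMap.ext fun v =>
      TwistedFamily.induce_ext fun c => ?_) (hI.continuous_zero_section continuous_id)⟩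
    rw [TwistedFamily.induceEval_eq_zero (d o').irreducible hk _ fun hi =>
      ho (OrbitDatum.eq_of_translate_isIso d _ hi.symm).symm]
    exact (LinearMap.map_zero _).symm

/-- The isomorphism `[E] ↦ ([Hom(V_τ, E)])_[τ]`. -/
def homEquiv : Vect α X ≃+ ∀ o, Vect (d o).beta X :=
  AddEquiv.ofBijective (homPi d hX) ⟨homPi_injective d hX, fun b => by
    classical
    have := Fintype.ofFinite (MulAction.orbitRel.Quotient G (Irr (α.res A)))
    choose s hs using exists_homPi_eq_single d hX
    refine ⟨∑ o, s o (b o), ?_⟩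
    rw [map_sum]
    simp only [hs]
    exact Finset.univ_sum_single b⟩

end Decomposition

end Vect

/-! ### Grothendieck groups of finite products -/

section GrothendieckGroup

open Algebra

theorem grothendieckHom_ext {M N : Type*} [AddCommMonoid M] [AddCommGroup N]
    {φ ψ : GrothendieckAddGroup M →+ N}
    (h : ∀ m, φ (GrothendieckAddGroup.of m) = ψ (GrothendieckAddGroup.of m)) : φ = ψ :=
  GrothendieckAddGroup.lift.symm.injective (AddMonoidHom.ext h)

/-- The homomorphism of Grothendieck groups induced by a homomorphism of monoids. -/
def grothendieckMap {M N : Type*} [AddCommMonoid M] [AddCommMonoid N] (φ : M →+ N) :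
    GrothendieckAddGroup M →+ GrothendieckAddGroup N :=
  GrothendieckAddGroup.lift (GrothendieckAddGroup.of.comp φ)

theorem grothendieckMap_of {M N : Type*} [AddCommMonoid M] [AddCommMonoid N] (φ : M →+ N) (m : M) :
    grothendieckMap φ (GrothendieckAddGroup.of m) = GrothendieckAddGroup.of (φ m) :=
  congrArg (fun ψ : M →+ GrothendieckAddGroup N => ψ m)
    (GrothendieckAddGroup.lift.symm_apply_apply (GrothendieckAddGroup.of.comp φ))

variable {ι M : Type*} [Fintype ι] [DecidableEq ι] {N : ι → Type*} [AddCommMonoid M]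
  [∀ i, AddCommMonoid (N i)]

/-- The Grothendieck group of a finite product is the product of the Grothendieck groups. -/
def grothendieckPiEquiv (e : M ≃+ ∀ i, N i) :
    GrothendieckAddGroup M ≃+ ∀ i, GrothendieckAddGroup (N i) :=
  AddMonoidHom.toAddEquiv
    (AddMonoidHom.pi fun i => grothendieckMap ((Pi.evalAddMonoidHom N i).comp e.toAddMonoidHom))
    -- The inverse adds up the maps induced by the inclusions of the factors; the sum makes sense
    -- because the product is finite.
    (∑ i, (grothendieckMap (e.symm.toAddMonoidHom.comp (AddMonoidHom.single N i))).comp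
      (Pi.evalAddMonoidHom _ i))
    (grothendieckHom_ext fun m => by
      simp only [AddMonoidHom.comp_apply, AddMonoidHom.finsetSum_apply, Pi.evalAddMonoidHom_apply,
        AddMonoidHom.pi_apply, grothendieckMap_of, AddMonoidHom.id_apply, ← map_sum]
      congr 1
      exact e.symm_apply_eq.2 (Finset.univ_sum_single (e m)))
    (AddMonoidHom.ext fun ξ => funext fun j => by
      have h : ∀ i, (grothendieckMap ((Pi.evalAddMonoidHom N j).comp e.toAddMonoidHom)).comp
          (grothendieckMap (e.symm.toAddMonoidHom.comp (AddMonoidHom.single N i))) =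
          (Pi.evalAddMonoidHom (fun i => GrothendieckAddGroup (N i)) j).comp
            (AddMonoidHom.single (fun i => GrothendieckAddGroup (N i)) i) :=
        fun i => grothendieckHom_ext fun n => by
          simp only [AddMonoidHom.comp_apply, grothendieckMap_of, AddMonoidHom.single_apply,
            Pi.evalAddMonoidHom_apply, AddEquiv.coe_toAddMonoidHom, AddEquiv.apply_symm_apply]
          exact Pi.apply_single (fun i => (GrothendieckAddGroup.of : N i →+ _))
            (fun i => map_zero _) i n j
      simp only [AddMonoidHom.comp_apply, AddMonoidHom.finsetSum_apply, Pi.evalAddMonoidHom_apply,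
        AddMonoidHom.pi_apply, AddMonoidHom.id_apply, map_sum]
      simp only [← AddMonoidHom.comp_apply, h]
      exact (Finset.sum_apply j _ _).symm.trans (congrFun (Finset.univ_sum_single ξ) j))

end GrothendieckGroup

/-- An isomorphism onto a product restricts to an isomorphism of subgroups. -/
def subgroupPiEquiv {ι K : Type*} {L : ι → Type*} [AddCommGroup K] [∀ i, AddCommGroup (L i)]
    (Φ : K ≃+ ∀ i, L i) (S : AddSubgroup K) (T : ∀ i, AddSubgroup (L i))
    (h : ∀ k, k ∈ S ↔ ∀ i, Φ k i ∈ T i) : S ≃+ ∀ i, T i where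
  toFun k i := ⟨Φ k i, (h k).1 k.2 i⟩
  invFun l := ⟨Φ.symm fun i => l i, (h _).2 fun i => by
    rw [Φ.apply_symm_apply]
    exact (l i).2⟩
  left_inv k := Subtype.ext (Φ.symm_apply_apply k)
  right_inv l := funext fun i => Subtype.ext (congrFun (Φ.apply_symm_apply _) i)
  map_add' k k' := funext fun i => Subtype.ext (congrFun (Φ.map_add k k') i)

/-! ### The decomposition of twisted equivariant `K`-theory -/

section Decomposition

variable {G : Type w} [Group G] [Finite G] {α : NormalizedCocycle G} {A : Subgroup G} [A.Normal]
  (d : ∀ o : MulAction.orbitRel.Quotient G (Irr (α.res A)), OrbitDatum A α o)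

open Classical in
/-- The isomorphism `[E] ↦ ([Hom(V_τ, E)])_[τ]` of the groups `K⁰`. -/
def KZero.homEquiv {X : Type u} [TopologicalSpace X] [MulAction G X] [MulAction (G ⧸ A) X]
    [ContinuousConstSMul G X] [ContinuousConstSMul (G ⧸ A) X]
    (hX : ∀ (g : G) (x : X), (g : G ⧸ A) • x = g • x) : KZero α X ≃+ ∀ o, KZero (d o).beta X :=
  have := Fintype.ofFinite (MulAction.orbitRel.Quotient G (Irr (α.res A)))
  grothendieckPiEquiv (Vect.homEquiv d hX)

section

variable {X : Type u} [TopologicalSpace X] [MulAction G X] [MulAction (G ⧸ A) X]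
  [ContinuousConstSMul G X] [ContinuousConstSMul (G ⧸ A) X]
  (hX : ∀ (g : G) (x : X), (g : G ⧸ A) • x = g • x)

theorem KZero.homEquiv_of (a : Vect α X) (o) :
    homEquiv d hX (Algebra.GrothendieckAddGroup.of a) o = Algebra.GrothendieckAddGroup.of
      (Vect.hom (d o).irreducible (d o).frame hX a) :=
  grothendieckMap_of _ a

theorem KZero.homEquiv_mk (E : TwistedBundle α X) (o) :
    homEquiv d hX (mk E) o = mk (E.hom (d o).irreducible (d o).frame hX) :=
  homEquiv_of d hX (Vect.mk E) o

theorem KZero.homEquiv_map {Y : Type v} [TopologicalSpace Y] [MulAction G Y] [MulAction (G ⧸ A) Y]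
    [ContinuousConstSMul G Y] [ContinuousConstSMul (G ⧸ A) Y]
    (hY : ∀ (g : G) (y : Y), (g : G ⧸ A) • y = g • y) (f : C(Y, X))
    (hf : ∀ (g : G) y, f (g • y) = g • f y) (o)
    (hf' : ∀ (q : (d o).τ.quotStab) y, f (q • y) = q • f y) (ξ : KZero α X) :
    homEquiv d hY (map f hf ξ) o = map f hf' (homEquiv d hX ξ o) := by
  have h : ((Pi.evalAddMonoidHom _ o).comp (homEquiv d hY).toAddMonoidHom).comp (map f hf) =
      (map f hf').comp ((Pi.evalAddMonoidHom _ o).comp (homEquiv d hX).toAddMonoidHom) :=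
    grothendieckHom_ext fun a => by
      refine (congrArg (fun ξ => homEquiv d hY ξ o) (map_of f hf a)).trans ?_
      refine Eq.trans ?_ (congrArg (map f hf') (homEquiv_of d hX a o)).symm
      rw [homEquiv_of, map_of, Vect.hom_map]
  exact congrArg (fun φ : KZero α X →+ KZero (d o).beta Y => φ ξ) h

/-- Naturality for the inclusion of the base point compares the restrictions on both sides, and the
decomposition over a point is injective. Hence a class restricts to zero exactly when all its
components do. -/
theorem mem_reducedKZero_iff {z₀ : X} (h : ∀ g : G, g • z₀ = z₀)
    (h' : ∀ o, ∀ q : (d o).τ.quotStab, q • z₀ = z₀) (ξ : KZero α X) :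
    ξ ∈ reducedKZero α X z₀ h ↔
      ∀ o, KZero.homEquiv d hX ξ o ∈ reducedKZero (d o).beta X z₀ (h' o) := by
  have h1 : ∀ o, KZero.homEquiv d (X := PUnit.{1}) (fun _ _ => rfl)
      (KZero.map (ContinuousMap.const _ z₀) (fun g _ => (h g).symm) ξ) o =
      KZero.map (ContinuousMap.const _ z₀) (fun g _ => (h' o g).symm) (KZero.homEquiv d hX ξ o) :=
    fun o => KZero.homEquiv_map d hX _ _ _ o _ ξ
  simp only [reducedKZero, AddMonoidHom.mem_ker]
  rw [← map_eq_zero_iff _ (KZero.homEquiv d (X := PUnit.{1}) (fun _ _ => rfl)).injective,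
    funext_iff]
  exact forall_congr' fun o => Eq.congr_left (h1 o)

end

variable (X : TrivSpace.{u} A)

/-- The isomorphism `Φ_X` onto the product. -/
def KGroup.homPiEquiv : ∀ n, KGroup α n X ≃+ ∀ o, KGroup (d o).beta n X
  | 0 => KZero.homEquiv d X.mk_smul
  | n + 1 => subgroupPiEquiv (KZero.homEquiv d (X.mk_smul_susp (n + 1))) _
      (fun o => reducedKZero (d o).beta (Susp (n + 1) X) (Susp.pt _ X) Susp.smul_pt)
      (mem_reducedKZero_iff d (X.mk_smul_susp (n + 1)) Susp.smul_pt fun _ => Susp.smul_pt)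

theorem KGroup.homPiEquiv_map {X Y : TrivSpace.{u} A} (f : C(Y, X))
    (hf : ∀ (g : G) (y : Y), f (g • y) = g • f y) (n : ℕ) (ξ : KGroup α n X) (o) :
    homPiEquiv d Y n (map f hf n ξ) o =
      map f (TrivSpace.map_quotient_smul hf _) n (homPiEquiv d X n ξ o) :=
  match n, ξ with
  | 0, ξ => KZero.homEquiv_map d X.mk_smul Y.mk_smul f hf o (TrivSpace.map_quotient_smul hf _) ξ
  | n + 1, ξ => Subtype.ext (KZero.homEquiv_map d (X.mk_smul_susp (n + 1)) (Y.mk_smul_susp (n + 1))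
      ⟨Susp.map f, Susp.continuous_map f.continuous⟩ (Susp.map_smul f hf) o
      (Susp.map_smul f (TrivSpace.map_quotient_smul hf _)) ξ.1)

/-- The isomorphism `Φ_X`. -/
def KGroup.homSumEquiv (n : ℕ) : KGroup α n X ≃+ DirectSum _ (fun o => KGroup (d o).beta n X) :=
  have := Fintype.ofFinite (MulAction.orbitRel.Quotient G (Irr (α.res A)))
  (homPiEquiv d X n).trans (DirectSum.addEquivProd _).symm

theorem KGroup.homSumEquiv_apply (n : ℕ) (ξ : KGroup α n X) (o) :
    homSumEquiv d X n ξ o = homPiEquiv d X n ξ o :=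
  have := Fintype.ofFinite (MulAction.orbitRel.Quotient G (Irr (α.res A)))
  congrFun ((DirectSum.addEquivProd fun o => KGroup (d o).beta n X).apply_symm_apply
    (homPiEquiv d X n ξ)) o

end Decomposition

end TwistedK

end

open TwistedK in
theorem theorem1p1 {G : Type w} [Group G] [Finite G] (A : Subgroup G) [A.Normal]
    (α : NormalizedCocycle G) :
    (∀ τ : ProjRep (α.res A), τ.IsIrreducible → Nonempty (Frame τ)) ∧
    ∀ d : ∀ o : MulAction.orbitRel.Quotient G (Irr (α.res A)), OrbitDatum A α o,
      ∃ Φ : ∀ (X : TrivSpace.{u} A) (n : ℕ),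
          KGroup α n X ≃+ DirectSum _ (fun o => KGroup (d o).beta n X),
        (∀ (X : TrivSpace.{u} A) (E : TwistedBundle α X) (o),
          Φ X 0 (KGroup.ofKZero (KZero.mk E)) o =
            KGroup.ofKZero (KZero.mk (E.hom (d o).irreducible (d o).frame X.mk_smul))) ∧
        (∀ (X : TrivSpace.{u} A) (n : ℕ) (ξ : KGroup α (n + 1) X)
          (E E' : TwistedBundle α (Susp (n + 1) X)),
          ξ.toKZero = KZero.mk E - KZero.mk E' → ∀ o,
            (Φ X (n + 1) ξ o).toKZero =
              KZero.mk (E.hom (d o).irreducible (d o).frame (X.mk_smul_susp (n + 1))) -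
                KZero.mk (E'.hom (d o).irreducible (d o).frame (X.mk_smul_susp (n + 1)))) ∧
        (∀ (X Y : TrivSpace.{u} A) (f : C(Y, X)) (hf : ∀ (g : G) (y : Y), f (g • y) = g • f y)
          (n : ℕ) (ξ : KGroup α n X) (o),
          Φ Y n (KGroup.map f hf n ξ) o =
            KGroup.map f (TrivSpace.map_quotient_smul hf _) n (Φ X n ξ o)) := by
  refine ⟨fun τ hτ => nonempty_frame hτ, fun d => ⟨KGroup.homSumEquiv d, ?_, ?_, ?_⟩⟩
  · intro X E o
    exact (KGroup.homSumEquiv_apply d X 0 _ o).trans (KZero.homEquiv_mk d X.mk_smul E o)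
  · intro X n ξ E E' h o
    have h1 := KZero.homEquiv_mk d (X.mk_smul_susp (n + 1))
    refine (congrArg KGroup.toKZero (KGroup.homSumEquiv_apply d X (n + 1) ξ o)).trans ?_
    -- In positive degree the isomorphism is the restriction of the one for `K⁰` of the suspension.
    -- There it is additive and can be applied to `E` and `E'` separately, although their individual
    -- classes need not be reduced.
    change KZero.homEquiv d (X.mk_smul_susp (n + 1)) ξ.toKZero o = _
    rw [h, ← h1, ← h1, map_sub]
    rfl
  · intro X Y f hf n ξ o
    rw [KGroup.homSumEquiv_apply, KGroup.homSumEquiv_apply]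
    exact KGroup.homPiEquiv_map d f hf n ξ o
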